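/- Let $N\ge 3$, $2^*=2N/(N-2)$, $p,q\in(2,2^*)$ and $\mu>0$, and let $H^1=H^1(\mathbb R^N)$ be the Sobolev space of real-valued, or of complex-valued, functions (the statement holds in both cases). For $u\in H^1$ put $$H_\mu(u)=\int_{\mathbb R^N}\Big(\tfrac12|\nabla u|^2-\tfrac{\mu}{p}|u|^p+\tfrac1q|u|^q\Big)dx,\qquad Q(u)=\tfrac12\int_{\mathbb R^N}|u|^2dx,\qquad S_{\lambda,\mu}(u)=H_\mu(u)-\lambda Q(u),$$ and, for $S>0$ and $u\ne0$, $$\Lambda^S_\mu(u)=\frac{H_\mu(u)-S}{Q(u)},\qquad \lambda^S_\mu(u)=\frac{c^S_N\big(\int|\nabla u|^2\big)^{N/(N-2)}-\mu\frac2p\int|u|^p+\frac2q\int|u|^q}{\int|u|^2},\qquad c_N^S=\frac{N-2}{N^{N/(N-2)}S^{2/(N-2)}}.$$ Here $DF(w)=0$ means that all Gateaux derivatives of $F$ at $w$ along real lines in $H^1$ vanish. Consider, for $\lambda\in\mathbb R$, weak solutions in $H^1$ of $$-\Delta u-\lambda u-\mu|u|^{p-2}u+|u|^{q-2}u=0\quad\text{in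 }\mathbb R^N. \tag{1S}$$ A weak solution $u\neq0$ of (1S) is a ground state if $S_{\lambda,\mu}(u)\le S_{\lambda,\mu}(w)$ for every $w\in H^1\setminus\{0\}$ with $DS_{\lambda,\mu}(w)=0$. For $S>0$, a weak solution $u\ne0$ of (1S) is a fundamental frequency solution with action $S$ and fundamental frequency $\lambda=\hat\lambda^S_\mu$ if $\lambda=\Lambda^S_\mu(u)\le\Lambda^S_\mu(w)$ for every $w\in H^1\setminus\{0\}$ with $D\Lambda^S_\mu(w)=0$. $(1^o)$ Let $S>0$ and let $u$ be a fundamental frequency solution with action $S$ whose fundamental frequency $\lambda=\hat\lambda^S_\mu$ is negative. Then $u$ is a ground state of (1S) with this $\lambda$, and its ground level is $S_{\lambda,\mu}(u)=S$. $(2^o)$ Let $\lambda<0$, let $u$ be a ground state of (1S), and put $S=S_{\lambda,\mu}(u)$. Then $S>0$, and $u$ is a fundamental frequency solution with action $S$ and fundamental frequency $\lambda=\hat\lambda^S_\mu$; moreover $\lambda=\min_{v\in H^1\setminus\{0\}}\lambda^S_\mu(v)$. -/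

import Mathlib

open MeasureTheory
open scoped ContDiff

namespace NLS

noncomputable section

/-- `g` is the weak (distributional) gradient of `u` on `ℝ^N`. -/
def IsWeakGradient {𝕜 : Type*} [RCLike 𝕜] {N : ℕ} (u : EuclideanSpace ℝ (Fin N) → 𝕜)
    (g : EuclideanSpace ℝ (Fin N) → EuclideanSpace 𝕜 (Fin N)) : Prop :=
  ∀ φ : EuclideanSpace ℝ (Fin N) → ℝ, ContDiff ℝ ∞ φ → HasCompactSupport φ → ∀ i : Fin N,
    ∫ x, fderiv ℝ φ x (EuclideanSpace.single i (1 : ℝ)) • u x = - ∫ x, φ x • g x i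

theorem integrable_smul_of_test {𝕜 : Type*} [RCLike 𝕜] {N : ℕ}
    {ψ : EuclideanSpace ℝ (Fin N) → ℝ} (hψ : Continuous ψ) (hc : HasCompactSupport ψ)
    {f : EuclideanSpace ℝ (Fin N) → 𝕜} (hf : MemLp f 2 volume) :
    Integrable (fun x => ψ x • f x) volume :=
  memLp_one_iff_integrable.mp (hf.smul (r := 1) (hψ.memLp_of_hasCompactSupport hc (p := 2)))

theorem continuous_fderiv_test {N : ℕ} {φ : EuclideanSpace ℝ (Fin N) → ℝ}
    (hφ : ContDiff ℝ ∞ φ) (v : EuclideanSpace ℝ (Fin N)) :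
    Continuous (fun x => fderiv ℝ φ x v) :=
  (hφ.continuous_fderiv (by simp)).clm_apply continuous_const

theorem memLp_coord {𝕜 : Type*} [RCLike 𝕜] {N : ℕ}
    {g : EuclideanSpace ℝ (Fin N) → EuclideanSpace 𝕜 (Fin N)} (hg : MemLp g 2 volume)
    (i : Fin N) : MemLp (fun x => g x i) 2 volume :=
  (EuclideanSpace.proj (𝕜 := 𝕜) i).comp_memLp' hg

/-- The Sobolev space `H¹(ℝ^N)` of `𝕜`-valued functions (`𝕜 = ℝ` or `ℂ`): the classes in `L²`
that have a weak gradient in `L²`. It is regarded as a real vector space, because the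
functionals below are real-valued and are differentiated along real lines. -/
def H1 (𝕜 : Type*) [RCLike 𝕜] (N : ℕ) :
    Submodule ℝ (Lp 𝕜 2 (volume : Measure (EuclideanSpace ℝ (Fin N)))) where
  carrier := {u | ∃ g : Lp (EuclideanSpace 𝕜 (Fin N)) 2
    (volume : Measure (EuclideanSpace ℝ (Fin N))), IsWeakGradient u g}
  zero_mem' := by
    refine ⟨0, fun φ _ _ i => ?_⟩
    have h1 : ∫ x, fderiv ℝ φ x (EuclideanSpace.single i (1 : ℝ)) •
        (0 : Lp 𝕜 2 (volume : Measure (EuclideanSpace ℝ (Fin N)))) x = 0 := by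
      refine integral_eq_zero_of_ae ?_
      filter_upwards [Lp.coeFn_zero 𝕜 2 (volume : Measure (EuclideanSpace ℝ (Fin N)))] with x hx
      rw [hx]; simp
    have h2 : ∫ x, φ x • (0 : Lp (EuclideanSpace 𝕜 (Fin N)) 2
        (volume : Measure (EuclideanSpace ℝ (Fin N)))) x i = 0 := by
      refine integral_eq_zero_of_ae ?_
      filter_upwards [Lp.coeFn_zero (EuclideanSpace 𝕜 (Fin N)) 2
        (volume : Measure (EuclideanSpace ℝ (Fin N)))] with x hx
      rw [hx]; simp
    rw [h1, h2, neg_zero]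
  add_mem' := by
    rintro u v ⟨g, hg⟩ ⟨h, hh⟩
    refine ⟨g + h, fun φ hφ hc i => ?_⟩
    have hd := continuous_fderiv_test hφ (EuclideanSpace.single i (1 : ℝ))
    have hdc := hc.fderiv_apply (𝕜 := ℝ) (EuclideanSpace.single i (1 : ℝ))
    have h1 : ∫ x, fderiv ℝ φ x (EuclideanSpace.single i (1 : ℝ)) • (u + v) x =
        ∫ x, (fderiv ℝ φ x (EuclideanSpace.single i (1 : ℝ)) • u x +
          fderiv ℝ φ x (EuclideanSpace.single i (1 : ℝ)) • v x) := by
      refine integral_congr_ae ?_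
      filter_upwards [Lp.coeFn_add u v] with x hx
      rw [hx, Pi.add_apply, smul_add]
    have h2 : ∫ x, φ x • (g + h) x i = ∫ x, (φ x • g x i + φ x • h x i) := by
      refine integral_congr_ae ?_
      filter_upwards [Lp.coeFn_add g h] with x hx
      rw [hx, Pi.add_apply, PiLp.add_apply, smul_add]
    rw [h1, h2, integral_add (integrable_smul_of_test hd hdc (Lp.memLp u))
      (integrable_smul_of_test hd hdc (Lp.memLp v)),
      integral_add (integrable_smul_of_test hφ.continuous hc (memLp_coord (Lp.memLp g) i))
      (integrable_smul_of_test hφ.continuous hc (memLp_coord (Lp.memLp h) i)),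
      hg φ hφ hc i, hh φ hφ hc i, neg_add]
  smul_mem' := by
    rintro c u ⟨g, hg⟩
    refine ⟨c • g, fun φ hφ hc i => ?_⟩
    have h1 : ∫ x, fderiv ℝ φ x (EuclideanSpace.single i (1 : ℝ)) • (c • u) x =
        ∫ x, c • (fderiv ℝ φ x (EuclideanSpace.single i (1 : ℝ)) • u x) := by
      refine integral_congr_ae ?_
      filter_upwards [Lp.coeFn_smul c u] with x hx
      rw [hx, Pi.smul_apply, smul_comm]
    have h2 : ∫ x, φ x • (c • g) x i = ∫ x, c • (φ x • g x i) := by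
      refine integral_congr_ae ?_
      filter_upwards [Lp.coeFn_smul c g] with x hx
      rw [hx, Pi.smul_apply, PiLp.smul_apply, smul_comm]
    rw [h1, h2, integral_smul, integral_smul, hg φ hφ hc i, smul_neg]

/-- The weak gradient `∇u ∈ L²` of `u ∈ H¹` (it is unique as an element of `L²`). -/
def grad {𝕜 : Type*} [RCLike 𝕜] {N : ℕ} (u : H1 𝕜 N) :
    Lp (EuclideanSpace 𝕜 (Fin N)) 2 (volume : Measure (EuclideanSpace ℝ (Fin N))) :=
  Classical.choose u.2

theorem grad_spec {𝕜 : Type*} [RCLike 𝕜] {N : ℕ} (u : H1 𝕜 N) :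
    IsWeakGradient (u : Lp 𝕜 2 (volume : Measure (EuclideanSpace ℝ (Fin N)))) (grad u) :=
  Classical.choose_spec u.2

/-- The pointwise value of (a representative of) `u ∈ H¹`. -/
def val {𝕜 : Type*} [RCLike 𝕜] {N : ℕ} (u : H1 𝕜 N) (x : EuclideanSpace ℝ (Fin N)) : 𝕜 :=
  (u : Lp 𝕜 2 (volume : Measure (EuclideanSpace ℝ (Fin N)))) x

/-- The critical Sobolev exponent `2* = 2N/(N-2)`. -/
def critExp (N : ℕ) : ℝ := 2 * (N : ℝ) / ((N : ℝ) - 2)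

/-- `T(u) = ∫ |∇u|²`. -/
def dirichlet {𝕜 : Type*} [RCLike 𝕜] {N : ℕ} (u : H1 𝕜 N) : ℝ := ∫ x, ‖grad u x‖ ^ 2

/-- `∫ |u|^r`. -/
def powInt {𝕜 : Type*} [RCLike 𝕜] {N : ℕ} (r : ℝ) (u : H1 𝕜 N) : ℝ := ∫ x, ‖val u x‖ ^ r

/-- The mass `Q(u) = ½ ∫ |u|²`. -/
def mass {𝕜 : Type*} [RCLike 𝕜] {N : ℕ} (u : H1 𝕜 N) : ℝ := 1 / 2 * ∫ x, ‖val u x‖ ^ 2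

/-- The energy `H_μ(u) = ∫ (½ |∇u|² - (μ/p) |u|^p + (1/q) |u|^q)`. -/
def energy {𝕜 : Type*} [RCLike 𝕜] {N : ℕ} (p q μ : ℝ) (u : H1 𝕜 N) : ℝ :=
  1 / 2 * dirichlet u - μ / p * powInt p u + 1 / q * powInt q u

/-- The action `S_{λ,μ}(u) = H_μ(u) - λ Q(u)`. -/
def action {𝕜 : Type*} [RCLike 𝕜] {N : ℕ} (p q μ lam : ℝ) (u : H1 𝕜 N) : ℝ :=
  energy p q μ u - lam * mass u

/-- The action-level Rayleigh quotient `Λ^S_μ(u) = (H_μ(u) - S) / Q(u)`. -/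
def rayleigh {𝕜 : Type*} [RCLike 𝕜] {N : ℕ} (p q μ S : ℝ) (u : H1 𝕜 N) : ℝ :=
  (energy p q μ u - S) / mass u

/-- The constant `c_N^S = (N-2) / (N^{N/(N-2)} S^{2/(N-2)})`. -/
def cNS (N : ℕ) (S : ℝ) : ℝ :=
  ((N : ℝ) - 2) / ((N : ℝ) ^ ((N : ℝ) / ((N : ℝ) - 2)) * S ^ (2 / ((N : ℝ) - 2)))

/-- The nonlinear generalized Rayleigh quotient
`λ^S_μ(u) = (c_N^S (∫|∇u|²)^{N/(N-2)} - μ (2/p) ∫|u|^p + (2/q) ∫|u|^q) / ∫|u|²`. -/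
def ngRayleigh {𝕜 : Type*} [RCLike 𝕜] {N : ℕ} (p q μ S : ℝ) (u : H1 𝕜 N) : ℝ :=
  (cNS N S * dirichlet u ^ ((N : ℝ) / ((N : ℝ) - 2)) - μ * (2 / p) * powInt p u
    + 2 / q * powInt q u) / ∫ x, ‖val u x‖ ^ 2

/-- `DF(u) = 0`: the Gateaux derivative of `F : H¹ → ℝ` at `u` exists in every direction and
vanishes. -/
def IsCriticalPoint {𝕜 : Type*} [RCLike 𝕜] {N : ℕ} (F : H1 𝕜 N → ℝ) (u : H1 𝕜 N) : Prop :=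
  ∀ φ : H1 𝕜 N, HasDerivAt (fun t : ℝ => F (u + t • φ)) 0 0

/-- `u ∈ H¹` is a weak solution of `-Δu - λu - μ|u|^{p-2}u + |u|^{q-2}u = 0` in `ℝ^N`. The real
part of the tested equation is enough, because for `𝕜 = ℂ` one may test with `iφ` as well. -/
def IsWeakSolution {𝕜 : Type*} [RCLike 𝕜] {N : ℕ} (p q μ lam : ℝ) (u : H1 𝕜 N) : Prop :=
  ∀ φ : H1 𝕜 N,
    ∫ x, (RCLike.re (inner 𝕜 (grad φ x) (grad u x))
      - lam * RCLike.re (inner 𝕜 (val φ x) (val u x))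
      - μ * (‖val u x‖ ^ (p - 2) * RCLike.re (inner 𝕜 (val φ x) (val u x)))
      + ‖val u x‖ ^ (q - 2) * RCLike.re (inner 𝕜 (val φ x) (val u x))) = 0

/-- `u` is a ground state with frequency `lam`: a nonzero solution whose action is least among
all nonzero critical points of the action. -/
def IsGroundState {𝕜 : Type*} [RCLike 𝕜] {N : ℕ} (p q μ lam : ℝ) (u : H1 𝕜 N) : Prop :=
  u ≠ 0 ∧ IsWeakSolution p q μ lam u ∧
    ∀ w : H1 𝕜 N, w ≠ 0 → IsCriticalPoint (action p q μ lam) w →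
      action p q μ lam u ≤ action p q μ lam w

/-- `u` is a fundamental frequency solution, for the action `S`, with fundamental frequency
`lam`: a nonzero solution with frequency `lam = Λ^S_μ(u)`, and `lam ≤ Λ^S_μ(w)` for every nonzero
critical point `w` of `Λ^S_μ`. -/
def IsFundamentalFrequencySolution {𝕜 : Type*} [RCLike 𝕜] {N : ℕ} (p q μ S lam : ℝ)
    (u : H1 𝕜 N) : Prop :=
  u ≠ 0 ∧ IsWeakSolution p q μ lam u ∧ lam = rayleigh p q μ S u ∧
    ∀ w : H1 𝕜 N, w ≠ 0 → IsCriticalPoint (rayleigh p q μ S) w → lam ≤ rayleigh p q μ S w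

end

end NLS

/-!
The two minimization problems are linked by the nonlinear generalized Rayleigh quotient
`λ^S(v)`, through the functional

  `gap c ℓ v = c (∫|∇v|²) ^ κ - μ (2/p) ∫|v| ^ p + (2/q) ∫|v| ^ q - ℓ ∫|v|²`,  `κ = N/(N-2)`.

For `c = c_N^S` the inequality `ℓ ≤ λ^S(v)` says `gap c ℓ v ≥ 0`. All the terms of the gap scale
in the same way under dilations `v(x) ↦ v(a x)`, so only the sign of the gap matters, and the
Dirichlet integral may be normalized. A zero of a nonnegative gap is a minimizer; dilated so that
`c κ (∫|∇v|²) ^ (κ - 1) = 1`, that is `∫|∇v|² = N S`, it becomes a solution of the equation with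
frequency `ℓ` and action `S` (`exists_solution_of_gap_eq_zero`).

Conversely, if `v` satisfies the Pohozaev identity with frequency `λ`, then its action is
`S_v = (1/N) ∫|∇v|²`, and `gap c_N^S λ v` is negative, zero or positive according to whether
`S_v` is below, at or above `S` (`gap_eq_of_pohozaev`). Below every solution there is such a `v`
(`exists_pohozaev`).

Three analytic facts carry the argument.

* The minimum is attained for `ℓ < 0` (`exists_gap_eq_zero`). A minimizing sequence with
  `∫|∇v|² = 1` is bounded in `H¹`, and has translates that do not vanish in the limit
  (`exists_translate_nonvanishing`). By the Brezis–Lieb lemma the gap splits along the weak limit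
  and the remainder, and strict superadditivity of `T ↦ T ^ κ` excludes a loss of Dirichlet energy.
  Sobolev's inequality, approximation by mollification and local compactness are proved on the
  way for the space `H1` of the statement.
* If the gap at `(S, λ)`, `λ < 0`, is negative somewhere, one may lower the frequency at fixed
  action (`exists_solution_lower_frequency`), or the action at fixed frequency
  (`exists_solution_lower_action`), until the minimum is zero; this gives a solution with frequency
  below `λ` and action `S`, or with frequency `λ` and action below `S`.
* The Pohozaev comparison `exists_pohozaev`. If `q ≤ p`, the action of a solution `w` is maximal
  along the ray `t w`, which meets the Pohozaev set. If `p < q`, the solution satisfies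
  the identity itself. The usual proof multiplies by `x · ∇w` and needs `H²` regularity; here the
  equation is tested with the localized difference `χ (w((1 + τ) ·) - w)`, and convexity of
  `|∇w|²` with semiconcavity of the potential bounds the first variation of the action under
  dilations from both sides.

Given a fundamental frequency solution, a critical point with smaller action would make the gap
negative, and lowering the frequency would contradict minimality. Given a ground state with action
`S`, a negative gap would allow the action to be lowered; so `λ` bounds `λ^S` from below,
it is attained by the function from the Pohozaev comparison, and a critical point of `Λ^S` with a
smaller frequency would give a smaller value of `λ^S`.
-/

namespace NLS

open Filter Topology
open scoped ENNReal NNReal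

section Basics

variable {𝕜 : Type*} [RCLike 𝕜] {N : ℕ} {F : Type*} [NormedAddCommGroup F]

local notation "𝔼" => EuclideanSpace ℝ (Fin N)
local notation "𝔾" => EuclideanSpace 𝕜 (Fin N)

/-! ### Affine changes of variables -/

theorem map_affine_volume {a : ℝ} (ha : a ≠ 0) (y : 𝔼) :
    Measure.map (fun x : 𝔼 => a • x + y) volume
      = ENNReal.ofReal |(a ^ N)⁻¹| • (volume : Measure 𝔼) := by
  have h : (fun x : 𝔼 => a • x + y) = (fun x => x + y) ∘ (fun x => a • x) := rfl
  rw [h, ← Measure.map_map (measurable_add_const y) (measurable_const_smul a),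
    Measure.map_addHaar_smul _ ha, Measure.map_smul, map_add_right_eq_self]
  simp

theorem measurableEmbedding_affine {a : ℝ} (ha : a ≠ 0) (y : 𝔼) :
    MeasurableEmbedding (fun x : 𝔼 => a • x + y) :=
  ((Homeomorph.smulOfNeZero a ha).trans (Homeomorph.addRight y)).measurableEmbedding

theorem quasiMeasurePreserving_affine {a : ℝ} (ha : a ≠ 0) (y : 𝔼) :
    Measure.QuasiMeasurePreserving (fun x : 𝔼 => a • x + y) volume volume := by
  refine ⟨(measurableEmbedding_affine ha y).measurable, ?_⟩
  rw [map_affine_volume ha y]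
  exact Measure.smul_absolutelyContinuous

theorem lintegral_comp_affine {a : ℝ} (ha : a ≠ 0) (y : 𝔼) (f : 𝔼 → ℝ≥0∞) :
    ∫⁻ x, f (a • x + y) = ENNReal.ofReal |(a ^ N)⁻¹| * ∫⁻ x, f x := by
  rw [← (measurableEmbedding_affine ha y).lintegral_map f, map_affine_volume ha y,
    lintegral_smul_measure, smul_eq_mul]

theorem integral_comp_affine [NormedSpace ℝ F] {a : ℝ} (ha : a ≠ 0) (y : 𝔼) (f : 𝔼 → F) :
    ∫ x, f (a • x + y) = |(a ^ N)⁻¹| • ∫ x, f x := by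
  rw [← (measurableEmbedding_affine ha y).integral_map f, map_affine_volume ha y,
    integral_smul_measure, ENNReal.toReal_ofReal (abs_nonneg _)]

theorem memLp_comp_affine {a : ℝ} (ha : a ≠ 0) (y : 𝔼) {p : ℝ≥0∞} {f : 𝔼 → F}
    (hf : MemLp f p volume) : MemLp (fun x => f (a • x + y)) p volume := by
  refine ((measurableEmbedding_affine ha y).memLp_map_measure_iff (g := f)).1 ?_
  rw [map_affine_volume ha y]
  exact hf.smul_measure ENNReal.ofReal_ne_top

/-! ### Functions with a weak gradient -/

/-- `u ∈ L²` has the weak gradient `g ∈ L²`. This is membership in `H¹` at the level of functions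
rather than of classes, with the gradient as an explicit datum. -/
structure HasSobGrad (u : 𝔼 → 𝕜) (g : 𝔼 → 𝔾) : Prop where
  memLp : MemLp u 2 volume
  memLp_grad : MemLp g 2 volume
  weak : IsWeakGradient u g

theorem IsWeakGradient.congr {u u' : 𝔼 → 𝕜} {g g' : 𝔼 → 𝔾} (h : IsWeakGradient u g)
    (hu : u =ᵐ[volume] u') (hg : g =ᵐ[volume] g') : IsWeakGradient u' g' := by
  intro φ hφ hc i
  have h1 : ∫ x, fderiv ℝ φ x (EuclideanSpace.single i (1 : ℝ)) • u' x
      = ∫ x, fderiv ℝ φ x (EuclideanSpace.single i (1 : ℝ)) • u x :=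
    integral_congr_ae (hu.mono fun x hx => by simp only [hx])
  have h2 : ∫ x, φ x • g' x i = ∫ x, φ x • g x i :=
    integral_congr_ae (hg.mono fun x hx => by simp only [hx])
  rw [h1, h2, h φ hφ hc i]

theorem HasSobGrad.congr {u u' : 𝔼 → 𝕜} {g g' : 𝔼 → 𝔾} (h : HasSobGrad u g)
    (hu : u =ᵐ[volume] u') (hg : g =ᵐ[volume] g') : HasSobGrad u' g' :=
  ⟨h.memLp.ae_eq hu, h.memLp_grad.ae_eq hg, h.weak.congr hu hg⟩

theorem IsWeakGradient.ae_unique {u : 𝔼 → 𝕜} {g g' : 𝔼 → 𝔾} (h : IsWeakGradient u g)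
    (h' : IsWeakGradient u g') (hg : MemLp g 2 volume) (hg' : MemLp g' 2 volume) :
    g =ᵐ[volume] g' := by
  have key : ∀ i, ∀ᵐ x, g x i - g' x i = 0 := by
    intro i
    refine ae_eq_zero_of_integral_contDiff_smul_eq_zero
      (((memLp_coord hg i).sub (memLp_coord hg' i)).locallyIntegrable (by norm_num)) ?_
    intro φ hφ hc
    have e : ∫ x, φ x • (g x i - g' x i) = ∫ x, (φ x • g x i - φ x • g' x i) := by
      simp only [smul_sub]
    rw [e, integral_sub (integrable_smul_of_test hφ.continuous hc (memLp_coord hg i))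
      (integrable_smul_of_test hφ.continuous hc (memLp_coord hg' i))]
    have := (h φ hφ hc i).symm.trans (h' φ hφ hc i)
    rw [neg_inj] at this
    rw [this, sub_self]
  filter_upwards [ae_all_iff.2 key] with x hx
  ext i
  exact sub_eq_zero.1 (hx i)

theorem hasSobGrad_val (u : H1 𝕜 N) : HasSobGrad (val u) (grad u) :=
  ⟨Lp.memLp _, Lp.memLp _, grad_spec u⟩

theorem HasSobGrad.add {u v : 𝔼 → 𝕜} {g h : 𝔼 → 𝔾} (hu : HasSobGrad u g)
    (hv : HasSobGrad v h) : HasSobGrad (fun x => u x + v x) (fun x => g x + h x) := by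
  refine ⟨hu.memLp.add hv.memLp, hu.memLp_grad.add hv.memLp_grad, fun φ hφ hc i => ?_⟩
  have hd := continuous_fderiv_test hφ (EuclideanSpace.single i (1 : ℝ))
  have hdc := hc.fderiv_apply (𝕜 := ℝ) (EuclideanSpace.single i (1 : ℝ))
  simp only [smul_add, PiLp.add_apply]
  rw [integral_add (integrable_smul_of_test hd hdc hu.memLp)
      (integrable_smul_of_test hd hdc hv.memLp),
    integral_add (integrable_smul_of_test hφ.continuous hc (memLp_coord hu.memLp_grad i))
      (integrable_smul_of_test hφ.continuous hc (memLp_coord hv.memLp_grad i)),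
    hu.weak φ hφ hc i, hv.weak φ hφ hc i, neg_add]

theorem HasSobGrad.smul {u : 𝔼 → 𝕜} {g : 𝔼 → 𝔾} (hu : HasSobGrad u g) (c : ℝ) :
    HasSobGrad (fun x => c • u x) (fun x => c • g x) := by
  refine ⟨hu.memLp.const_smul c, hu.memLp_grad.const_smul c, fun φ hφ hc i => ?_⟩
  simp only [PiLp.smul_apply, smul_comm _ c]
  rw [integral_smul, integral_smul, hu.weak φ hφ hc i, smul_neg]

theorem HasSobGrad.sub {u v : 𝔼 → 𝕜} {g h : 𝔼 → 𝔾} (hu : HasSobGrad u g)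
    (hv : HasSobGrad v h) : HasSobGrad (fun x => u x - v x) (fun x => g x - h x) := by
  simpa [sub_eq_add_neg] using hu.add (hv.smul (-1))

theorem HasSobGrad.ae_unique {u : 𝔼 → 𝕜} {g g' : 𝔼 → 𝔾} (h : HasSobGrad u g)
    (h' : HasSobGrad u g') : g =ᵐ[volume] g' :=
  h.weak.ae_unique h'.weak h.memLp_grad h'.memLp_grad

/-- The element of `H¹` represented by a function with a weak gradient. -/
noncomputable def HasSobGrad.toH1 {u : 𝔼 → 𝕜} {g : 𝔼 → 𝔾} (h : HasSobGrad u g) : H1 𝕜 N :=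
  ⟨h.memLp.toLp u, h.memLp_grad.toLp g,
    h.weak.congr h.memLp.coeFn_toLp.symm h.memLp_grad.coeFn_toLp.symm⟩

theorem HasSobGrad.val_toH1 {u : 𝔼 → 𝕜} {g : 𝔼 → 𝔾} (h : HasSobGrad u g) :
    val h.toH1 =ᵐ[volume] u :=
  h.memLp.coeFn_toLp

theorem grad_ae_eq {u : H1 𝕜 N} {v : 𝔼 → 𝕜} {g : 𝔼 → 𝔾} (h : HasSobGrad v g)
    (huv : val u =ᵐ[volume] v) : grad u =ᵐ[volume] g :=
  (hasSobGrad_val u).ae_unique (h.congr huv.symm EventuallyEq.rfl)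

theorem HasSobGrad.grad_toH1 {u : 𝔼 → 𝕜} {g : 𝔼 → 𝔾} (h : HasSobGrad u g) :
    grad h.toH1 =ᵐ[volume] g :=
  grad_ae_eq h h.val_toH1

theorem val_add_smul (u φ : H1 𝕜 N) (t : ℝ) :
    val (u + t • φ) =ᵐ[volume] fun x => val u x + t • val φ x := by
  filter_upwards [Lp.coeFn_add u.1 (t • φ.1), Lp.coeFn_smul t φ.1] with x h1 h2
  exact h1.trans (congrArg (val u x + ·) h2)

theorem grad_add_smul (u φ : H1 𝕜 N) (t : ℝ) :
    grad (u + t • φ) =ᵐ[volume] fun x => grad u x + t • grad φ x :=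
  grad_ae_eq ((hasSobGrad_val u).add ((hasSobGrad_val φ).smul t)) (val_add_smul u φ t)

theorem val_ae_zero_iff {u : H1 𝕜 N} : val u =ᵐ[volume] 0 ↔ u = 0 := by
  rw [← Submodule.coe_eq_zero (x := u)]
  exact (Lp.eq_zero_iff_ae_eq_zero (f := u.1)).symm

theorem HasSobGrad.comp_affine {u : 𝔼 → 𝕜} {g : 𝔼 → 𝔾} (hu : HasSobGrad u g) {a : ℝ}
    (ha : a ≠ 0) (y : 𝔼) :
    HasSobGrad (fun x => u (a • x + y)) (fun x => a • g (a • x + y)) := by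
  refine ⟨memLp_comp_affine ha y hu.memLp, (memLp_comp_affine ha y hu.memLp_grad).const_smul a,
    fun φ hφ hc i => ?_⟩
  set e := EuclideanSpace.single i (1 : ℝ) with he
  -- the test function transported by the inverse change of variables
  let ψ : 𝔼 → ℝ := fun z => φ (a⁻¹ • (z - y))
  have hinv : ∀ x : 𝔼, a⁻¹ • (a • x + y - y) = x := fun x => by
    rw [add_sub_cancel_right, smul_smul, inv_mul_cancel₀ ha, one_smul]
  have hψ : ContDiff ℝ ∞ ψ := by
    have : ContDiff ℝ ∞ fun z : 𝔼 => a⁻¹ • (z - y) := by fun_prop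
    exact hφ.comp this
  have hψc : HasCompactSupport ψ :=
    hc.comp_homeomorph
      ((Homeomorph.subRight y).trans (Homeomorph.smulOfNeZero a⁻¹ (inv_ne_zero ha)))
  have hd : ∀ z, fderiv ℝ ψ z e = a⁻¹ * fderiv ℝ φ (a⁻¹ • (z - y)) e := by
    intro z
    have h1 : HasFDerivAt (fun z : 𝔼 => a⁻¹ • (z - y)) (a⁻¹ • ContinuousLinearMap.id ℝ 𝔼) z :=
      ((hasFDerivAt_id z).sub_const y).const_smul a⁻¹
    have h2 := ((hφ.differentiable (by simp)).differentiableAt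
      (x := a⁻¹ • (z - y))).hasFDerivAt.comp z h1
    rw [show fderiv ℝ ψ z = _ from h2.fderiv]
    simp
  have h1 : ∫ x, fderiv ℝ φ x e • u (a • x + y)
      = |(a ^ N)⁻¹| • ∫ z, a • (fderiv ℝ ψ z e • u z) := by
    rw [← integral_comp_affine ha y]
    refine integral_congr_ae (Eventually.of_forall fun x => ?_)
    simp only [hd, hinv, smul_smul]
    rw [← mul_assoc, mul_inv_cancel₀ ha, one_mul]
  have h2 : ∫ x, φ x • (a • g (a • x + y)) i = |(a ^ N)⁻¹| • ∫ z, a • (ψ z • g z i) := by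
    rw [← integral_comp_affine ha y]
    refine integral_congr_ae (Eventually.of_forall fun x => ?_)
    simp only [ψ, hinv, PiLp.smul_apply]
    rw [smul_comm]
  rw [h1, h2, integral_smul, integral_smul, hu.weak ψ hψ hψc i, smul_neg, smul_neg]

end Basics

section Mollification

variable {𝕜 : Type*} [RCLike 𝕜] {N : ℕ} {F : Type*} [NormedAddCommGroup F] [NormedSpace ℝ F]

local notation "𝔼" => EuclideanSpace ℝ (Fin N)
local notation "𝔾" => EuclideanSpace 𝕜 (Fin N)

/-! ### Mollification -/

theorem sq_eLpNorm_two {α : Type*} {m : MeasurableSpace α} {ν : Measure α} {F : Type*}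
    [NormedAddCommGroup F] (f : α → F) :
    eLpNorm f 2 ν ^ 2 = ∫⁻ x, ‖f x‖ₑ ^ 2 ∂ν := by
  have := eLpNorm_nnreal_pow_eq_lintegral (f := f) (μ := ν) (p := 2) (by norm_num)
  simpa using this

theorem eLpNorm_two_le_iff {α : Type*} {m : MeasurableSpace α} {ν : Measure α} {F : Type*}
    [NormedAddCommGroup F] {f : α → F} {c : ℝ≥0∞} :
    eLpNorm f 2 ν ≤ c ↔ ∫⁻ x, ‖f x‖ₑ ^ 2 ∂ν ≤ c ^ 2 := by
  rw [← sq_eLpNorm_two]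
  exact (ENNReal.pow_le_pow_left_iff two_ne_zero).symm

/-- The mollification of `u` by the normalized bump function `ρ`. -/
noncomputable def mollify (ρ : ContDiffBump (0 : 𝔼)) (u : 𝔼 → F) (x : 𝔼) : F :=
  ∫ t, ρ.normed volume (x - t) • u t

theorem integrable_mollify (ρ : ContDiffBump (0 : 𝔼)) {u : 𝔼 → F} (hu : MemLp u 2 volume)
    (x : 𝔼) : Integrable fun t => ρ.normed volume (x - t) • u t :=
  ρ.hasCompactSupport_normed.convolutionExists_right (L := (ContinuousLinearMap.lsmul ℝ ℝ).flip)
    (hu.locallyIntegrable (by norm_num)) ρ.continuous_normed x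

theorem contDiff_mollify (ρ : ContDiffBump (0 : 𝔼)) {u : 𝔼 → F} (hu : MemLp u 2 volume) :
    ContDiff ℝ ∞ (mollify ρ u) :=
  ρ.hasCompactSupport_normed.contDiff_convolution_right (n := ⊤) (μ := volume)
    (ContinuousLinearMap.lsmul ℝ ℝ).flip (hu.locallyIntegrable (by norm_num))
    ρ.contDiff_normed

/-- Jensen's inequality: a mollification is an average of translates, so it is as close to `f` as
these are. -/
theorem eLpNorm_mollify_sub_le [CompleteSpace F] (ρ : ContDiffBump (0 : 𝔼)) {f : 𝔼 → F}
    (hf : MemLp f 2 volume) {δ : ℝ≥0∞}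
    (h : ∀ y, ‖y‖ ≤ ρ.rOut → eLpNorm (fun x => f (x - y) - f x) 2 volume ≤ δ) :
    eLpNorm (fun x => mollify ρ f x - f x) 2 volume ≤ δ := by
  rw [eLpNorm_two_le_iff]
  let w : 𝔼 → ℝ≥0∞ := fun t => ENNReal.ofReal (ρ.normed volume t)
  have hw : Measurable w := ρ.continuous_normed.measurable.ennreal_ofReal
  have hw1 : ∫⁻ t, w t = 1 := by
    rw [← ofReal_integral_eq_lintegral_ofReal ρ.integrable_normed
      (Eventually.of_forall ρ.nonneg_normed), ρ.integral_normed, ENNReal.ofReal_one]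
  let ν : Measure 𝔼 := volume.withDensity w
  have : IsProbabilityMeasure ν := ⟨by simp [ν, hw1]⟩
  have hmeas : AEStronglyMeasurable (fun z : 𝔼 × 𝔼 => f (z.1 - z.2) - f z.1)
      (volume.prod volume) :=
    (hf.1.comp_quasiMeasurePreserving (quasiMeasurePreserving_sub volume volume)).sub
      (hf.1.comp_quasiMeasurePreserving Measure.quasiMeasurePreserving_fst)
  have hpt : ∀ᵐ x, ‖mollify ρ f x - f x‖ₑ ^ 2 ≤ ∫⁻ t, w t * ‖f (x - t) - f x‖ₑ ^ 2 := by
    filter_upwards [hmeas.prodMk_left] with x hx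
    have hx' : AEStronglyMeasurable (fun t => f (x - t) - f x) ν :=
      hx.mono_ac (withDensity_absolutelyContinuous _ _)
    have e1 : mollify ρ f x = ∫ t, ρ.normed volume t • f (x - t) := by
      rw [mollify, ← integral_sub_left_eq_self _ volume x]
      simp
    have i1 : Integrable fun t => ρ.normed volume t • f (x - t) := by
      simpa using (integrable_mollify ρ hf x).comp_sub_left x
    have e2 : mollify ρ f x - f x = ∫ t, ρ.normed volume t • (f (x - t) - f x) := by
      simp only [smul_sub]
      rw [integral_sub i1 (ρ.integrable_normed.smul_const _), ← e1, ρ.integral_normed_smul]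
    have e3 : ‖mollify ρ f x - f x‖ₑ ≤ ∫⁻ t, ‖f (x - t) - f x‖ₑ ∂ν := by
      rw [e2, lintegral_withDensity_eq_lintegral_mul₀ hw.aemeasurable hx.enorm]
      refine (enorm_integral_le_lintegral_enorm _).trans (lintegral_mono fun t => ?_)
      rw [enorm_smul, Real.enorm_of_nonneg (ρ.nonneg_normed t)]
      rfl
    have e4 : ∫⁻ t, ‖f (x - t) - f x‖ₑ ∂ν ≤ eLpNorm (fun t => f (x - t) - f x) 2 ν := by
      rw [← eLpNorm_one_eq_lintegral_enorm]
      exact eLpNorm_le_eLpNorm_of_exponent_le one_le_two hx'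
    calc ‖mollify ρ f x - f x‖ₑ ^ 2 ≤ eLpNorm (fun t => f (x - t) - f x) 2 ν ^ 2 := by
          gcongr; exact e3.trans e4
      _ = ∫⁻ t, w t * ‖f (x - t) - f x‖ₑ ^ 2 := by
          rw [sq_eLpNorm_two, lintegral_withDensity_eq_lintegral_mul₀ hw.aemeasurable
            (hx.enorm.pow_const 2)]
          rfl
  calc ∫⁻ x, ‖mollify ρ f x - f x‖ₑ ^ 2
      ≤ ∫⁻ x, ∫⁻ t, w t * ‖f (x - t) - f x‖ₑ ^ 2 := lintegral_mono_ae hpt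
    _ = ∫⁻ t, ∫⁻ x, w t * ‖f (x - t) - f x‖ₑ ^ 2 := by
        refine lintegral_lintegral_swap ?_
        exact (hw.comp measurable_snd).aemeasurable.mul (hmeas.enorm.pow_const 2)
    _ ≤ ∫⁻ t, w t * δ ^ 2 := by
        refine lintegral_mono fun t => ?_
        rw [lintegral_const_mul' _ _ ENNReal.ofReal_ne_top]
        by_cases ht : ‖t‖ ≤ ρ.rOut
        · gcongr
          exact eLpNorm_two_le_iff.1 (h t ht)
        · have : ENNReal.ofReal (ρ.normed volume t) = 0 := by
            have h0 : t ∉ Function.support (ρ.normed volume) := by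
              rw [ρ.support_normed_eq]
              simpa using (not_le.1 ht).le
            simp [Function.notMem_support.1 h0]
          rw [this, zero_mul]
          exact zero_le
    _ = δ ^ 2 := by
        rw [lintegral_mul_const _ hw, hw1, one_mul]

/-- Translations act continuously on `L²`. -/
theorem exists_eLpNorm_translate_sub_le {F : Type*} [NormedAddCommGroup F] {f : 𝔼 → F}
    (hf : MemLp f 2 volume) {ε : ℝ≥0∞} (hε : 0 < ε) :
    ∃ r > 0, ∀ y : 𝔼, ‖y‖ ≤ r → eLpNorm (fun x => f (x - y) - f x) 2 volume ≤ ε := by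
  let sh : C(𝔼, C(𝔼, 𝔼)) := ContinuousMap.curry ⟨fun z : 𝔼 × 𝔼 => z.2 - z.1, by fun_prop⟩
  have hmp : ∀ y, MeasurePreserving (sh y) volume volume := fun y =>
    measurePreserving_sub_right volume y
  have hc := (continuous_const (y := hf.toLp f)).compMeasurePreservingLp sh.continuous hmp
    (by norm_num)
  have h0 := (hc.tendsto 0).eventually (Metric.eball_mem_nhds _ hε)
  obtain ⟨r, hr, hr'⟩ := Metric.eventually_nhds_iff_ball.1 h0
  refine ⟨r / 2, half_pos hr, fun y hy => ?_⟩
  have hlt := hr' y (by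
    rw [mem_ball_zero_iff]
    exact hy.trans_lt (half_lt_self hr))
  rw [Lp.edist_def] at hlt
  refine le_trans (le_of_eq (eLpNorm_congr_ae ?_)) hlt.le
  have e0 : ∀ z : 𝔼, ⇑(Lp.compMeasurePreserving (sh z) (hmp z) (hf.toLp f))
      =ᵐ[volume] fun x => f (x - z) := fun z =>
    (Lp.coeFn_compMeasurePreserving _ (hmp z)).trans
      ((hmp z).quasiMeasurePreserving.ae_eq_comp hf.coeFn_toLp)
  filter_upwards [e0 y, e0 0] with x h1 h2
  rw [Pi.sub_apply, h1, h2, sub_zero]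

theorem exists_eLpNorm_mollify_sub_le [CompleteSpace F] {f : 𝔼 → F} (hf : MemLp f 2 volume)
    {ε : ℝ≥0∞} (hε : 0 < ε) :
    ∃ r > 0, ∀ ρ : ContDiffBump (0 : 𝔼), ρ.rOut ≤ r →
      eLpNorm (fun x => mollify ρ f x - f x) 2 volume ≤ ε := by
  obtain ⟨r, hr, h⟩ := exists_eLpNorm_translate_sub_le hf hε
  exact ⟨r, hr, fun ρ hρ => eLpNorm_mollify_sub_le ρ hf fun y hy => h y (hy.trans hρ)⟩

/-! ### Cutoffs and density of test functions -/

/-- The gradient of a differentiable function, as the vector of its partial derivatives. -/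
noncomputable def classicalGrad (φ : 𝔼 → 𝕜) (x : 𝔼) : 𝔾 :=
  WithLp.toLp 2 fun i => fderiv ℝ φ x (EuclideanSpace.single i (1 : ℝ))

/-- The vector `z d` with coordinates `dᵢ z`. -/
noncomputable def vecSmul (d : 𝔼) (z : 𝕜) : 𝔾 := WithLp.toLp 2 fun i => d i • z

theorem norm_vecSmul (d : 𝔼) (z : 𝕜) : ‖(vecSmul d z : 𝔾)‖ = ‖d‖ * ‖z‖ := by
  rw [EuclideanSpace.norm_eq, EuclideanSpace.norm_eq]
  simp only [vecSmul, norm_smul, mul_pow, ← Finset.sum_mul]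
  rw [Real.sqrt_mul (by positivity), Real.sqrt_sq (norm_nonneg _)]

theorem fderiv_apply_eq_sum (φ : 𝔼 → 𝕜) (x v : 𝔼) :
    fderiv ℝ φ x v = ∑ i, v i • classicalGrad φ x i := by
  have hv : v = ∑ i, v i • EuclideanSpace.single i (1 : ℝ) := by
    ext j
    simp [Pi.single_apply]
  conv_lhs => rw [hv]
  simp [map_sum, map_smul, classicalGrad]

theorem norm_fderiv_apply_le (φ : 𝔼 → 𝕜) (x v : 𝔼) :
    ‖fderiv ℝ φ x v‖ ≤ ‖v‖ * ‖classicalGrad φ x‖ := by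
  rw [fderiv_apply_eq_sum, EuclideanSpace.norm_eq, EuclideanSpace.norm_eq]
  refine (norm_sum_le _ _).trans ?_
  simp only [norm_smul]
  exact Real.sum_mul_le_sqrt_mul_sqrt _ _ _

theorem norm_fderiv_le (φ : 𝔼 → 𝕜) (x : 𝔼) : ‖fderiv ℝ φ x‖ ≤ ‖classicalGrad φ x‖ :=
  ContinuousLinearMap.opNorm_le_bound _ (norm_nonneg _) fun v => by
    rw [mul_comm]; exact norm_fderiv_apply_le φ x v

theorem continuous_classicalGrad {φ : 𝔼 → 𝕜} (hφ : ContDiff ℝ ∞ φ) :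
    Continuous (classicalGrad φ) := by
  refine (PiLp.continuous_toLp 2 _).comp (continuous_pi fun i => ?_)
  exact (hφ.continuous_fderiv (by simp)).clm_apply continuous_const

theorem hasCompactSupport_classicalGrad {φ : 𝔼 → 𝕜} (hc : HasCompactSupport φ) :
    HasCompactSupport (classicalGrad φ) := by
  refine (hc.fderiv (𝕜 := ℝ)).mono' ?_
  intro x hx
  refine subset_tsupport _ ?_
  contrapose! hx
  rw [Function.notMem_support] at hx ⊢
  ext i
  simp [classicalGrad, hx]

theorem HasSobGrad.cutoff {u : 𝔼 → 𝕜} {g : 𝔼 → 𝔾} (hu : HasSobGrad u g) {χ : 𝔼 → ℝ}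
    (hχ : ContDiff ℝ ∞ χ) (hχc : HasCompactSupport χ) :
    HasSobGrad (fun x => χ x • u x)
      (fun x => χ x • g x + vecSmul (classicalGrad χ x) (u x)) := by
  have hχ' := continuous_classicalGrad hχ
  have hχc' := hasCompactSupport_classicalGrad hχc
  have hm1 : MemLp (fun x => χ x • g x) 2 volume :=
    hu.memLp_grad.smul (p := ∞) (hχ.continuous.memLp_of_hasCompactSupport hχc)
  have hm2 : MemLp (fun x => (vecSmul (classicalGrad χ x) (u x) : 𝔾)) 2 volume := by
    refine MemLp.of_eval_piLp fun i => ?_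
    have hd : Continuous fun x => classicalGrad χ x i :=
      (EuclideanSpace.proj (𝕜 := ℝ) i).continuous.comp hχ'
    have hdc : HasCompactSupport fun x => classicalGrad χ x i :=
      hχc'.comp_left (g := fun v : 𝔼 => v i) rfl
    exact hu.memLp.smul (p := ∞) (hd.memLp_of_hasCompactSupport hdc)
  refine ⟨hu.memLp.smul (p := ∞) (hχ.continuous.memLp_of_hasCompactSupport hχc), hm1.add hm2,
    fun φ hφ hc i => ?_⟩
  set e := EuclideanSpace.single i (1 : ℝ)
  have hprod : ∫ x, fderiv ℝ (fun x => φ x * χ x) x e • u x = - ∫ x, (φ x * χ x) • g x i :=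
    hu.weak (fun x => φ x * χ x) (hφ.mul hχ) hc.mul_right i
  have hd : ∀ x, fderiv ℝ (fun x => φ x * χ x) x e
      = fderiv ℝ φ x e * χ x + φ x * fderiv ℝ χ x e := by
    intro x
    rw [fderiv_fun_mul (hφ.differentiable (by simp) x) (hχ.differentiable (by simp) x)]
    simp
    ring
  have c1 := continuous_fderiv_test hφ e
  have c2 := continuous_fderiv_test hχ e
  have s1 := hc.fderiv_apply (𝕜 := ℝ) e
  have i1 := integrable_smul_of_test (ψ := fun x => fderiv ℝ φ x e * χ x)
    (c1.mul hχ.continuous) s1.mul_right hu.memLp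
  have i2 := integrable_smul_of_test (ψ := fun x => φ x * fderiv ℝ χ x e)
    (hφ.continuous.mul c2) hc.mul_right hu.memLp
  have i3 := integrable_smul_of_test (ψ := fun x => φ x * χ x)
    (hφ.continuous.mul hχ.continuous) hc.mul_right (memLp_coord hu.memLp_grad i)
  simp only [hd, add_smul] at hprod
  rw [integral_add i1 i2] at hprod
  have l1 : ∫ x, fderiv ℝ φ x e • χ x • u x = ∫ x, (fderiv ℝ φ x e * χ x) • u x := by
    simp only [smul_smul]
  have l2 : ∫ x, φ x • (χ x • g x + vecSmul (classicalGrad χ x) (u x)) i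
      = ∫ x, ((φ x * χ x) • g x i + (φ x * fderiv ℝ χ x e) • u x) := by
    refine integral_congr_ae (Eventually.of_forall fun x => ?_)
    simp only [PiLp.add_apply, PiLp.smul_apply, vecSmul, classicalGrad, smul_add, smul_smul]
    rfl
  rw [l1, l2, integral_add i3 i2, neg_add, ← hprod]
  abel

theorem classicalGrad_mollify (ρ : ContDiffBump (0 : 𝔼)) {u : 𝔼 → 𝕜} {g : 𝔼 → 𝔾}
    (hu : HasSobGrad u g) (x : 𝔼) : classicalGrad (mollify ρ u) x = mollify ρ g x := by
  ext i
  set e := EuclideanSpace.single i (1 : ℝ)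
  have hloc : LocallyIntegrable u volume := hu.memLp.locallyIntegrable (by norm_num)
  have hsm : ContDiff ℝ ∞ (ρ.normed (volume : Measure 𝔼)) := ρ.contDiff_normed
  have h1 : fderiv ℝ (mollify ρ u) x e
      = ∫ t, fderiv ℝ (ρ.normed volume) (x - t) e • u t := by
    have hd := ρ.hasCompactSupport_normed.hasFDerivAt_convolution_right
      (ContinuousLinearMap.lsmul ℝ ℝ).flip hloc (hsm.of_le (by simp)) x
    rw [show fderiv ℝ (mollify ρ u) x = _ from hd.fderiv,
      convolution_precompR_apply _ hloc (ρ.hasCompactSupport_normed.fderiv (𝕜 := ℝ))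
        (hsm.continuous_fderiv (by simp))]
    rfl
  have htest : ContDiff ℝ ∞ fun t => ρ.normed volume (x - t) :=
    hsm.comp (contDiff_const.sub contDiff_id)
  have htestc : HasCompactSupport fun t => ρ.normed volume (x - t) :=
    ρ.hasCompactSupport_normed.comp_homeomorph (Homeomorph.subLeft x)
  have hd : ∀ t, fderiv ℝ (fun t => ρ.normed volume (x - t)) t e
      = - fderiv ℝ (ρ.normed volume) (x - t) e := by
    intro t
    have h2 := ((hsm.differentiable (by simp)).differentiableAt
      (x := x - t)).hasFDerivAt.comp t ((hasFDerivAt_id t).const_sub x)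
    rw [show fderiv ℝ (fun t => ρ.normed volume (x - t)) t = _ from h2.fderiv]
    simp
  have hw := hu.weak _ htest htestc i
  simp only [hd, neg_smul, e] at hw
  rw [integral_neg, neg_inj] at hw
  have h3 : mollify ρ g x i = ∫ t, ρ.normed volume (x - t) • g t i :=
    ((EuclideanSpace.proj (𝕜 := 𝕜) i).restrictScalars ℝ).integral_comp_comm
      (integrable_mollify ρ hu.memLp_grad x) |>.symm
  rw [h3, ← hw, ← h1]
  rfl

/-- A fixed smooth bump function, equal to `1` on the unit ball and to `0` off the ball of
radius `2`. -/
noncomputable def unitBump (n : ℕ) : ContDiffBump (0 : EuclideanSpace ℝ (Fin n)) :=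
  ⟨1, 2, one_pos, one_lt_two⟩

/-- The cutoff function at radius `R`: equal to `1` for `‖x‖ ≤ R` and to `0` for `‖x‖ ≥ 2R`. -/
noncomputable def cutoffAt (R : ℝ) (x : 𝔼) : ℝ := unitBump N (R⁻¹ • x)

theorem contDiff_cutoffAt (R : ℝ) : ContDiff ℝ ∞ (cutoffAt R : 𝔼 → ℝ) := by
  have : ContDiff ℝ ∞ fun x : 𝔼 => R⁻¹ • x := by fun_prop
  exact (unitBump N).contDiff.comp this

theorem hasCompactSupport_cutoffAt {R : ℝ} (hR : 0 < R) :
    HasCompactSupport (cutoffAt R : 𝔼 → ℝ) :=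
  (unitBump N).hasCompactSupport.comp_homeomorph
    (Homeomorph.smulOfNeZero R⁻¹ (inv_ne_zero hR.ne'))

theorem cutoffAt_nonneg (R : ℝ) (x : 𝔼) : 0 ≤ cutoffAt R x := (unitBump N).nonneg

theorem cutoffAt_le_one (R : ℝ) (x : 𝔼) : cutoffAt R x ≤ 1 := (unitBump N).le_one

theorem cutoffAt_eq_one {R : ℝ} (hR : 0 < R) {x : 𝔼} (hx : ‖x‖ ≤ R) : cutoffAt R x = 1 := by
  refine (unitBump N).one_of_mem_closedBall ?_
  rw [mem_closedBall_zero_iff, norm_smul, norm_inv, Real.norm_of_nonneg hR.le]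
  change R⁻¹ * ‖x‖ ≤ 1
  rw [inv_mul_le_iff₀ hR]
  linarith

theorem cutoffAt_eq_zero {R : ℝ} (hR : 0 < R) {x : 𝔼} (hx : 2 * R ≤ ‖x‖) : cutoffAt R x = 0 := by
  refine (unitBump N).zero_of_le_dist ?_
  rw [dist_zero_right, norm_smul, norm_inv, Real.norm_of_nonneg hR.le]
  change 2 ≤ R⁻¹ * ‖x‖
  rw [le_inv_mul_iff₀ hR]
  linarith

theorem fderiv_cutoffAt (R : ℝ) (x : 𝔼) :
    fderiv ℝ (cutoffAt R) x = R⁻¹ • fderiv ℝ (unitBump N) (R⁻¹ • x) := by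
  have h1 : HasFDerivAt (fun z : 𝔼 => R⁻¹ • z) (R⁻¹ • ContinuousLinearMap.id ℝ 𝔼) x :=
    (hasFDerivAt_id x).const_smul R⁻¹
  have h2 := (((unitBump N).contDiff (n := ⊤).differentiable (by simp)).differentiableAt
    (x := R⁻¹ • x)).hasFDerivAt.comp x h1
  rw [show fderiv ℝ (cutoffAt R) x = _ from h2.fderiv]
  ext v
  simp

theorem exists_norm_grad_cutoffAt_le :
    ∃ C : ℝ, 0 < C ∧ ∀ R : ℝ, 0 < R → ∀ x : 𝔼,
      ‖classicalGrad (cutoffAt R) x‖ ≤ C / R ∧ ‖fderiv ℝ (cutoffAt R) x‖ ≤ C / R := by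
  obtain ⟨C, hC⟩ := (continuous_classicalGrad (𝕜 := ℝ)
    (unitBump N).contDiff).bounded_above_of_compact_support
    (hasCompactSupport_classicalGrad (unitBump N).hasCompactSupport)
  have key : ∀ R : ℝ, 0 < R → ∀ x : 𝔼, ‖classicalGrad (cutoffAt R) x‖ ≤ (|C| + 1) / R := by
    intro R hR x
    have e : classicalGrad (cutoffAt R) x = R⁻¹ • classicalGrad (unitBump N) (R⁻¹ • x) := by
      ext i
      simp [classicalGrad, fderiv_cutoffAt]
    rw [e, norm_smul, norm_inv, Real.norm_of_nonneg hR.le, div_eq_inv_mul]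
    gcongr
    linarith [hC (R⁻¹ • x), le_abs_self C]
  exact ⟨|C| + 1, by positivity,
    fun R hR x => ⟨key R hR x, (norm_fderiv_le _ x).trans (key R hR x)⟩⟩

theorem tendsto_eLpNorm_smul_sub {f : 𝔼 → F} (hf : MemLp f 2 volume) {c : ℕ → 𝔼 → ℝ}
    (hc : ∀ n, Continuous (c n)) (h0 : ∀ n x, 0 ≤ c n x) (h1 : ∀ n x, c n x ≤ 1)
    (hlim : ∀ x, Tendsto (fun n => c n x) atTop (𝓝 1)) :
    Tendsto (fun n => eLpNorm (fun x => c n x • f x - f x) 2 volume) atTop (𝓝 0) := by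
  have hsq : Tendsto (fun n => ∫⁻ x, ‖c n x • f x - f x‖ₑ ^ 2) atTop (𝓝 (∫⁻ _ : 𝔼, 0)) := by
    refine tendsto_lintegral_of_dominated_convergence' (fun x => ‖f x‖ₑ ^ 2) (fun n => ?_)
      (fun n => ?_) ?_ ?_
    · exact ((((hc n).aestronglyMeasurable.smul hf.1).sub hf.1).enorm).pow_const 2
    · refine Eventually.of_forall fun x => ?_
      have : ‖c n x • f x - f x‖ ≤ ‖f x‖ := by
        have e : c n x • f x - f x = (c n x - 1) • f x := by rw [sub_smul, one_smul]
        rw [e, norm_smul]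
        refine mul_le_of_le_one_left (norm_nonneg _) ?_
        rw [Real.norm_eq_abs, abs_le]
        constructor <;> linarith [h0 n x, h1 n x]
      exact pow_le_pow_left' (enorm_le_iff_norm_le.2 this) 2
    · rw [← sq_eLpNorm_two]
      exact ENNReal.pow_ne_top hf.2.ne
    · refine Eventually.of_forall fun x => ?_
      have h2 : Tendsto (fun n => c n x • f x - f x) atTop (𝓝 ((1 : ℝ) • f x - f x)) :=
        ((hlim x).smul_const _).sub_const _
      rw [one_smul, sub_self] at h2
      have h3 := (ENNReal.continuous_pow 2).continuousAt.tendsto.comp h2.enorm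
      simpa [Function.comp_def] using h3
  rw [lintegral_zero] at hsq
  have h4 := (ENNReal.continuous_rpow_const (y := (1 / 2 : ℝ))).continuousAt.tendsto.comp hsq
  rw [ENNReal.zero_rpow_of_pos (by norm_num)] at h4
  refine h4.congr fun n => ?_
  rw [Function.comp_apply, ← sq_eLpNorm_two, ← ENNReal.rpow_two, ← ENNReal.rpow_mul]
  norm_num

theorem hasCompactSupport_mollify (ρ : ContDiffBump (0 : 𝔼)) {u : 𝔼 → F}
    (hu : HasCompactSupport u) : HasCompactSupport (mollify ρ u) :=
  hu.convolution (L := (ContinuousLinearMap.lsmul ℝ ℝ).flip) ρ.hasCompactSupport_normed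

/-- Test functions are dense in `H¹`. -/
theorem HasSobGrad.exists_test_approx {u : 𝔼 → 𝕜} {g : 𝔼 → 𝔾} (hu : HasSobGrad u g) {ε : ℝ≥0∞}
    (hε : 0 < ε) :
    ∃ φ : 𝔼 → 𝕜, ContDiff ℝ ∞ φ ∧ HasCompactSupport φ ∧
      eLpNorm (fun x => φ x - u x) 2 volume ≤ ε ∧
      eLpNorm (fun x => classicalGrad φ x - g x) 2 volume ≤ ε := by
  obtain ⟨C, hC0, hC⟩ := exists_norm_grad_cutoffAt_le (N := N)
  let R : ℕ → ℝ := fun n => n + 1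
  have hR : ∀ n, 0 < R n := fun n => by positivity
  have hlim : ∀ x : 𝔼, Tendsto (fun n => cutoffAt (R n) x) atTop (𝓝 1) := by
    intro x
    refine tendsto_const_nhds.congr' ?_
    obtain ⟨m, hm⟩ := exists_nat_ge ‖x‖
    filter_upwards [eventually_ge_atTop m] with n hn
    refine (cutoffAt_eq_one (hR n) ?_).symm
    have : (m : ℝ) ≤ n := by exact_mod_cast hn
    simp only [R]
    linarith
  have l1 := tendsto_eLpNorm_smul_sub hu.memLp (fun n => (contDiff_cutoffAt (R n)).continuous)
    (fun n => cutoffAt_nonneg (R n)) (fun n => cutoffAt_le_one (R n)) hlim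
  have l2 := tendsto_eLpNorm_smul_sub hu.memLp_grad
    (fun n => (contDiff_cutoffAt (R n)).continuous)
    (fun n => cutoffAt_nonneg (R n)) (fun n => cutoffAt_le_one (R n)) hlim
  have l3 : Tendsto (fun n => ENNReal.ofReal (C / R n) * eLpNorm u 2 volume) atTop (𝓝 0) := by
    have t1 : Tendsto (fun n => C / R n) atTop (𝓝 0) :=
      tendsto_const_nhds.div_atTop
        (tendsto_atTop_add_const_right _ _ tendsto_natCast_atTop_atTop)
    have t2 := ENNReal.Tendsto.mul_const (b := eLpNorm u 2 volume) (ENNReal.tendsto_ofReal t1)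
      (Or.inr hu.memLp.2.ne)
    simpa using t2
  have hε4 : (0 : ℝ≥0∞) < ε / 4 := ENNReal.div_pos hε.ne' (by norm_num)
  obtain ⟨n, h1, h2, h3⟩ := ((l1.eventually (gt_mem_nhds hε4)).and
    ((l2.eventually (gt_mem_nhds hε4)).and (l3.eventually (gt_mem_nhds hε4)))).exists
  have hv := hu.cutoff (contDiff_cutoffAt (R n)) (hasCompactSupport_cutoffAt (hR n))
  set v : 𝔼 → 𝕜 := fun x => cutoffAt (R n) x • u x with hvdef
  set h : 𝔼 → 𝔾 := fun x => cutoffAt (R n) x • g x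
    + vecSmul (classicalGrad (cutoffAt (R n)) x) (u x) with hdef
  have hvc : HasCompactSupport v := (hasCompactSupport_cutoffAt (hR n)).smul_right
  obtain ⟨r1, hr1, hm1⟩ := exists_eLpNorm_mollify_sub_le hv.memLp hε4
  obtain ⟨r2, hr2, hm2⟩ := exists_eLpNorm_mollify_sub_le hv.memLp_grad hε4
  let ρ : ContDiffBump (0 : 𝔼) :=
    ⟨min r1 r2 / 2, min r1 r2, half_pos (lt_min hr1 hr2), half_lt_self (lt_min hr1 hr2)⟩
  have b1 := hm1 ρ (min_le_left _ _)
  have b2 := hm2 ρ (min_le_right _ _)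
  have hsum : ε / 4 + (ε / 4 + ε / 4) ≤ ε := by
    calc ε / 4 + (ε / 4 + ε / 4) ≤ (ε / 4 + ε / 4) + (ε / 4 + ε / 4) := by
          gcongr; exact le_self_add
      _ = ε / 2 + ε / 2 := by
          have : ε / 4 + ε / 4 = ε / 2 := by
            rw [← ENNReal.add_div, ← two_mul, show (4 : ℝ≥0∞) = 2 * 2 by norm_num,
              ENNReal.mul_div_mul_left _ _ (by norm_num) (by norm_num)]
          rw [this]
      _ = ε := ENNReal.add_halves ε
  refine ⟨mollify ρ v, contDiff_mollify ρ hv.memLp, hasCompactSupport_mollify ρ hvc, ?_, ?_⟩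
  · have e : (fun x => mollify ρ v x - u x)
        = (fun x => mollify ρ v x - v x) + fun x => v x - u x := by
      ext x; simp
    have hmol : AEStronglyMeasurable (mollify ρ v) volume :=
      (contDiff_mollify ρ hv.memLp).continuous.aestronglyMeasurable
    rw [e]
    refine (eLpNorm_add_le (hmol.sub hv.memLp.1) (hv.memLp.1.sub hu.memLp.1) one_le_two).trans
      (le_trans ?_ hsum)
    exact add_le_add b1 (h1.le.trans le_self_add)
  · have e : (fun x => classicalGrad (mollify ρ v) x - g x)
        = (fun x => mollify ρ h x - h x) + ((fun x => cutoffAt (R n) x • g x - g x)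
          + fun x => vecSmul (classicalGrad (cutoffAt (R n)) x) (u x)) := by
      ext1 x
      simp only [Pi.add_apply, classicalGrad_mollify ρ hv, hdef]
      abel
    have hmol : AEStronglyMeasurable (mollify ρ h) volume :=
      (contDiff_mollify ρ hv.memLp_grad).continuous.aestronglyMeasurable
    have hcg : AEStronglyMeasurable (fun x => cutoffAt (R n) x • g x) volume :=
      (contDiff_cutoffAt (R n)).continuous.aestronglyMeasurable.smul hu.memLp_grad.1
    have hvs : AEStronglyMeasurable
        (fun x => (vecSmul (classicalGrad (cutoffAt (R n)) x) (u x) : 𝔾)) volume := by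
      have := hv.memLp_grad.1.sub hcg
      refine this.congr (Eventually.of_forall fun x => ?_)
      simp [hdef]
    have b3 : eLpNorm (fun x => (vecSmul (classicalGrad (cutoffAt (R n)) x) (u x) : 𝔾)) 2 volume
        ≤ ε / 4 := by
      refine le_trans ?_ h3.le
      refine (eLpNorm_le_mul_eLpNorm_of_ae_le_mul (c := C / R n)
        (Eventually.of_forall fun x => ?_) 2)
      rw [norm_vecSmul]
      gcongr
      exact (hC (R n) (hR n) x).1
    rw [e]
    refine (eLpNorm_add_le (hmol.sub hv.memLp_grad.1)
      ((hcg.sub hu.memLp_grad.1).add hvs) one_le_two).trans (le_trans ?_ hsum)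
    refine add_le_add b2 ((eLpNorm_add_le (hcg.sub hu.memLp_grad.1) hvs one_le_two).trans ?_)
    exact add_le_add h2.le b3

end Mollification

section SobolevInequality

variable {𝕜 : Type*} [RCLike 𝕜] {N : ℕ}

local notation "𝔼" => EuclideanSpace ℝ (Fin N)
local notation "𝔾" => EuclideanSpace 𝕜 (Fin N)

/-! ### The Sobolev inequality and differences along affine maps -/

/-- The exponent `κ = N / (N - 2)`, half the critical one. Under dilations both `(∫ |∇u|²) ^ κ` and
the integrals `∫ |u| ^ r` scale like volume. -/
noncomputable def sobExp (N : ℕ) : ℝ := (N : ℝ) / ((N : ℝ) - 2)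

theorem critExp_eq (N : ℕ) : critExp N = 2 * sobExp N := by
  rw [critExp, sobExp, mul_div_assoc]

theorem one_lt_sobExp (hN : 3 ≤ N) : 1 < sobExp N := by
  have h : (3 : ℝ) ≤ N := by exact_mod_cast hN
  rw [sobExp, one_lt_div (by linarith)]
  linarith

theorem two_lt_critExp (hN : 3 ≤ N) : 2 < critExp N := by
  rw [critExp_eq]
  linarith [one_lt_sobExp hN]

theorem exists_eLpNorm_critExp_le (hN : 3 ≤ N) (𝕜 : Type*) [RCLike 𝕜] :
    ∃ C : ℝ≥0, ∀ (u : 𝔼 → 𝕜) (g : 𝔼 → EuclideanSpace 𝕜 (Fin N)), HasSobGrad u g →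
      eLpNorm u (ENNReal.ofReal (critExp N)) volume ≤ C * eLpNorm g 2 volume := by
  have h3 : (3 : ℝ) ≤ N := by exact_mod_cast hN
  let p' : ℝ≥0 := (critExp N).toNNReal
  have hp' : (p' : ℝ) = critExp N :=
    Real.coe_toNNReal _ (by linarith [two_lt_critExp hN])
  have hconj : (p' : ℝ)⁻¹ = ((2 : ℝ≥0) : ℝ)⁻¹ - (Module.finrank ℝ 𝔼 : ℝ)⁻¹ := by
    rw [hp', critExp, finrank_euclideanSpace_fin]
    have : (N : ℝ) - 2 ≠ 0 := by linarith
    have : (N : ℝ) ≠ 0 := by linarith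
    push_cast
    field_simp
  let K := SNormLESNormFDerivOfEqConst 𝕜 (volume : Measure 𝔼) 2
  refine ⟨K, fun u g hu => ?_⟩
  let ε : ℕ → ℝ≥0∞ := fun n => ((n : ℝ≥0∞) + 1)⁻¹
  have hεlim : Tendsto ε atTop (𝓝 0) := by
    have := ENNReal.tendsto_inv_nat_nhds_zero.comp (tendsto_add_atTop_nat 1)
    simpa [ε, Function.comp_def] using this
  have hε : ∀ n, 0 < ε n := fun n => by simp [ε]
  choose φ hφ hφc h1 h2 using fun n => hu.exists_test_approx (hε n)
  have hmeas : ∀ n, AEStronglyMeasurable (φ n) volume :=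
    fun n => (hφ n).continuous.aestronglyMeasurable
  have hL2 : Tendsto (fun n => eLpNorm (φ n - u) 2 volume) atTop (𝓝 0) :=
    tendsto_of_tendsto_of_tendsto_of_le_of_le tendsto_const_nhds hεlim (fun _ => zero_le)
      (fun n => h1 n)
  obtain ⟨ns, hns, hae⟩ := (tendstoInMeasure_of_tendsto_eLpNorm (by norm_num) hmeas hu.memLp.1
    hL2).exists_seq_tendsto_ae
  have hbound : ∀ n, eLpNorm (φ n) p' volume ≤ K * (eLpNorm g 2 volume + ε n) := by
    intro n
    have hS := eLpNorm_le_eLpNorm_fderiv_of_eq (F := 𝕜) (volume : Measure 𝔼)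
      ((hφ n).of_le (by simp)) (hφc n) (p := 2) (p' := p') (by norm_num)
      (by rw [finrank_euclideanSpace_fin]; omega) hconj
    refine hS.trans (mul_le_mul' le_rfl ?_)
    have hg : AEStronglyMeasurable (classicalGrad (φ n)) volume :=
      (continuous_classicalGrad (hφ n)).aestronglyMeasurable
    calc eLpNorm (fderiv ℝ (φ n)) 2 volume ≤ eLpNorm (classicalGrad (φ n)) 2 volume :=
          eLpNorm_mono fun x => norm_fderiv_le _ x
      _ = eLpNorm (g + fun x => classicalGrad (φ n) x - g x) 2 volume := by
          congr 1; ext1 x; simp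
      _ ≤ eLpNorm g 2 volume + eLpNorm (fun x => classicalGrad (φ n) x - g x) 2 volume :=
          eLpNorm_add_le hu.memLp_grad.1 (hg.sub hu.memLp_grad.1) one_le_two
      _ ≤ eLpNorm g 2 volume + ε n := by gcongr; exact h2 n
  have hF := Lp.eLpNorm_lim_le_liminf_eLpNorm (p := (p' : ℝ≥0∞)) (fun n => hmeas (ns n)) u hae
  refine hF.trans ?_
  have hlim : Tendsto (fun n => K * (eLpNorm g 2 volume + ε (ns n))) atTop
      (𝓝 ((K : ℝ≥0∞) * (eLpNorm g 2 volume + 0))) :=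
    ENNReal.Tendsto.const_mul ((hεlim.comp hns.tendsto_atTop).const_add _)
      (Or.inr ENNReal.coe_ne_top)
  rw [add_zero] at hlim
  calc liminf (fun n => eLpNorm (φ (ns n)) p' volume) atTop
      ≤ liminf (fun n => K * (eLpNorm g 2 volume + ε (ns n))) atTop :=
        liminf_le_liminf (Eventually.of_forall fun n => hbound (ns n))
    _ = K * eLpNorm g 2 volume := hlim.liminf_eq

theorem HasSobGrad.memLp_critExp (hN : 3 ≤ N) {u : 𝔼 → 𝕜} {g : 𝔼 → 𝔾} (hu : HasSobGrad u g) :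
    MemLp u (ENNReal.ofReal (critExp N)) volume := by
  obtain ⟨C, hC⟩ := exists_eLpNorm_critExp_le hN 𝕜
  exact ⟨hu.memLp.1, (hC u g hu).trans_lt
    (ENNReal.mul_lt_top ENNReal.coe_lt_top hu.memLp_grad.2)⟩

/-- The Sobolev inequality in `H¹`. -/
theorem exists_sobolev_const (hN : 3 ≤ N) (𝕜 : Type*) [RCLike 𝕜] :
    ∃ C : ℝ, 0 < C ∧ ∀ (u : 𝔼 → 𝕜) (g : 𝔼 → EuclideanSpace 𝕜 (Fin N)), HasSobGrad u g →
      ∫ x, ‖u x‖ ^ critExp N ≤ C * (∫ x, ‖g x‖ ^ 2) ^ sobExp N := by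
  obtain ⟨C, hC⟩ := exists_eLpNorm_critExp_le hN 𝕜
  have h2 := two_lt_critExp hN
  have h0 : 0 < critExp N := by linarith
  refine ⟨(C + 1 : ℝ) ^ critExp N, by positivity, fun u g hu => ?_⟩
  have h := hC u g hu
  rw [(hu.memLp_critExp hN).eLpNorm_eq_integral_rpow_norm (by simpa using h0) (by simp),
    hu.memLp_grad.eLpNorm_eq_integral_rpow_norm (by norm_num) (by norm_num),
    ← ENNReal.ofReal_coe_nnreal, ← ENNReal.ofReal_mul C.coe_nonneg,
    ENNReal.ofReal_le_ofReal_iff (by positivity), ENNReal.toReal_ofReal h0.le] at h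
  simp only [ENNReal.toReal_ofNat, Real.rpow_two] at h
  have hI : 0 ≤ ∫ x, ‖u x‖ ^ critExp N := by positivity
  have hJ : 0 ≤ ∫ x, ‖g x‖ ^ 2 := by positivity
  calc ∫ x, ‖u x‖ ^ critExp N = ((∫ x, ‖u x‖ ^ critExp N) ^ (critExp N)⁻¹) ^ critExp N := by
        rw [← Real.rpow_mul hI, inv_mul_cancel₀ h0.ne', Real.rpow_one]
    _ ≤ (C * (∫ x, ‖g x‖ ^ 2) ^ (2 : ℝ)⁻¹) ^ critExp N := by gcongr
    _ = (C : ℝ) ^ critExp N * (∫ x, ‖g x‖ ^ 2) ^ sobExp N := by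
        rw [Real.mul_rpow C.coe_nonneg (by positivity), ← Real.rpow_mul hJ, critExp_eq]
        congr 2
        ring
    _ ≤ (C + 1 : ℝ) ^ critExp N * (∫ x, ‖g x‖ ^ 2) ^ sobExp N := by
        gcongr
        linarith

theorem eLpNorm_two_comp_affine_le {F : Type*} [NormedAddCommGroup F] (f : 𝔼 → F) {a : ℝ}
    (ha : 1 / 2 ≤ a) (y : 𝔼) :
    eLpNorm (fun x => f (a • x + y)) 2 volume ≤ 2 ^ N * eLpNorm f 2 volume := by
  rw [eLpNorm_two_le_iff, mul_pow, sq_eLpNorm_two,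
    lintegral_comp_affine (by linarith : a ≠ 0) y fun z => ‖f z‖ₑ ^ 2]
  gcongr
  have h1 : |(a ^ N)⁻¹| ≤ 2 ^ N := by
    rw [abs_of_pos (by positivity), ← inv_pow]
    gcongr
    rw [inv_le_comm₀ (by linarith) two_pos]
    linarith
  calc ENNReal.ofReal |(a ^ N)⁻¹| ≤ ENNReal.ofReal (2 ^ N) := ENNReal.ofReal_le_ofReal h1
    _ = 2 ^ N := by rw [ENNReal.ofReal_pow two_pos.le]; simp
    _ ≤ (2 ^ N) ^ 2 := le_self_pow₀ (one_le_pow₀ one_le_two) two_ne_zero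

/-- The difference is the integral of the derivative along the segment from `x` to its image, whose
points are themselves affine images of `x`. -/
theorem eLpNorm_affine_sub_le_of_smooth {φ : 𝔼 → 𝕜} (hφ : ContDiff ℝ ∞ φ) {τ : ℝ}
    (hτ : |τ| ≤ 1 / 2) (y : 𝔼) {A : Set 𝔼} (hA : MeasurableSet A) {d : ℝ}
    (hd : ∀ x ∈ A, ‖τ • x + y‖ ≤ d) :
    eLpNorm (fun x => φ ((1 + τ) • x + y) - φ x) 2 (volume.restrict A)
      ≤ ENNReal.ofReal d * (2 ^ N * eLpNorm (classicalGrad φ) 2 volume) := by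
  rw [eLpNorm_two_le_iff, mul_pow]
  have hcg := continuous_classicalGrad hφ
  have hpt : ∀ x ∈ A, ‖φ ((1 + τ) • x + y) - φ x‖ₑ ^ 2 ≤ ∫⁻ s in Set.Icc (0 : ℝ) 1,
      ENNReal.ofReal d ^ 2 * ‖classicalGrad φ ((1 + s * τ) • x + s • y)‖ₑ ^ 2 := by
    intro x hx
    let c : ℝ → 𝔼 := fun s => (1 + s * τ) • x + s • y
    have hcc : Continuous c := by fun_prop
    have hc : ∀ s, HasDerivAt c (τ • x + y) s := by
      intro s
      have h1 : HasDerivAt (fun s : ℝ => 1 + s * τ) τ s := by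
        simpa using ((hasDerivAt_id s).mul_const τ).const_add 1
      have h2 := (h1.smul_const x).add ((hasDerivAt_id s).smul_const y)
      rw [one_smul] at h2
      exact h2
    have hder : ∀ s, HasDerivAt (fun s => φ (c s)) (fderiv ℝ φ (c s) (τ • x + y)) s := fun s =>
      ((hφ.differentiable (by simp)).differentiableAt.hasFDerivAt).comp_hasDerivAt s (hc s)
    have hcont : Continuous fun s => fderiv ℝ φ (c s) (τ • x + y) :=
      ((hφ.continuous_fderiv (by simp)).comp hcc).clm_apply continuous_const
    have hftc : φ ((1 + τ) • x + y) - φ x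
        = ∫ s in (0 : ℝ)..1, fderiv ℝ φ (c s) (τ • x + y) := by
      rw [intervalIntegral.integral_eq_sub_of_hasDerivAt (fun s _ => hder s)
        (hcont.intervalIntegrable _ _)]
      simp [c]
    have : IsProbabilityMeasure ((volume : Measure ℝ).restrict (Set.Icc 0 1)) := ⟨by simp⟩
    have e1 : ‖φ ((1 + τ) • x + y) - φ x‖ₑ
        ≤ eLpNorm (fun s => fderiv ℝ φ (c s) (τ • x + y)) 2 (volume.restrict (Set.Icc 0 1)) := by
      rw [hftc, intervalIntegral.integral_of_le zero_le_one, ← integral_Icc_eq_integral_Ioc]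
      refine (enorm_integral_le_lintegral_enorm _).trans ?_
      rw [← eLpNorm_one_eq_lintegral_enorm]
      exact eLpNorm_le_eLpNorm_of_exponent_le one_le_two hcont.aestronglyMeasurable
    calc ‖φ ((1 + τ) • x + y) - φ x‖ₑ ^ 2
        ≤ eLpNorm (fun s => fderiv ℝ φ (c s) (τ • x + y)) 2 (volume.restrict (Set.Icc 0 1)) ^ 2 :=
          pow_le_pow_left' e1 2
      _ = ∫⁻ s in Set.Icc (0 : ℝ) 1, ‖fderiv ℝ φ (c s) (τ • x + y)‖ₑ ^ 2 := sq_eLpNorm_two _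
      _ ≤ _ := by
          refine lintegral_mono fun s => ?_
          rw [← mul_pow]
          refine pow_le_pow_left' ?_ 2
          rw [← ofReal_norm, ← ofReal_norm, ← ENNReal.ofReal_mul ((norm_nonneg _).trans (hd x hx))]
          refine ENNReal.ofReal_le_ofReal ((norm_fderiv_apply_le _ _ _).trans ?_)
          gcongr
          exact hd x hx
  calc ∫⁻ x in A, ‖φ ((1 + τ) • x + y) - φ x‖ₑ ^ 2
      ≤ ∫⁻ x in A, ∫⁻ s in Set.Icc (0 : ℝ) 1,
          ENNReal.ofReal d ^ 2 * ‖classicalGrad φ ((1 + s * τ) • x + s • y)‖ₑ ^ 2 :=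
        setLIntegral_mono' hA hpt
    _ ≤ ∫⁻ x, ∫⁻ s in Set.Icc (0 : ℝ) 1,
          ENNReal.ofReal d ^ 2 * ‖classicalGrad φ ((1 + s * τ) • x + s • y)‖ₑ ^ 2 :=
        setLIntegral_le_lintegral _ _
    _ = ∫⁻ s in Set.Icc (0 : ℝ) 1, ∫⁻ x,
          ENNReal.ofReal d ^ 2 * ‖classicalGrad φ ((1 + s * τ) • x + s • y)‖ₑ ^ 2 := by
        refine lintegral_lintegral_swap (Continuous.aemeasurable ?_)
        refine ENNReal.continuous_const_mul (by finiteness) |>.comp ?_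
        refine (ENNReal.continuous_pow 2).comp (continuous_enorm.comp (hcg.comp ?_))
        fun_prop
    _ ≤ ∫⁻ _ in Set.Icc (0 : ℝ) 1,
          ENNReal.ofReal d ^ 2 * (2 ^ N * eLpNorm (classicalGrad φ) 2 volume) ^ 2 := by
        refine setLIntegral_mono' measurableSet_Icc fun s hs => ?_
        rw [lintegral_const_mul' _ _ (by finiteness)]
        gcongr
        refine eLpNorm_two_le_iff.1 (eLpNorm_two_comp_affine_le (classicalGrad φ) ?_ (s • y))
        have : |s * τ| ≤ 1 / 2 := by
          rw [abs_mul, abs_of_nonneg hs.1]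
          nlinarith [hs.2, hs.1, abs_nonneg τ]
        linarith [neg_abs_le (s * τ)]
    _ = ENNReal.ofReal d ^ 2 * (2 ^ N * eLpNorm (classicalGrad φ) 2 volume) ^ 2 := by simp

/-- The `L²` difference quotients of an `H¹` function along affine maps are bounded by its
gradient. -/
theorem HasSobGrad.eLpNorm_affine_sub_le {u : 𝔼 → 𝕜} {g : 𝔼 → 𝔾} (hu : HasSobGrad u g) {τ : ℝ}
    (hτ : |τ| ≤ 1 / 2) (y : 𝔼) {A : Set 𝔼} (hA : MeasurableSet A) {d : ℝ}
    (hd : ∀ x ∈ A, ‖τ • x + y‖ ≤ d) :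
    eLpNorm (fun x => u ((1 + τ) • x + y) - u x) 2 (volume.restrict A)
      ≤ ENNReal.ofReal d * (2 ^ N * eLpNorm g 2 volume) := by
  have ha : 1 / 2 ≤ 1 + τ := by linarith [neg_abs_le τ]
  have ha0 : 1 + τ ≠ 0 := by linarith
  have hε : ∀ ε : ℝ≥0∞, 0 < ε →
      eLpNorm (fun x => u ((1 + τ) • x + y) - u x) 2 (volume.restrict A)
        ≤ 2 ^ N * ε + (ENNReal.ofReal d * (2 ^ N * (eLpNorm g 2 volume + ε)) + ε) := by
    intro ε hε
    obtain ⟨φ, hφ, hφc, h1, h2⟩ := hu.exists_test_approx hε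
    have hφm : AEStronglyMeasurable φ volume := hφ.continuous.aestronglyMeasurable
    have hq := quasiMeasurePreserving_affine ha0 y
    have m1 : AEStronglyMeasurable (fun x => u ((1 + τ) • x + y) - φ ((1 + τ) • x + y))
        (volume.restrict A) :=
      ((hu.memLp.1.comp_quasiMeasurePreserving hq).sub
        (hφm.comp_quasiMeasurePreserving hq)).restrict
    have m2 : AEStronglyMeasurable (fun x => φ ((1 + τ) • x + y) - φ x) (volume.restrict A) :=
      ((hφm.comp_quasiMeasurePreserving hq).sub hφm).restrict
    have m3 : AEStronglyMeasurable (fun x => φ x - u x) (volume.restrict A) :=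
      (hφm.sub hu.memLp.1).restrict
    have e : (fun x => u ((1 + τ) • x + y) - u x)
        = (fun x => u ((1 + τ) • x + y) - φ ((1 + τ) • x + y))
          + ((fun x => φ ((1 + τ) • x + y) - φ x) + fun x => φ x - u x) := by
      ext1 x
      simp
    rw [e]
    refine (eLpNorm_add_le m1 (m2.add m3) one_le_two).trans (add_le_add ?_
      ((eLpNorm_add_le m2 m3 one_le_two).trans (add_le_add ?_ ?_)))
    · refine (eLpNorm_mono_measure _ Measure.restrict_le_self).trans
        ((eLpNorm_two_comp_affine_le (fun x => u x - φ x) ha y).trans ?_)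
      gcongr
      refine le_trans (le_of_eq ?_) h1
      exact eLpNorm_sub_comm u φ 2 volume
    · refine (eLpNorm_affine_sub_le_of_smooth hφ hτ y hA hd).trans ?_
      gcongr
      have hg : AEStronglyMeasurable (classicalGrad φ) volume :=
        (continuous_classicalGrad hφ).aestronglyMeasurable
      have e2 : classicalGrad φ = g + fun x => classicalGrad φ x - g x := by
        ext1 x; simp
      calc eLpNorm (classicalGrad φ) 2 volume
          = eLpNorm (g + fun x => classicalGrad φ x - g x) 2 volume := by rw [← e2]
        _ ≤ eLpNorm g 2 volume + eLpNorm (fun x => classicalGrad φ x - g x) 2 volume :=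
          eLpNorm_add_le hu.memLp_grad.1 (hg.sub hu.memLp_grad.1) one_le_two
        _ ≤ _ := by gcongr
    · exact (eLpNorm_mono_measure _ Measure.restrict_le_self).trans h1
  have hlim : Tendsto (fun ε : ℝ≥0∞ =>
      2 ^ N * ε + (ENNReal.ofReal d * (2 ^ N * (eLpNorm g 2 volume + ε)) + ε)) (𝓝[>] 0)
      (𝓝 (2 ^ N * 0 + (ENNReal.ofReal d * (2 ^ N * (eLpNorm g 2 volume + 0)) + 0))) := by
    refine Tendsto.mono_left ?_ nhdsWithin_le_nhds
    have c1 : Continuous fun ε : ℝ≥0∞ => 2 ^ N * ε :=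
      ENNReal.continuous_const_mul (by finiteness)
    have c2 : Continuous fun ε : ℝ≥0∞ => 2 ^ N * (eLpNorm g 2 volume + ε) :=
      c1.comp (continuous_const.add continuous_id)
    have c3 : Continuous fun ε : ℝ≥0∞ =>
        ENNReal.ofReal d * (2 ^ N * (eLpNorm g 2 volume + ε)) :=
      (ENNReal.continuous_const_mul (by finiteness)).comp c2
    exact (c1.add (c3.add continuous_id)).tendsto 0
  have := ge_of_tendsto hlim (eventually_nhdsWithin_of_forall fun ε h => hε ε h)
  simpa using this

end SobolevInequality

section Interpolation

variable {𝕜 : Type*} [RCLike 𝕜] {N : ℕ}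

local notation "𝔼" => EuclideanSpace ℝ (Fin N)
local notation "𝔾" => EuclideanSpace 𝕜 (Fin N)

/-! ### Powers between 2 and the critical exponent -/

theorem rpow_le_interpolation {r s η t : ℝ} (h2 : 2 < r) (hs : r < s) (hη : 0 < η) (ht : 0 ≤ t) :
    t ^ r ≤ η ^ (r - 2) * t ^ 2 + (η ^ (s - r))⁻¹ * t ^ s := by
  rcases ht.eq_or_lt with rfl | ht
  · rw [Real.zero_rpow (by linarith), Real.zero_rpow (by linarith)]
    simp
  rcases le_total t η with h | h
  · have h1 : t ^ r = t ^ (r - 2) * t ^ 2 := by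
      rw [← Real.rpow_two, ← Real.rpow_add ht]
      congr 1; ring
    have h3 : t ^ (r - 2) ≤ η ^ (r - 2) := Real.rpow_le_rpow ht.le h (by linarith)
    have h4 : 0 ≤ (η ^ (s - r))⁻¹ * t ^ s := by positivity
    rw [h1]
    nlinarith [sq_nonneg t]
  · have h1 : t ^ s = t ^ (s - r) * t ^ r := by
      rw [← Real.rpow_add ht]
      congr 1; ring
    have h3 : η ^ (s - r) ≤ t ^ (s - r) := Real.rpow_le_rpow hη.le h (by linarith)
    have h4 : 0 ≤ η ^ (r - 2) * t ^ 2 := by positivity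
    have h5 : 0 < η ^ (s - r) := by positivity
    have h6 : t ^ r ≤ (η ^ (s - r))⁻¹ * t ^ s := by
      rw [le_inv_mul_iff₀ h5, h1]
      gcongr
    linarith

theorem exists_rpow_le_small_sq {r s : ℝ} (h2 : 2 < r) (hs : r < s) {ε : ℝ} (hε : 0 < ε) :
    ∃ K : ℝ, 0 < K ∧ ∀ t : ℝ, 0 ≤ t → t ^ r ≤ ε * t ^ 2 + K * t ^ s := by
  have hη : 0 < ε ^ (r - 2)⁻¹ := by positivity
  refine ⟨((ε ^ (r - 2)⁻¹) ^ (s - r))⁻¹, by positivity, fun t ht => ?_⟩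
  have := rpow_le_interpolation h2 hs hη ht
  rwa [← Real.rpow_mul hε.le, inv_mul_cancel₀ (by linarith), Real.rpow_one] at this

theorem exists_rpow_le_small_crit {r s : ℝ} (h2 : 2 < r) (hs : r < s) {ε : ℝ} (hε : 0 < ε) :
    ∃ K : ℝ, 0 < K ∧ ∀ t : ℝ, 0 ≤ t → t ^ r ≤ K * t ^ 2 + ε * t ^ s := by
  have hη : 0 < (ε⁻¹) ^ (s - r)⁻¹ := by positivity
  refine ⟨((ε⁻¹) ^ (s - r)⁻¹) ^ (r - 2), by positivity, fun t ht => ?_⟩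
  have := rpow_le_interpolation h2 hs hη ht
  rwa [← Real.rpow_mul (inv_pos.2 hε).le (s - r)⁻¹ (s - r), inv_mul_cancel₀ (by linarith),
    Real.rpow_one, inv_inv] at this

theorem integrable_norm_sq {α F : Type*} {m : MeasurableSpace α} {ν : Measure α}
    [NormedAddCommGroup F] {f : α → F} (hf : MemLp f 2 ν) : Integrable (fun x => ‖f x‖ ^ 2) ν :=
  hf.integrable_norm_pow two_ne_zero

theorem HasSobGrad.integrable_critExp (hN : 3 ≤ N) {u : 𝔼 → 𝕜} {g : 𝔼 → 𝔾}
    (hu : HasSobGrad u g) : Integrable (fun x => ‖u x‖ ^ critExp N) volume := by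
  have h0 : 0 < critExp N := by linarith [two_lt_critExp hN]
  have := (hu.memLp_critExp hN).integrable_norm_rpow (by simpa using h0) (by simp)
  rwa [ENNReal.toReal_ofReal h0.le] at this

theorem HasSobGrad.integrable_rpow (hN : 3 ≤ N) {r : ℝ} (hr : r ∈ Set.Ioo 2 (critExp N))
    {u : 𝔼 → 𝕜} {g : 𝔼 → 𝔾} (hu : HasSobGrad u g) :
    Integrable (fun x => ‖u x‖ ^ r) volume := by
  obtain ⟨K, -, hK⟩ := exists_rpow_le_small_sq hr.1 hr.2 one_pos
  refine ((((integrable_norm_sq hu.memLp).const_mul 1).add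
    ((hu.integrable_critExp hN).const_mul K))).mono'
    (hu.memLp.1.norm.aemeasurable.pow_const r).aestronglyMeasurable
    (Eventually.of_forall fun x => ?_)
  rw [Real.norm_of_nonneg (by positivity)]
  exact hK _ (norm_nonneg _)

/-- Pointwise interpolation between `|u|²` and `|u| ^ 2*`, integrated and combined with the
Sobolev inequality. -/
theorem HasSobGrad.integral_rpow_le (hN : 3 ≤ N) {r : ℝ} (hr : r ∈ Set.Ioo 2 (critExp N))
    {a b Cs : ℝ} (hb : 0 ≤ b)
    (hab : ∀ t : ℝ, 0 ≤ t → t ^ r ≤ a * t ^ 2 + b * t ^ critExp N)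
    (hCs : ∀ (u : 𝔼 → 𝕜) (g : 𝔼 → 𝔾), HasSobGrad u g →
      ∫ x, ‖u x‖ ^ critExp N ≤ Cs * (∫ x, ‖g x‖ ^ 2) ^ sobExp N)
    {u : 𝔼 → 𝕜} {g : 𝔼 → 𝔾} (hu : HasSobGrad u g) :
    ∫ x, ‖u x‖ ^ r ≤ a * (∫ x, ‖u x‖ ^ 2) + b * (Cs * (∫ x, ‖g x‖ ^ 2) ^ sobExp N) := by
  have i1 := (integrable_norm_sq hu.memLp).const_mul a
  have i2 := (hu.integrable_critExp hN).const_mul b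
  calc ∫ x, ‖u x‖ ^ r ≤ ∫ x, (a * ‖u x‖ ^ 2 + b * ‖u x‖ ^ critExp N) :=
        integral_mono (hu.integrable_rpow hN hr) (i1.add i2) fun x => hab _ (norm_nonneg _)
    _ = a * (∫ x, ‖u x‖ ^ 2) + b * ∫ x, ‖u x‖ ^ critExp N := by
        rw [integral_add i1 i2, integral_const_mul, integral_const_mul]
    _ ≤ _ := by
        gcongr
        exact hCs u g hu

theorem ae_eq_zero_of_integral_sq_eq_zero {α F : Type*} {m : MeasurableSpace α} {ν : Measure α}
    [NormedAddCommGroup F] {f : α → F} (hf : MemLp f 2 ν) (h : ∫ x, ‖f x‖ ^ 2 ∂ν = 0) :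
    f =ᵐ[ν] 0 := by
  have := (integral_eq_zero_iff_of_nonneg (fun x => by positivity) (integrable_norm_sq hf)).1 h
  filter_upwards [this] with x hx
  simpa using hx

/-- A function in `H¹` with vanishing gradient is zero. -/
theorem HasSobGrad.ae_zero_of_grad (hN : 3 ≤ N) {u : 𝔼 → 𝕜} {g : 𝔼 → 𝔾} (hu : HasSobGrad u g)
    (h : ∫ x, ‖g x‖ ^ 2 = 0) : u =ᵐ[volume] 0 := by
  obtain ⟨C, -, hC⟩ := exists_sobolev_const hN 𝕜
  have h1 := hC u g hu
  rw [h, Real.zero_rpow (by linarith [one_lt_sobExp hN]), mul_zero] at h1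
  have h2 : ∫ x, ‖u x‖ ^ critExp N = 0 := le_antisymm h1 (by positivity)
  have h3 := (integral_eq_zero_iff_of_nonneg (fun x => by positivity)
    (hu.integrable_critExp hN)).1 h2
  filter_upwards [h3] with x hx
  have hx' : ‖u x‖ ^ critExp N = 0 := hx
  rw [Real.rpow_eq_zero (norm_nonneg _) (by linarith [two_lt_critExp hN])] at hx'
  simpa using hx'

end Interpolation

section WeakLimits

variable {𝕜 : Type*} [RCLike 𝕜] {N : ℕ}

local notation "𝔼" => EuclideanSpace ℝ (Fin N)
local notation "𝔾" => EuclideanSpace 𝕜 (Fin N)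

/-! ### Weak limits and local compactness -/

open TopologicalSpace in
theorem exists_weak_subseq {H : Type*} [NormedAddCommGroup H] [InnerProductSpace ℝ H]
    [CompleteSpace H] [SeparableSpace H] (x : ℕ → H) {C : ℝ} (hx : ∀ n, ‖x n‖ ≤ C) :
    ∃ (z : H) (ns : ℕ → ℕ), StrictMono ns ∧
      ∀ y, Tendsto (fun n => inner ℝ (x (ns n)) y) atTop (𝓝 (inner ℝ z y)) := by
  let f : ℕ → WeakDual ℝ H := fun n => StrongDual.toWeakDual (InnerProductSpace.toDual ℝ H (x n))
  obtain ⟨z, -, ns, hns, hz⟩ := WeakDual.isSeqCompact_closedBall ℝ H (0 : StrongDual ℝ H) C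
    (x := f) (fun n => by simpa [f] using hx n)
  refine ⟨(InnerProductSpace.toDual ℝ H).symm (WeakDual.toStrongDual z), ns, hns, fun y => ?_⟩
  have := ((WeakDual.eval_continuous y).tendsto z).comp hz
  rw [InnerProductSpace.toDual_symm_apply]
  exact this

theorem exists_weak_subseq_L2 {F : Type*} [NormedAddCommGroup F] [InnerProductSpace ℝ F]
    [FiniteDimensional ℝ F] (u : ℕ → 𝔼 → F) (hu : ∀ n, MemLp (u n) 2 volume) {C : ℝ}
    (hC : ∀ n, ∫ x, ‖u n x‖ ^ 2 ≤ C) :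
    ∃ (z : 𝔼 → F) (ns : ℕ → ℕ), MemLp z 2 volume ∧ StrictMono ns ∧
      ∀ h : 𝔼 → F, MemLp h 2 volume →
        Tendsto (fun n => ∫ x, inner ℝ (u (ns n) x) (h x)) atTop
          (𝓝 (∫ x, inner ℝ (z x) (h x))) := by
  have : ProperSpace F := FiniteDimensional.proper ℝ F
  have : Fact ((2 : ℝ≥0∞) ≠ ⊤) := ⟨ENNReal.ofNat_ne_top⟩
  have hinner : ∀ {a b : 𝔼 → F} (ha : MemLp a 2 volume) (hb : MemLp b 2 volume),
      inner ℝ (ha.toLp a) (hb.toLp b) = ∫ x, inner ℝ (a x) (b x) := by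
    intro a b ha hb
    rw [L2.inner_def]
    refine integral_congr_ae ?_
    filter_upwards [ha.coeFn_toLp, hb.coeFn_toLp] with x h1 h2
    rw [h1, h2]
  obtain ⟨z, ns, hns, hz⟩ := exists_weak_subseq (fun n => (hu n).toLp (u n)) (C := Real.sqrt C)
    (fun n => by
      refine Real.le_sqrt_of_sq_le (le_trans (le_of_eq ?_) (hC n))
      rw [← real_inner_self_eq_norm_sq, hinner (hu n) (hu n)]
      simp only [real_inner_self_eq_norm_sq])
  refine ⟨z, ns, Lp.memLp z, hns, fun h hh => ?_⟩
  have := hz (hh.toLp h)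
  simp only [hinner] at this
  convert this using 2
  rw [← hinner (Lp.memLp z) hh, Lp.toLp_coeFn]

theorem integral_inner_smul_const {F : Type*} [NormedAddCommGroup F] [InnerProductSpace ℝ F]
    [CompleteSpace F] {ψ : 𝔼 → ℝ} {f : 𝔼 → F} (h : Integrable (fun x => ψ x • f x) volume) (c : F) :
    ∫ x, inner ℝ (f x) (ψ x • c) = inner ℝ c (∫ x, ψ x • f x) := by
  rw [← integral_inner h c]
  congr 1
  ext x
  rw [inner_smul_right, inner_smul_right, real_inner_comm]

theorem IsWeakGradient.of_weak_limit {u : ℕ → 𝔼 → 𝕜} {g : ℕ → 𝔼 → 𝔾}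
    (hu : ∀ n, HasSobGrad (u n) (g n)) {z : 𝔼 → 𝕜} {h : 𝔼 → 𝔾} (hz : MemLp z 2 volume)
    (hh : MemLp h 2 volume)
    (hzl : ∀ k : 𝔼 → 𝕜, MemLp k 2 volume →
      Tendsto (fun n => ∫ x, inner ℝ (u n x) (k x)) atTop (𝓝 (∫ x, inner ℝ (z x) (k x))))
    (hhl : ∀ k : 𝔼 → 𝔾, MemLp k 2 volume →
      Tendsto (fun n => ∫ x, inner ℝ (g n x) (k x)) atTop (𝓝 (∫ x, inner ℝ (h x) (k x)))) :
    IsWeakGradient z h := by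
  intro φ hφ hc i
  refine ext_inner_left ℝ fun c => ?_
  set e := EuclideanSpace.single i (1 : ℝ)
  have hd := continuous_fderiv_test hφ e
  have hdc := hc.fderiv_apply (𝕜 := ℝ) e
  have m1 : MemLp (fun x => fderiv ℝ φ x e • c) 2 (volume : Measure 𝔼) :=
    (hd.smul continuous_const).memLp_of_hasCompactSupport hdc.smul_right
  have m2 : MemLp (fun x => φ x • EuclideanSpace.single i c) 2 (volume : Measure 𝔼) :=
    (hφ.continuous.smul continuous_const).memLp_of_hasCompactSupport hc.smul_right
  have t1 := hzl _ m1
  have t2 := hhl _ m2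
  have hcomp : ∀ (f : 𝔼 → 𝔾), MemLp f 2 volume →
      ∫ x, inner ℝ (f x) (φ x • EuclideanSpace.single i c) = inner ℝ c (∫ x, φ x • f x i) := by
    intro f hf
    rw [← integral_inner_smul_const
      (integrable_smul_of_test hφ.continuous hc (memLp_coord hf i))]
    congr 1
    ext x
    rw [PiLp.inner_apply, Finset.sum_eq_single i]
    · simp
    · intro j _ hj
      simp [hj]
    · simp
  simp only [hcomp _ (hu _).memLp_grad, hcomp _ hh] at t2
  simp only [integral_inner_smul_const (integrable_smul_of_test hd hdc (hu _).memLp),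
    integral_inner_smul_const (integrable_smul_of_test hd hdc hz)] at t1
  rw [inner_neg_right]
  refine tendsto_nhds_unique t1 ?_
  refine t2.neg.congr fun n => ?_
  rw [(hu n).weak φ hφ hc i, inner_neg_right]

/-- A positive integrable weight, bounded by `1`, that makes Lebesgue measure finite. -/
noncomputable def weight (x : 𝔼) : ℝ := (1 + ‖x‖) ^ (-((N : ℝ) + 1))

theorem weight_pos (x : 𝔼) : 0 < weight x := by
  unfold weight; positivity

theorem weight_le_one (x : 𝔼) : weight x ≤ 1 :=
  Real.rpow_le_one_of_one_le_of_nonpos (by linarith [norm_nonneg x])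
    (by linarith [N.cast_nonneg (α := ℝ)])

theorem continuous_weight : Continuous (weight : 𝔼 → ℝ) :=
  (continuous_const.add continuous_norm).rpow_const fun x => Or.inl
    (add_pos_of_pos_of_nonneg one_pos (norm_nonneg x)).ne'

theorem integrable_weight : Integrable (weight : 𝔼 → ℝ) volume :=
  integrable_one_add_norm (by rw [finrank_euclideanSpace_fin]; linarith)

theorem norm_mollify_le {F : Type*} [NormedAddCommGroup F] [NormedSpace ℝ F]
    (ρ : ContDiffBump (0 : 𝔼)) {f : 𝔼 → F} (hf : MemLp f 2 volume) (x : 𝔼) :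
    ‖mollify ρ f x‖ ≤ 1 / 2 * (∫ t : 𝔼, ρ.normed volume t ^ 2) + 1 / 2 * ∫ t, ‖f t‖ ^ 2 := by
  have i1 : Integrable (fun t : 𝔼 => ρ.normed volume t ^ 2) volume := by
    have := integrable_norm_sq (ρ.continuous_normed (μ := (volume : Measure 𝔼))
      |>.memLp_of_hasCompactSupport (p := 2) (μ := volume) ρ.hasCompactSupport_normed)
    simpa using this
  have i1' := i1.comp_sub_left x
  have i2 := integrable_norm_sq hf
  have hle : ∀ t, ‖ρ.normed volume (x - t) • f t‖
      ≤ 1 / 2 * ρ.normed volume (x - t) ^ 2 + 1 / 2 * ‖f t‖ ^ 2 := by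
    intro t
    rw [norm_smul, Real.norm_of_nonneg (ρ.nonneg_normed _)]
    nlinarith [sq_nonneg (ρ.normed volume (x - t) - ‖f t‖)]
  calc ‖mollify ρ f x‖ ≤ ∫ t, ‖ρ.normed volume (x - t) • f t‖ := norm_integral_le_integral_norm _
    _ ≤ ∫ t, (1 / 2 * ρ.normed volume (x - t) ^ 2 + 1 / 2 * ‖f t‖ ^ 2) :=
        integral_mono (integrable_mollify ρ hf x).norm
          ((i1'.const_mul _).add (i2.const_mul _)) hle
    _ = _ := by
        rw [integral_add (i1'.const_mul _) (i2.const_mul _), integral_const_mul,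
          integral_const_mul, integral_sub_left_eq_self (fun t => ρ.normed volume t ^ 2) volume x]

theorem eLpNorm_two_eq_ofReal {α F : Type*} {m : MeasurableSpace α} {ν : Measure α}
    [NormedAddCommGroup F] {f : α → F} (hf : MemLp f 2 ν) :
    eLpNorm f 2 ν ^ 2 = ENNReal.ofReal (∫ x, ‖f x‖ ^ 2 ∂ν) := by
  rw [sq_eLpNorm_two, ofReal_integral_eq_lintegral_ofReal (integrable_norm_sq hf)
    (Eventually.of_forall fun x => by positivity)]
  refine lintegral_congr fun x => ?_
  rw [← ofReal_norm, ENNReal.ofReal_pow (norm_nonneg _)]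

/-- The mollification error of an `H¹` function is controlled by its gradient. -/
theorem HasSobGrad.integral_mollify_sub_le {u : 𝔼 → 𝕜} {g : 𝔼 → 𝔾} (hu : HasSobGrad u g)
    (ρ : ContDiffBump (0 : 𝔼)) :
    MemLp (fun x => mollify ρ u x - u x) 2 volume ∧
    ∫ x, ‖mollify ρ u x - u x‖ ^ 2 ≤ ρ.rOut ^ 2 * (2 ^ N) ^ 2 * ∫ x, ‖g x‖ ^ 2 := by
  have h := eLpNorm_mollify_sub_le ρ hu.memLp
    (δ := ENNReal.ofReal ρ.rOut * (2 ^ N * eLpNorm g 2 volume)) (fun y hy => by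
      have := hu.eLpNorm_affine_sub_le (τ := 0) (by norm_num) (-y) MeasurableSet.univ
        (d := ρ.rOut) (fun x _ => by simpa using hy)
      simpa [sub_eq_add_neg] using this)
  have hm : MemLp (fun x => mollify ρ u x - u x) 2 volume :=
    ⟨(contDiff_mollify ρ hu.memLp).continuous.aestronglyMeasurable.sub hu.memLp.1,
      h.trans_lt (by have := hu.memLp_grad.2; finiteness)⟩
  refine ⟨hm, ?_⟩
  have h2 := pow_le_pow_left' h 2
  rw [eLpNorm_two_eq_ofReal hm, mul_pow, mul_pow, eLpNorm_two_eq_ofReal hu.memLp_grad,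
    show ((2 : ℝ≥0∞) ^ N) ^ 2 = ENNReal.ofReal ((2 ^ N) ^ 2) by
      rw [ENNReal.ofReal_pow (by positivity), ENNReal.ofReal_pow (by positivity)]; simp,
    ← ENNReal.ofReal_pow ρ.rOut_pos.le, ← ENNReal.ofReal_mul (by positivity),
    ← ENNReal.ofReal_mul (by positivity),
    ENNReal.ofReal_le_ofReal_iff (by have : 0 ≤ ∫ x, ‖g x‖ ^ 2 := by positivity
                                     positivity)] at h2
  linarith

theorem tendsto_norm_of_tendsto_inner {α : Type*} {l : Filter α} {f : α → 𝕜}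
    (h : ∀ c : 𝕜, Tendsto (fun n => inner ℝ c (f n)) l (𝓝 0)) :
    Tendsto (fun n => ‖f n‖ ^ 2) l (𝓝 0) := by
  have h1 := ((h 1).pow 2).add ((h RCLike.I).pow 2)
  norm_num at h1
  refine h1.congr fun n => ?_
  rw [RCLike.norm_sq_eq_def]
  have e1 : inner ℝ (1 : 𝕜) (f n) = RCLike.re (f n) := by
    change RCLike.re (inner 𝕜 (1 : 𝕜) (f n)) = _
    simp
  have e2 : inner ℝ (RCLike.I : 𝕜) (f n) = RCLike.im (f n) := by
    change RCLike.re (inner 𝕜 (RCLike.I : 𝕜) (f n)) = _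
    simp
  rw [e1, e2]
  ring

/-- Local compactness of the embedding of `H¹` into `L²`: a bounded sequence in `H¹` that tends to
zero weakly in `L²` tends to zero in the weighted space. Mollifications tend to zero pointwise,
and they are uniformly close to the functions. -/
theorem tendsto_integral_weight_sq {u : ℕ → 𝔼 → 𝕜} {g : ℕ → 𝔼 → 𝔾}
    (hu : ∀ n, HasSobGrad (u n) (g n)) {C : ℝ} (hC : ∀ n, ∫ x, ‖u n x‖ ^ 2 ≤ C)
    (hC' : ∀ n, ∫ x, ‖g n x‖ ^ 2 ≤ C)
    (hw : ∀ k : 𝔼 → 𝕜, MemLp k 2 volume →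
      Tendsto (fun n => ∫ x, inner ℝ (u n x) (k x)) atTop (𝓝 0)) :
    Tendsto (fun n => ∫ x, weight x * ‖u n x‖ ^ 2) atTop (𝓝 0) := by
  have hC0 : 0 ≤ C := le_trans (by positivity) (hC 0)
  have hmol : ∀ ρ : ContDiffBump (0 : 𝔼),
      Tendsto (fun n => ∫ x, weight x * ‖mollify ρ (u n) x‖ ^ 2) atTop (𝓝 0) := by
    intro ρ
    set B := 1 / 2 * (∫ t : 𝔼, ρ.normed volume t ^ 2) + 1 / 2 * C
    have hlim := tendsto_integral_of_dominated_convergence (μ := (volume : Measure 𝔼))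
      (F := fun n x => weight x * ‖mollify ρ (u n) x‖ ^ 2) (f := fun _ => (0 : ℝ))
      (fun x => weight x * B ^ 2)
      (fun n => (continuous_weight.mul
        ((contDiff_mollify ρ (hu n).memLp).continuous.norm.pow 2)).aestronglyMeasurable)
      (integrable_weight.mul_const _)
      (fun n => Eventually.of_forall fun x => by
        rw [Real.norm_of_nonneg (mul_nonneg (weight_pos x).le (by positivity))]
        have h1 := norm_mollify_le ρ (hu n).memLp x
        have h2 : ‖mollify ρ (u n) x‖ ≤ B := h1.trans (by
          simp only [B]
          linarith [hC n])
        have := (weight_pos x).le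
        gcongr)
      (Eventually.of_forall fun x => by
        have h1 : Tendsto (fun n => ‖mollify ρ (u n) x‖ ^ 2) atTop (𝓝 0) := by
          refine tendsto_norm_of_tendsto_inner fun c => ?_
          have hk : MemLp (fun t => ρ.normed volume (x - t) • c) 2 (volume : Measure 𝔼) :=
            ((ρ.continuous_normed.comp (continuous_const.sub continuous_id)).smul
              continuous_const).memLp_of_hasCompactSupport
              ((ρ.hasCompactSupport_normed.comp_homeomorph
                (Homeomorph.subLeft x)).smul_right)
          refine (hw _ hk).congr fun n => ?_
          exact integral_inner_smul_const (integrable_mollify ρ (hu n).memLp x) c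
        simpa using h1.const_mul (weight x))
    simpa using hlim
  rw [Metric.tendsto_atTop]
  intro ε hε
  -- a mollification radius at which the error is at most a quarter of the target
  let r : ℝ := Real.sqrt (ε / (8 * ((2 ^ N) ^ 2 * (C + 1))))
  have hr : 0 < r := Real.sqrt_pos.2 (by positivity)
  let ρ : ContDiffBump (0 : 𝔼) := ⟨r / 2, r, half_pos hr, half_lt_self hr⟩
  have hρ : ρ.rOut ^ 2 * (2 ^ N) ^ 2 * C ≤ ε / 8 := by
    change r ^ 2 * (2 ^ N) ^ 2 * C ≤ ε / 8
    rw [Real.sq_sqrt (by positivity)]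
    calc ε / (8 * ((2 ^ N) ^ 2 * (C + 1))) * (2 ^ N) ^ 2 * C
        ≤ ε / (8 * ((2 ^ N) ^ 2 * (C + 1))) * (2 ^ N) ^ 2 * (C + 1) := by
          gcongr; linarith
      _ = ε / 8 := by field_simp
  obtain ⟨n0, hn0⟩ := Metric.tendsto_atTop.1 (hmol ρ) (ε / 4) (by positivity)
  refine ⟨n0, fun n hn => ?_⟩
  obtain ⟨hm, hle⟩ := (hu n).integral_mollify_sub_le ρ
  have hI : Integrable (fun x => weight x * ‖mollify ρ (u n) x‖ ^ 2) (volume : Measure 𝔼) := by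
    refine (integrable_weight.mul_const ((1 / 2 * (∫ t : 𝔼, ρ.normed volume t ^ 2)
      + 1 / 2 * C) ^ 2)).mono' (continuous_weight.mul
        ((contDiff_mollify ρ (hu n).memLp).continuous.norm.pow 2)).aestronglyMeasurable
      (Eventually.of_forall fun x => ?_)
    rw [Real.norm_of_nonneg (mul_nonneg (weight_pos x).le (by positivity))]
    have h1 := norm_mollify_le ρ (hu n).memLp x
    have h2 : ‖mollify ρ (u n) x‖ ≤ 1 / 2 * (∫ t : 𝔼, ρ.normed volume t ^ 2) + 1 / 2 * C := by
      linarith [hC n]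
    have := (weight_pos x).le
    gcongr
  have hpt : ∀ x, weight x * ‖u n x‖ ^ 2
      ≤ 2 * ‖mollify ρ (u n) x - u n x‖ ^ 2 + 2 * (weight x * ‖mollify ρ (u n) x‖ ^ 2) := by
    intro x
    have h1 : ‖u n x‖ ≤ ‖mollify ρ (u n) x - u n x‖ + ‖mollify ρ (u n) x‖ := by
      have := norm_sub_le (mollify ρ (u n) x) (mollify ρ (u n) x - u n x)
      simp only [sub_sub_cancel] at this
      linarith
    have h2 : ‖u n x‖ ^ 2 ≤ 2 * ‖mollify ρ (u n) x - u n x‖ ^ 2 + 2 * ‖mollify ρ (u n) x‖ ^ 2 := by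
      have := pow_le_pow_left₀ (norm_nonneg _) h1 2
      nlinarith [sq_nonneg (‖mollify ρ (u n) x - u n x‖ - ‖mollify ρ (u n) x‖)]
    have h3 := weight_le_one x
    have h4 := (weight_pos x).le
    nlinarith [sq_nonneg ‖mollify ρ (u n) x - u n x‖]
  have hwI : Integrable (fun x => weight x * ‖u n x‖ ^ 2) (volume : Measure 𝔼) := by
    refine (integrable_norm_sq (hu n).memLp).mono' (continuous_weight.aestronglyMeasurable.mul
      ((hu n).memLp.1.norm.pow 2)) (Eventually.of_forall fun x => ?_)
    rw [Real.norm_of_nonneg (mul_nonneg (weight_pos x).le (by positivity))]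
    exact mul_le_of_le_one_left (by positivity) (weight_le_one x)
  have hkey : ∫ x, weight x * ‖u n x‖ ^ 2
      ≤ 2 * (∫ x, ‖mollify ρ (u n) x - u n x‖ ^ 2)
        + 2 * ∫ x, weight x * ‖mollify ρ (u n) x‖ ^ 2 := by
    rw [← integral_const_mul, ← integral_const_mul,
      ← integral_add ((integrable_norm_sq hm).const_mul 2) (hI.const_mul 2)]
    exact integral_mono hwI (((integrable_norm_sq hm).const_mul 2).add (hI.const_mul 2)) hpt
  have hn1 := hn0 n hn
  rw [Real.dist_eq, sub_zero] at hn1 ⊢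
  rw [abs_of_nonneg (integral_nonneg fun x => mul_nonneg (weight_pos x).le (by positivity))]
  have h5 : ρ.rOut ^ 2 * (2 ^ N) ^ 2 * ∫ x, ‖g n x‖ ^ 2 ≤ ρ.rOut ^ 2 * (2 ^ N) ^ 2 * C := by
    gcongr
    exact hC' n
  have h6 := le_abs_self (∫ x, weight x * ‖mollify ρ (u n) x‖ ^ 2)
  linarith

end WeakLimits

section BrezisLieb

variable {𝕜 : Type*} [RCLike 𝕜] {N : ℕ}

local notation "𝔼" => EuclideanSpace ℝ (Fin N)
local notation "𝔾" => EuclideanSpace 𝕜 (Fin N)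

/-! ### The Brezis–Lieb lemma -/

theorem rpow_sub_rpow_le {r x y : ℝ} (hr : 1 ≤ r) (hx : 0 ≤ x) (hxy : x ≤ y) :
    y ^ r - x ^ r ≤ r * y ^ (r - 1) * (y - x) := by
  rcases (hx.trans hxy).eq_or_lt with h | hy
  · have hx0 : x = 0 := le_antisymm (h ▸ hxy) hx
    simp [← h, hx0]
  have hb := one_add_mul_self_le_rpow_one_add (s := x / y - 1)
    (by have := div_nonneg hx hy.le; linarith) hr
  rw [show 1 + (x / y - 1) = x / y by ring, Real.div_rpow hx hy.le,
    le_div_iff₀ (Real.rpow_pos_of_pos hy r)] at hb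
  have hyr : y ^ r = y ^ (r - 1) * y := by
    rw [Real.rpow_sub_one hy.ne']
    field_simp
  have e : r * (x / y - 1) * y ^ r = - (r * y ^ (r - 1) * (y - x)) := by
    rw [hyr]
    field_simp
    ring
  nlinarith

/-- The elementary inequality behind the Brezis–Lieb lemma: the error of order `t ^ (r - 1) d` is
absorbed into `ε t ^ r` if `d` is small compared with `t`, and into `K d ^ r` otherwise. -/
theorem exists_rpow_add_sub_le {r : ℝ} (hr : 1 < r) {ε : ℝ} (hε : 0 < ε) :
    ∃ K : ℝ, 0 < K ∧ ∀ s t d : ℝ, 0 ≤ s → 0 ≤ t → 0 ≤ d → |s - t| ≤ d →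
      |s ^ r - t ^ r| ≤ ε * t ^ r + K * d ^ r := by
  let θ : ℝ := min 1 (ε / (r * 2 ^ (r - 1)))
  have hθ : 0 < θ := lt_min one_pos (by positivity)
  refine ⟨r * (1 / θ + 1) ^ (r - 1), by positivity, fun s t d hs ht hd h => ?_⟩
  have hr1 : 0 < r - 1 := by linarith
  have h1 : |s ^ r - t ^ r| ≤ r * (t + d) ^ (r - 1) * d := by
    have aux : ∀ x y : ℝ, 0 ≤ x → x ≤ y → y ≤ t + d → y - x ≤ d →
        y ^ r - x ^ r ≤ r * (t + d) ^ (r - 1) * d := by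
      intro x y hx hxy hy hyx
      refine (rpow_sub_rpow_le hr.le hx hxy).trans ?_
      have hy0 : 0 ≤ y := hx.trans hxy
      gcongr
    rw [abs_le] at h
    rcases le_total s t with hst | hst
    · rw [abs_of_nonpos (by linarith [Real.rpow_le_rpow hs hst (by linarith : 0 ≤ r)]), neg_sub]
      exact aux s t hs hst (by linarith) (by linarith)
    · rw [abs_of_nonneg (by linarith [Real.rpow_le_rpow ht hst (by linarith : 0 ≤ r)])]
      exact aux t s ht hst (by linarith) (by linarith)
  have hpow : ∀ x : ℝ, 0 ≤ x → x ^ (r - 1) * x = x ^ r := by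
    intro x hx
    conv_lhs => rw [← Real.rpow_one x]
    rw [← Real.rpow_mul hx, one_mul, ← Real.rpow_add' hx (by linarith)]
    congr 1; ring
  refine h1.trans ?_
  have p1 : 0 ≤ t ^ r := by positivity
  have p2 : 0 ≤ d ^ r := by positivity
  rcases le_total d (θ * t) with hdt | hdt
  · have hd' : d ≤ t := hdt.trans (mul_le_of_le_one_left ht (min_le_left _ _))
    have hθ2 : θ ≤ ε / (r * 2 ^ (r - 1)) := min_le_right _ _
    calc r * (t + d) ^ (r - 1) * d ≤ r * (2 * t) ^ (r - 1) * (θ * t) := by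
          gcongr; linarith
      _ = r * 2 ^ (r - 1) * θ * t ^ r := by
          rw [Real.mul_rpow two_pos.le ht, ← hpow t ht]; ring
      _ ≤ ε * t ^ r := by
          gcongr
          rw [le_div_iff₀ (by positivity)] at hθ2
          linarith
      _ ≤ _ := le_add_of_nonneg_right (by positivity)
  · have ht' : t ≤ 1 / θ * d := by
      rw [one_div, le_inv_mul_iff₀ hθ]; exact hdt
    calc r * (t + d) ^ (r - 1) * d ≤ r * ((1 / θ + 1) * d) ^ (r - 1) * d := by
          gcongr; linarith
      _ = r * (1 / θ + 1) ^ (r - 1) * d ^ r := by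
          rw [Real.mul_rpow (by positivity) hd, ← hpow d hd]; ring
      _ ≤ _ := le_add_of_nonneg_left (by positivity)

/-- The **Brezis–Lieb lemma**. -/
theorem tendsto_integral_rpow_sub {r : ℝ} (hr : 1 < r) {u : ℕ → 𝔼 → 𝕜} {z : 𝔼 → 𝕜}
    (hui : ∀ n, Integrable (fun x => ‖u n x‖ ^ r) volume)
    (hzi : Integrable (fun x => ‖z x‖ ^ r) volume)
    (hdi : ∀ n, Integrable (fun x => ‖u n x - z x‖ ^ r) volume)
    {C : ℝ} (hC : ∀ n, ∫ x, ‖u n x - z x‖ ^ r ≤ C)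
    (hae : ∀ᵐ x, Tendsto (fun n => u n x) atTop (𝓝 (z x))) :
    Tendsto (fun n => (∫ x, ‖u n x‖ ^ r) - ∫ x, ‖u n x - z x‖ ^ r) atTop
      (𝓝 (∫ x, ‖z x‖ ^ r)) := by
  have hC0 : 0 ≤ C := le_trans (integral_nonneg fun x => by positivity) (hC 0)
  have hr0 : 0 < r := by linarith
  rw [Metric.tendsto_atTop]
  intro δ hδ
  let ε : ℝ := δ / (2 * (C + 1))
  have hε : 0 < ε := by positivity
  obtain ⟨K, hK0, hK⟩ := exists_rpow_add_sub_le hr hε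
  let D : ℕ → 𝔼 → ℝ := fun n x => |‖u n x‖ ^ r - ‖u n x - z x‖ ^ r - ‖z x‖ ^ r|
  -- the part of the error that is not absorbed is dominated by a multiple of `|z| ^ r`
  let W : ℕ → 𝔼 → ℝ := fun n x => max (D n x - ε * ‖u n x - z x‖ ^ r) 0
  have hDi : ∀ n, Integrable (D n) volume := fun n => (((hui n).sub (hdi n)).sub hzi).abs
  have hWi : ∀ n, Integrable (W n) volume := fun n =>
    ((hDi n).sub ((hdi n).const_mul ε)).pos_part
  have hlim := tendsto_integral_of_dominated_convergence (μ := (volume : Measure 𝔼))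
    (F := W) (f := fun _ => (0 : ℝ)) (fun x => (K + 1) * ‖z x‖ ^ r)
    (fun n => (hWi n).1) (hzi.const_mul _)
    (fun n => Eventually.of_forall fun x => by
      rw [Real.norm_of_nonneg (le_max_right _ _)]
      refine max_le ?_ (by positivity)
      have h1 := hK ‖u n x‖ ‖u n x - z x‖ ‖z x‖ (norm_nonneg _) (norm_nonneg _) (norm_nonneg _)
        (by
          have := abs_norm_sub_norm_le (u n x) (u n x - z x)
          simpa using this)
      have h2 : D n x ≤ |‖u n x‖ ^ r - ‖u n x - z x‖ ^ r| + ‖z x‖ ^ r := by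
        refine (abs_sub _ _).trans ?_
        rw [abs_of_nonneg (by positivity : 0 ≤ ‖z x‖ ^ r)]
      linarith)
    (by
      filter_upwards [hae] with x hx
      have t1 : Tendsto (fun n => ‖u n x‖ ^ r) atTop (𝓝 (‖z x‖ ^ r)) :=
        hx.norm.rpow_const (Or.inr hr0.le)
      have t2 : Tendsto (fun n => ‖u n x - z x‖ ^ r) atTop (𝓝 (0 : ℝ)) := by
        have := (hx.sub_const (z x)).norm.rpow_const (p := r) (Or.inr hr0.le)
        simpa [Real.zero_rpow hr0.ne'] using this
      have t3 := ((((t1.sub t2).sub_const (‖z x‖ ^ r)).abs).sub (t2.const_mul ε)).max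
        (tendsto_const_nhds (x := (0 : ℝ)))
      simpa using t3)
  rw [integral_zero, Metric.tendsto_atTop] at hlim
  obtain ⟨n0, hn0⟩ := hlim (δ / 2) (by positivity)
  refine ⟨n0, fun n hn => ?_⟩
  have h1 := hn0 n hn
  rw [Real.dist_eq, sub_zero, abs_of_nonneg (integral_nonneg fun x => le_max_right _ _)] at h1
  have hidi : Integrable (fun x => ‖u n x‖ ^ r - ‖u n x - z x‖ ^ r) volume := (hui n).sub (hdi n)
  rw [Real.dist_eq, ← integral_sub (hui n) (hdi n), ← integral_sub hidi hzi]
  calc |∫ x, (‖u n x‖ ^ r - ‖u n x - z x‖ ^ r - ‖z x‖ ^ r)| ≤ ∫ x, D n x :=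
        abs_integral_le_integral_abs
    _ ≤ ∫ x, (W n x + ε * ‖u n x - z x‖ ^ r) := by
        refine integral_mono (hDi n) ((hWi n).add ((hdi n).const_mul ε)) fun x => ?_
        have := le_max_left (D n x - ε * ‖u n x - z x‖ ^ r) 0
        change D n x ≤ W n x + ε * ‖u n x - z x‖ ^ r
        linarith
    _ = (∫ x, W n x) + ε * ∫ x, ‖u n x - z x‖ ^ r := by
        rw [integral_add (hWi n) ((hdi n).const_mul ε), integral_const_mul]
    _ < δ := by
        have h2 : ε * ∫ x, ‖u n x - z x‖ ^ r ≤ ε * C := by gcongr; exact hC n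
        have h3 : ε * C ≤ δ / 2 := by
          calc ε * C ≤ ε * (C + 1) := by gcongr; linarith
            _ = δ / 2 := by simp only [ε]; field_simp
        linarith

theorem integrable_inner_of_memLp {F : Type*} [NormedAddCommGroup F] [InnerProductSpace ℝ F]
    {u v : 𝔼 → F} (hu : MemLp u 2 volume) (hv : MemLp v 2 volume) :
    Integrable (fun x => inner ℝ (u x) (v x)) volume := by
  refine ((integrable_norm_sq hu).add (integrable_norm_sq hv)).mono' (hu.1.inner hv.1)
    (Eventually.of_forall fun x => (norm_inner_le_norm _ _).trans ?_)
  change ‖u x‖ * ‖v x‖ ≤ ‖u x‖ ^ 2 + ‖v x‖ ^ 2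
  nlinarith [sq_nonneg (‖u x‖ - ‖v x‖), sq_nonneg ‖u x‖, sq_nonneg ‖v x‖]

theorem tendsto_integral_sq_sub {F : Type*} [NormedAddCommGroup F] [InnerProductSpace ℝ F]
    {u : ℕ → 𝔼 → F} {z : 𝔼 → F}
    (hu : ∀ n, MemLp (u n) 2 volume) (hz : MemLp z 2 volume)
    (hw : Tendsto (fun n => ∫ x, inner ℝ (u n x) (z x)) atTop (𝓝 (∫ x, inner ℝ (z x) (z x)))) :
    Tendsto (fun n => (∫ x, ‖u n x‖ ^ 2) - ∫ x, ‖u n x - z x‖ ^ 2) atTop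
      (𝓝 (∫ x, ‖z x‖ ^ 2)) := by
  have iz := integrable_norm_sq hz
  have e0 : ∫ x, inner ℝ (z x) (z x) = ∫ x, ‖z x‖ ^ 2 := by
    simp only [real_inner_self_eq_norm_sq]
  have h := (hw.const_mul 2).sub_const (∫ x, ‖z x‖ ^ 2)
  rw [e0, show 2 * (∫ x, ‖z x‖ ^ 2) - ∫ x, ‖z x‖ ^ 2 = ∫ x, ‖z x‖ ^ 2 by ring] at h
  refine h.congr fun n => ?_
  have ii : Integrable (fun x => inner ℝ (u n x) (z x)) volume :=
    integrable_inner_of_memLp (hu n) hz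
  have hid : Integrable (fun x => ‖u n x - z x‖ ^ 2) volume := integrable_norm_sq ((hu n).sub hz)
  rw [← integral_sub (integrable_norm_sq (hu n)) hid,
    ← integral_const_mul, ← integral_sub (ii.const_mul 2) iz]
  refine integral_congr_ae (Eventually.of_forall fun x => ?_)
  simp only [norm_sub_sq_real]
  ring

theorem integral_norm_sub_sq_le {F : Type*} [NormedAddCommGroup F] {u z : 𝔼 → F}
    (hu : MemLp u 2 volume) (hz : MemLp z 2 volume) :
    ∫ x, ‖u x - z x‖ ^ 2 ≤ 2 * (∫ x, ‖u x‖ ^ 2) + 2 * ∫ x, ‖z x‖ ^ 2 := by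
  have i1 := (integrable_norm_sq hu).const_mul 2
  have i2 := (integrable_norm_sq hz).const_mul 2
  rw [← integral_const_mul, ← integral_const_mul, ← integral_add i1 i2]
  refine integral_mono (integrable_norm_sq (hu.sub hz)) (i1.add i2) fun x => ?_
  have := pow_le_pow_left₀ (norm_nonneg _) (norm_sub_le (u x) (z x)) 2
  change ‖u x - z x‖ ^ 2 ≤ 2 * ‖u x‖ ^ 2 + 2 * ‖z x‖ ^ 2
  nlinarith [sq_nonneg (‖u x‖ - ‖z x‖)]

/-- Bounded sequences in `H¹` have subsequences that converge weakly, almost everywhere, and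
strongly in the weighted space. -/
theorem exists_weak_limit {u : ℕ → 𝔼 → 𝕜} {g : ℕ → 𝔼 → 𝔾} (hu : ∀ n, HasSobGrad (u n) (g n))
    {C : ℝ} (hC : ∀ n, ∫ x, ‖u n x‖ ^ 2 ≤ C) (hC' : ∀ n, ∫ x, ‖g n x‖ ^ 2 ≤ C) :
    ∃ (z : 𝔼 → 𝕜) (h : 𝔼 → 𝔾) (ns : ℕ → ℕ), StrictMono ns ∧ HasSobGrad z h ∧
      Tendsto (fun n => (∫ x, ‖u (ns n) x‖ ^ 2) - ∫ x, ‖u (ns n) x - z x‖ ^ 2) atTop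
        (𝓝 (∫ x, ‖z x‖ ^ 2)) ∧
      Tendsto (fun n => (∫ x, ‖g (ns n) x‖ ^ 2) - ∫ x, ‖g (ns n) x - h x‖ ^ 2) atTop
        (𝓝 (∫ x, ‖h x‖ ^ 2)) ∧
      (∀ᵐ x, Tendsto (fun n => u (ns n) x) atTop (𝓝 (z x))) ∧
      Tendsto (fun n => ∫ x, weight x * ‖u (ns n) x - z x‖ ^ 2) atTop (𝓝 0) := by
  obtain ⟨z, n1, hz, hn1, hzl⟩ := exists_weak_subseq_L2 u (fun n => (hu n).memLp) hC
  obtain ⟨h, n2, hh, hn2, hhl⟩ := exists_weak_subseq_L2 (fun n => g (n1 n))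
    (fun n => (hu (n1 n)).memLp_grad) (fun n => hC' (n1 n))
  have hzl2 : ∀ k : 𝔼 → 𝕜, MemLp k 2 volume →
      Tendsto (fun n => ∫ x, inner ℝ (u (n1 (n2 n)) x) (k x)) atTop
        (𝓝 (∫ x, inner ℝ (z x) (k x))) := fun k hk => (hzl k hk).comp hn2.tendsto_atTop
  have hS : HasSobGrad z h :=
    ⟨hz, hh, IsWeakGradient.of_weak_limit (fun n => hu (n1 (n2 n))) hz hh hzl2 hhl⟩
  have hd : ∀ n, HasSobGrad (fun x => u (n1 (n2 n)) x - z x) (fun x => g (n1 (n2 n)) x - h x) :=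
    fun n => (hu _).sub hS
  have hw := tendsto_integral_weight_sq hd
    (C := max (2 * C + 2 * ∫ x, ‖z x‖ ^ 2) (2 * C + 2 * ∫ x, ‖h x‖ ^ 2))
    (fun n => ((integral_norm_sub_sq_le (hu _).memLp hz).trans (by
      linarith [hC (n1 (n2 n))])).trans (le_max_left _ _))
    (fun n => ((integral_norm_sub_sq_le (hu _).memLp_grad hh).trans (by
      linarith [hC' (n1 (n2 n))])).trans (le_max_right _ _))
    (fun k hk => by
      have := (hzl2 k hk).sub_const (∫ x, inner ℝ (z x) (k x))
      rw [sub_self] at this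
      refine this.congr fun n => ?_
      rw [← integral_sub (integrable_inner_of_memLp (hu _).memLp hk)
        (integrable_inner_of_memLp hz hk)]
      simp only [inner_sub_left])
  have hwm : ∀ n, AEStronglyMeasurable (fun x => weight x * ‖u (n1 (n2 n)) x - z x‖ ^ 2)
      (volume : Measure 𝔼) := fun n =>
    continuous_weight.aestronglyMeasurable.mul ((hd n).memLp.1.norm.pow 2)
  have hwi : ∀ n, Integrable (fun x => weight x * ‖u (n1 (n2 n)) x - z x‖ ^ 2)
      (volume : Measure 𝔼) := fun n => by
    refine (integrable_norm_sq (hd n).memLp).mono' (hwm n) (Eventually.of_forall fun x => ?_)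
    rw [Real.norm_of_nonneg (mul_nonneg (weight_pos x).le (by positivity))]
    exact mul_le_of_le_one_left (by positivity) (weight_le_one x)
  have hL1 : Tendsto (fun n => eLpNorm ((fun x => weight x * ‖u (n1 (n2 n)) x - z x‖ ^ 2)
      - fun _ : 𝔼 => (0 : ℝ)) 1 volume) atTop (𝓝 0) := by
    have := ENNReal.tendsto_ofReal hw
    rw [ENNReal.ofReal_zero] at this
    refine this.congr fun n => ?_
    rw [ofReal_integral_eq_lintegral_ofReal (hwi n) (Eventually.of_forall fun x =>
      mul_nonneg (weight_pos x).le (by positivity)), eLpNorm_one_eq_lintegral_enorm]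
    refine lintegral_congr fun x => ?_
    simp only [Pi.sub_apply, sub_zero]
    rw [Real.enorm_of_nonneg (mul_nonneg (weight_pos x).le (by positivity))]
  obtain ⟨n3, hn3, hae⟩ := (tendstoInMeasure_of_tendsto_eLpNorm one_ne_zero hwm
    aestronglyMeasurable_const hL1).exists_seq_tendsto_ae
  refine ⟨z, h, fun n => n1 (n2 (n3 n)), hn1.comp (hn2.comp hn3), hS, ?_, ?_, ?_, ?_⟩
  · exact (tendsto_integral_sq_sub (fun n => (hu (n1 (n2 n))).memLp) hz (hzl2 z hz)).comp
      hn3.tendsto_atTop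
  · exact (tendsto_integral_sq_sub (fun n => (hu (n1 (n2 n))).memLp_grad) hh (hhl h hh)).comp
      hn3.tendsto_atTop
  · filter_upwards [hae] with x hx
    have h1 : Tendsto (fun n => ‖u (n1 (n2 (n3 n))) x - z x‖ ^ 2) atTop (𝓝 0) := by
      have := hx.const_mul (weight x)⁻¹
      rw [mul_zero] at this
      refine this.congr fun n => ?_
      rw [inv_mul_cancel_left₀ (weight_pos x).ne']
    have h2 : Tendsto (fun n => ‖u (n1 (n2 (n3 n))) x - z x‖) atTop (𝓝 0) := by
      have := h1.sqrt
      simpa [Real.sqrt_sq (norm_nonneg _)] using this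
    exact tendsto_iff_norm_sub_tendsto_zero.2 h2
  · exact hw.comp hn3.tendsto_atTop

end BrezisLieb

section Nonvanishing

variable {𝕜 : Type*} [RCLike 𝕜] {N : ℕ}

local notation "𝔼" => EuclideanSpace ℝ (Fin N)
local notation "𝔾" => EuclideanSpace 𝕜 (Fin N)

/-! ### Nonvanishing up to translation -/

theorem integral_integral_mul_sub {f k : 𝔼 → ℝ} (hf : Integrable f volume)
    (hk : Integrable k volume) :
    Integrable (fun y => ∫ x, f x * k (y - x)) volume ∧
      ∫ y, ∫ x, f x * k (y - x) = (∫ x, f x) * ∫ x, k x :=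
  ⟨hf.integrable_convolution (ContinuousLinearMap.mul ℝ ℝ) hk,
    integral_convolution (ContinuousLinearMap.mul ℝ ℝ) hf hk⟩

/-- The weight that dominates the square of the `H¹` norm of a function localized by the unit
bump. -/
noncomputable def bumpEnergy (z : 𝔼) : ℝ :=
  3 * unitBump N z ^ 2 + 2 * ‖classicalGrad (unitBump N) z‖ ^ 2

theorem continuous_bumpEnergy : Continuous (bumpEnergy : 𝔼 → ℝ) := by
  have h1 : Continuous (unitBump N) := (unitBump N).continuous
  have h2 : Continuous (classicalGrad (𝕜 := ℝ) (unitBump N)) :=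
    continuous_classicalGrad (unitBump N).contDiff
  unfold bumpEnergy
  fun_prop

theorem hasCompactSupport_bumpEnergy : HasCompactSupport (bumpEnergy : 𝔼 → ℝ) := by
  have h1 : HasCompactSupport fun z : 𝔼 => 3 * unitBump N z ^ 2 :=
    (unitBump N).hasCompactSupport.comp_left (g := fun t : ℝ => 3 * t ^ 2) (by norm_num)
  have h2 : HasCompactSupport fun z : 𝔼 => 2 * ‖classicalGrad (𝕜 := ℝ) (unitBump N) z‖ ^ 2 :=
    (hasCompactSupport_classicalGrad (unitBump N).hasCompactSupport).comp_left
      (g := fun t : 𝔼 => 2 * ‖t‖ ^ 2) (by norm_num)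
  exact h1.add h2

/-- The localization of an `H¹` function by the bump centred at `y`. -/
theorem HasSobGrad.localize {u : 𝔼 → 𝕜} {g : 𝔼 → 𝔾} (hu : HasSobGrad u g) (y : 𝔼) :
    ∃ h : 𝔼 → 𝔾, HasSobGrad (fun x => unitBump N (y - x) • u x) h ∧
      (∫ x, ‖unitBump N (y - x) • u x‖ ^ 2) + ∫ x, ‖h x‖ ^ 2
        ≤ ∫ x, (‖u x‖ ^ 2 + ‖g x‖ ^ 2) * bumpEnergy (y - x) := by
  have hsm : ContDiff ℝ ∞ fun x : 𝔼 => unitBump N (y - x) :=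
    (unitBump N).contDiff.comp (contDiff_const.sub contDiff_id)
  have hcs : HasCompactSupport fun x : 𝔼 => unitBump N (y - x) :=
    (unitBump N).hasCompactSupport.comp_homeomorph (Homeomorph.subLeft y)
  have hw := hu.cutoff hsm hcs
  have hd : ∀ x, ‖classicalGrad (𝕜 := ℝ) (fun x : 𝔼 => unitBump N (y - x)) x‖
      = ‖classicalGrad (𝕜 := ℝ) (unitBump N) (y - x)‖ := by
    intro x
    have h1 := (((unitBump N).contDiff (n := ⊤).differentiable (by simp)).differentiableAt
      (x := y - x)).hasFDerivAt.comp x ((hasFDerivAt_id x).const_sub y)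
    have h2 : classicalGrad (𝕜 := ℝ) (fun x : 𝔼 => unitBump N (y - x)) x
        = - classicalGrad (𝕜 := ℝ) (unitBump N) (y - x) := by
      ext i
      simp only [classicalGrad, PiLp.neg_apply]
      rw [show fderiv ℝ (fun x : 𝔼 => unitBump N (y - x)) x = _ from h1.fderiv]
      simp
    rw [h2, norm_neg]
  refine ⟨_, hw, ?_⟩
  have i1 := integrable_norm_sq hw.memLp
  have i2 := integrable_norm_sq hw.memLp_grad
  rw [← integral_add i1 i2]
  have i3 : Integrable (fun x => ‖u x‖ ^ 2 + ‖g x‖ ^ 2) volume :=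
    (integrable_norm_sq hu.memLp).add (integrable_norm_sq hu.memLp_grad)
  obtain ⟨B, hB⟩ := continuous_bumpEnergy.bounded_above_of_compact_support
    (hasCompactSupport_bumpEnergy (N := N))
  have i4 : Integrable (fun x => (‖u x‖ ^ 2 + ‖g x‖ ^ 2) * bumpEnergy (y - x)) volume :=
    i3.mul_bdd (c := B) (continuous_bumpEnergy.comp (continuous_const.sub continuous_id)
      |>.aestronglyMeasurable) (Eventually.of_forall fun x => hB (y - x))
  refine integral_mono (i1.add i2) i4 fun x => ?_
  simp only [bumpEnergy]
  set c := unitBump N (y - x)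
  have hc0 : 0 ≤ c := (unitBump N).nonneg
  set d := ‖classicalGrad (𝕜 := ℝ) (unitBump N) (y - x)‖
  have h1 : ‖c • u x‖ ^ 2 = c ^ 2 * ‖u x‖ ^ 2 := by
    rw [norm_smul, mul_pow, Real.norm_eq_abs, sq_abs]
  have h2 : ‖c • g x + vecSmul (classicalGrad (𝕜 := ℝ) (fun x : 𝔼 => unitBump N (y - x)) x) (u x)‖
      ≤ c * ‖g x‖ + d * ‖u x‖ := by
    refine (norm_add_le _ _).trans ?_
    rw [norm_smul, Real.norm_of_nonneg hc0, norm_vecSmul, hd]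
  have h3 := pow_le_pow_left₀ (norm_nonneg _) h2 2
  have h4 : 0 ≤ d := norm_nonneg _
  rw [h1]
  nlinarith [sq_nonneg (c * ‖g x‖ - d * ‖u x‖), mul_nonneg (sq_nonneg c) (sq_nonneg ‖g x‖),
    mul_nonneg (sq_nonneg d) (sq_nonneg ‖g x‖), mul_nonneg (sq_nonneg c) (sq_nonneg ‖u x‖)]

/-- Lieb's translation argument: a bounded set in `H¹` on which `∫ |u| ^ r` stays away from zero
does not vanish, up to translations. Averaging over `y` finds a localization `w` of `u` whose `H¹`
norm is controlled by `∫ |w| ^ r`; by the Sobolev inequality this norm cannot be small. -/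
theorem exists_translate_nonvanishing (hN : 3 ≤ N) (𝕜 : Type*) [RCLike 𝕜] {r : ℝ}
    (hr : r ∈ Set.Ioo 2 (critExp N)) {C δ : ℝ} (hC : 0 < C) (hδ : 0 < δ) :
    ∃ η : ℝ, 0 < η ∧ ∀ (u : 𝔼 → 𝕜) (g : 𝔼 → EuclideanSpace 𝕜 (Fin N)), HasSobGrad u g →
      ∫ x, ‖u x‖ ^ 2 ≤ C → ∫ x, ‖g x‖ ^ 2 ≤ C → δ ≤ ∫ x, ‖u x‖ ^ r →
      ∃ y : 𝔼, η ≤ ∫ x, weight x * ‖u (x + y)‖ ^ 2 := by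
  obtain ⟨Cs, hCs0, hCs⟩ := exists_sobolev_const hN 𝕜
  have hκ := one_lt_sobExp hN
  have hr0 : 0 < r := by linarith [hr.1]
  set κ := sobExp N
  let bump : 𝔼 → ℝ := unitBump N
  let k1 : 𝔼 → ℝ := fun z => bump z ^ r
  have hbc : Continuous bump := (unitBump N).continuous
  have hk1c : Continuous k1 := hbc.rpow_const fun _ => Or.inr hr0.le
  have hk1s : HasCompactSupport k1 :=
    (unitBump N).hasCompactSupport.comp_left (g := fun t : ℝ => t ^ r) (Real.zero_rpow hr0.ne')
  have hk1 : Integrable k1 volume := hk1c.integrable_of_hasCompactSupport hk1s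
  have hk2 : Integrable (bumpEnergy : 𝔼 → ℝ) volume :=
    continuous_bumpEnergy.integrable_of_hasCompactSupport hasCompactSupport_bumpEnergy
  have hk20 : ∀ z : 𝔼, 0 ≤ bumpEnergy z := fun z => by unfold bumpEnergy; positivity
  have hc1 : 0 < ∫ z, k1 z := by
    refine hk1c.integral_pos_of_hasCompactSupport_nonneg_nonzero hk1s
      (fun z => Real.rpow_nonneg (unitBump N).nonneg _) (x := 0) ?_
    have : bump 0 = 1 := (unitBump N).one_of_mem_closedBall (by simp [(unitBump N).rIn_pos.le])
    simp [k1, this]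
  obtain ⟨B0, hB0⟩ := continuous_bumpEnergy.bounded_above_of_compact_support
    (hasCompactSupport_bumpEnergy (N := N))
  -- `A` makes the averaged inequality strict, `β` is the resulting lower bound for the local norm,
  -- and `B` an upper bound for it
  let A : ℝ := (2 * C * (∫ z : 𝔼, bumpEnergy z) + 1) / (δ * ∫ z, k1 z)
  have hI2 : 0 ≤ ∫ z : 𝔼, bumpEnergy z := integral_nonneg hk20
  have hA : 0 < A := by positivity
  obtain ⟨K, hK0, hK⟩ := exists_rpow_le_small_sq hr.1 hr.2 (ε := 1 / (2 * A)) (by positivity)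
  let β : ℝ := (2 * A * K * Cs)⁻¹ ^ (κ - 1)⁻¹
  have hβ : 0 < β := by positivity
  let B : ℝ := (|B0| + 1) * (2 * C)
  have hB : 0 < B := by positivity
  obtain ⟨K2, hK20, hK2⟩ := exists_rpow_le_small_crit hr.1 hr.2
    (ε := β / (2 * A * (Cs * B ^ κ))) (by positivity)
  -- the bump is dominated by the weight
  obtain ⟨L, hL⟩ := ((hbc.comp continuous_neg).pow 2 |>.div continuous_weight
    fun x => (weight_pos x).ne').bounded_above_of_compact_support (f := fun x : 𝔼 =>
      bump (-x) ^ 2 / weight x) (by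
        have h1 : HasCompactSupport fun x : 𝔼 => bump (-x) :=
          (unitBump N).hasCompactSupport.comp_homeomorph (Homeomorph.neg 𝔼)
        refine h1.mono fun x hx => ?_
        contrapose! hx
        have : bump (-x) = 0 := by simpa using hx
        simp [this])
  refine ⟨β / (2 * A * K2) / (|L| + 1), by positivity, fun u g hu h1 h2 h3 => ?_⟩
  have hur := hu.integrable_rpow hN hr
  have hus := integrable_norm_sq hu.memLp
  have hgs := integrable_norm_sq hu.memLp_grad
  have hf2 : Integrable (fun x => ‖u x‖ ^ 2 + ‖g x‖ ^ 2) volume := hus.add hgs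
  have hf2I : ∫ x, (‖u x‖ ^ 2 + ‖g x‖ ^ 2) ≤ 2 * C := by
    rw [integral_add hus hgs]; linarith
  obtain ⟨ia, ea⟩ := integral_integral_mul_sub hur hk1
  obtain ⟨ib, eb⟩ := integral_integral_mul_sub hf2 hk2
  -- a centre at which the averaged inequality holds
  obtain ⟨y, hy⟩ : ∃ y, ∫ x, (‖u x‖ ^ 2 + ‖g x‖ ^ 2) * bumpEnergy (y - x)
      < A * ∫ x, ‖u x‖ ^ r * k1 (y - x) := by
    by_contra! hcon
    have h4 := integral_mono (ia.const_mul A) ib hcon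
    rw [integral_const_mul, ea, eb] at h4
    have h5 : A * (δ * ∫ z, k1 z) ≤ A * ((∫ x, ‖u x‖ ^ r) * ∫ z, k1 z) := by gcongr
    have h6 : A * (δ * ∫ z, k1 z) = 2 * C * (∫ z : 𝔼, bumpEnergy z) + 1 :=
      div_mul_cancel₀ _ (by positivity)
    have h7 : (∫ x, (‖u x‖ ^ 2 + ‖g x‖ ^ 2)) * ∫ z : 𝔼, bumpEnergy z
        ≤ 2 * C * ∫ z : 𝔼, bumpEnergy z := by gcongr
    linarith
  obtain ⟨h, hw, hwle⟩ := hu.localize y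
  set b := ∫ x, (‖u x‖ ^ 2 + ‖g x‖ ^ 2) * bumpEnergy (y - x)
  set m := ∫ x, ‖unitBump N (y - x) • u x‖ ^ 2 with hm
  have hm0 : 0 ≤ m := by positivity
  have ht0 : 0 ≤ ∫ x, ‖h x‖ ^ 2 := by positivity
  have hae : ∫ x, ‖u x‖ ^ r * k1 (y - x) = ∫ x, ‖unitBump N (y - x) • u x‖ ^ r := by
    congr 1
    ext x
    have h0 : 0 ≤ unitBump N (y - x) := (unitBump N).nonneg
    rw [norm_smul, Real.norm_of_nonneg h0, Real.mul_rpow h0 (norm_nonneg _), mul_comm]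
  rw [hae] at hy
  set a := ∫ x, ‖unitBump N (y - x) • u x‖ ^ r
  have hbt : (∫ x, ‖h x‖ ^ 2) ≤ b := by linarith
  have hb0 : 0 ≤ b := ht0.trans hbt
  have hbB : b ≤ B := by
    have : b ≤ ∫ x, (‖u x‖ ^ 2 + ‖g x‖ ^ 2) * (|B0| + 1) := by
      refine integral_mono_of_nonneg (Eventually.of_forall fun x => ?_) (hf2.mul_const _)
        (Eventually.of_forall fun x => ?_)
      · exact mul_nonneg (by positivity) (hk20 _)
      · have := (le_abs_self _).trans ((hB0 (y - x)).trans (le_abs_self _))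
        have h9 : bumpEnergy (y - x) ≤ |B0| + 1 := by linarith
        exact mul_le_mul_of_nonneg_left h9 (by positivity)
    rw [integral_mul_const] at this
    refine this.trans ?_
    rw [mul_comm]
    exact mul_le_mul_of_nonneg_left hf2I (by positivity)
  have hTb : (∫ x, ‖h x‖ ^ 2) ^ κ ≤ b ^ κ := by gcongr
  have ha1 := hw.integral_rpow_le hN hr hK0.le hK hCs
  have ha2 := hw.integral_rpow_le hN hr (by positivity) hK2 hCs
  -- the localized norm is bounded below
  have hb1 : b < 2 * A * K * Cs * b ^ κ := by
    have e1 : a ≤ 1 / (2 * A) * b + K * (Cs * b ^ κ) := by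
      refine ha1.trans ?_
      gcongr
      linarith
    have e2 : A * a ≤ A * (1 / (2 * A) * b + K * (Cs * b ^ κ)) := by gcongr
    have e3 : A * (1 / (2 * A) * b + K * (Cs * b ^ κ)) = b / 2 + A * K * Cs * b ^ κ := by
      field_simp
    linarith
  have hbpos : 0 < b := by
    rcases hb0.eq_or_lt with h0 | h0
    · rw [← h0, Real.zero_rpow (by linarith)] at hb1
      simp at hb1
    · exact h0
  have hβb : β ≤ b := by
    have e1 : b ^ κ = b ^ (κ - 1) * b := by
      rw [Real.rpow_sub_one hbpos.ne']
      field_simp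
    have e2 : (2 * A * K * Cs)⁻¹ ≤ b ^ (κ - 1) := by
      rw [inv_le_iff_one_le_mul₀ (by positivity)]
      rw [e1] at hb1
      by_contra! hlt
      nlinarith
    calc β ≤ (b ^ (κ - 1)) ^ (κ - 1)⁻¹ :=
          Real.rpow_le_rpow (by positivity) e2 (inv_nonneg.2 (by linarith))
      _ = b := by
          rw [← Real.rpow_mul hb0, mul_inv_cancel₀ (by linarith), Real.rpow_one]
  -- as `∫ |w| ^ r` is bounded below, so is the local mass
  have ham : β / (2 * A) ≤ K2 * m := by
    have e1 : β / A < a := by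
      rw [div_lt_iff₀ hA]; linarith
    have e2 : β / (2 * A * (Cs * B ^ κ)) * (Cs * (∫ x, ‖h x‖ ^ 2) ^ κ) ≤ β / (2 * A) := by
      calc β / (2 * A * (Cs * B ^ κ)) * (Cs * (∫ x, ‖h x‖ ^ 2) ^ κ)
          ≤ β / (2 * A * (Cs * B ^ κ)) * (Cs * B ^ κ) := by
            gcongr
            exact hbt.trans hbB
        _ = β / (2 * A) := by
            have : 0 < Cs * B ^ κ := by positivity
            field_simp
    have e3 : β / A = β / (2 * A) + β / (2 * A) := by field_simp; norm_num
    linarith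
  refine ⟨y, ?_⟩
  have hwi : Integrable (fun x => weight x * ‖u (x + y)‖ ^ 2) volume := by
    refine (hus.comp_add_right y).mono' (continuous_weight.aestronglyMeasurable.mul
      (hus.comp_add_right y).1) (Eventually.of_forall fun x => ?_)
    rw [Real.norm_of_nonneg (mul_nonneg (weight_pos x).le (by positivity))]
    exact mul_le_of_le_one_left (by positivity) (weight_le_one x)
  have hmle : m ≤ (|L| + 1) * ∫ x, weight x * ‖u (x + y)‖ ^ 2 := by
    rw [hm, ← integral_add_right_eq_self _ y, ← integral_const_mul]
    refine integral_mono_of_nonneg (Eventually.of_forall fun x => by positivity)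
      (hwi.const_mul _) (Eventually.of_forall fun x => ?_)
    have h9 := hL x
    rw [Real.norm_of_nonneg (div_nonneg (sq_nonneg _) (weight_pos x).le),
      div_le_iff₀ (weight_pos x)] at h9
    have h10 : y - (x + y) = -x := by abel
    change ‖unitBump N (y - (x + y)) • u (x + y)‖ ^ 2
      ≤ (|L| + 1) * (weight x * ‖u (x + y)‖ ^ 2)
    rw [h10, norm_smul, mul_pow, Real.norm_eq_abs, sq_abs, ← mul_assoc]
    gcongr
    calc bump (-x) ^ 2 ≤ L * weight x := h9
      _ ≤ (|L| + 1) * weight x := by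
          have := (weight_pos x).le
          gcongr
          linarith [le_abs_self L]
  rw [div_le_iff₀ (by positivity), div_le_iff₀ (by positivity)]
  have e4 : β ≤ K2 * m * (2 * A) := by
    rwa [div_le_iff₀ (by positivity)] at ham
  calc β ≤ m * (2 * A * K2) := by linarith
    _ ≤ ((|L| + 1) * ∫ x, weight x * ‖u (x + y)‖ ^ 2) * (2 * A * K2) := by gcongr
    _ = _ := by ring

end Nonvanishing

section Attainment

variable {𝕜 : Type*} [RCLike 𝕜] {N : ℕ}

local notation "𝔼" => EuclideanSpace ℝ (Fin N)
local notation "𝔾" => EuclideanSpace 𝕜 (Fin N)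

/-! ### Attainment of the minimum -/

/-- `∫ |u|²`, twice the mass. -/
noncomputable def sqInt (u : H1 𝕜 N) : ℝ := ∫ x, ‖val u x‖ ^ 2

/-- The gap `c (∫ |∇u|²) ^ κ - μ (2/p) ∫ |u| ^ p + (2/q) ∫ |u| ^ q - ℓ ∫ |u|²`. It is nonnegative
exactly when `ℓ` is at most the nonlinear Rayleigh quotient with constant `c`. -/
noncomputable def gap (p q μ c ℓ : ℝ) (u : H1 𝕜 N) : ℝ :=
  c * dirichlet u ^ sobExp N - μ * (2 / p) * powInt p u + 2 / q * powInt q u - ℓ * sqInt u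

theorem HasSobGrad.sqInt_toH1 {u : 𝔼 → 𝕜} {g : 𝔼 → 𝔾} (h : HasSobGrad u g) :
    sqInt h.toH1 = ∫ x, ‖u x‖ ^ 2 :=
  integral_congr_ae (h.val_toH1.mono fun x hx => by simp only [hx])

theorem HasSobGrad.powInt_toH1 {u : 𝔼 → 𝕜} {g : 𝔼 → 𝔾} (h : HasSobGrad u g) (r : ℝ) :
    powInt r h.toH1 = ∫ x, ‖u x‖ ^ r :=
  integral_congr_ae (h.val_toH1.mono fun x hx => by simp only [hx])

theorem HasSobGrad.dirichlet_toH1 {u : 𝔼 → 𝕜} {g : 𝔼 → 𝔾} (h : HasSobGrad u g) :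
    dirichlet h.toH1 = ∫ x, ‖g x‖ ^ 2 :=
  integral_congr_ae (h.grad_toH1.mono fun x hx => by simp only [hx])

theorem HasSobGrad.toH1_eq_zero_iff {u : 𝔼 → 𝕜} {g : 𝔼 → 𝔾} (h : HasSobGrad u g) :
    h.toH1 = 0 ↔ u =ᵐ[volume] 0 := by
  rw [← val_ae_zero_iff]
  exact ⟨fun h1 => h.val_toH1.symm.trans h1, fun h1 => h.val_toH1.trans h1⟩

theorem sqInt_nonneg (u : H1 𝕜 N) : 0 ≤ sqInt u := integral_nonneg fun x => by positivity

theorem powInt_nonneg (r : ℝ) (u : H1 𝕜 N) : 0 ≤ powInt r u :=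
  integral_nonneg fun x => by positivity

theorem dirichlet_nonneg (u : H1 𝕜 N) : 0 ≤ dirichlet u :=
  integral_nonneg fun x => by positivity

theorem sqInt_pos {u : H1 𝕜 N} (hu : u ≠ 0) : 0 < sqInt u := by
  refine (sqInt_nonneg u).lt_of_ne fun h => hu ?_
  exact val_ae_zero_iff.1 (ae_eq_zero_of_integral_sq_eq_zero (hasSobGrad_val u).memLp h.symm)

theorem dirichlet_pos (hN : 3 ≤ N) {u : H1 𝕜 N} (hu : u ≠ 0) : 0 < dirichlet u := by
  refine (dirichlet_nonneg u).lt_of_ne fun h => hu ?_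
  exact val_ae_zero_iff.1 ((hasSobGrad_val u).ae_zero_of_grad hN h.symm)

/-- The infimum of the nonlinear Rayleigh quotient is attained when it is negative. Along a
minimizing sequence, translated so that it does not vanish, the gap splits into the gaps of the
weak limit and of the remainder, up to the superadditive term `T ^ κ`; so the remainder carries
no Dirichlet energy. -/
theorem exists_gap_eq_zero (hN : 3 ≤ N) {p q μ c ℓ : ℝ}
    (hp : p ∈ Set.Ioo 2 (critExp N)) (hq : q ∈ Set.Ioo 2 (critExp N)) (hμ : 0 < μ) (hc : 0 < c)
    (hℓ : ℓ < 0) (hG : ∀ u : H1 𝕜 N, 0 ≤ gap p q μ c ℓ u) (u : ℕ → H1 𝕜 N)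
    (hu1 : ∀ n, dirichlet (u n) = 1) (hu : Tendsto (fun n => gap p q μ c ℓ (u n)) atTop (𝓝 0)) :
    ∃ v : H1 𝕜 N, v ≠ 0 ∧ gap p q μ c ℓ v = 0 := by
  have hp0 : 0 < p := by linarith [hp.1]
  have hq0 : 0 < q := by linarith [hq.1]
  have hκ := one_lt_sobExp hN
  obtain ⟨Cs, hCs0, hCs⟩ := exists_sobolev_const hN 𝕜
  -- a tail of the sequence on which the gap is small
  obtain ⟨n0, hn0⟩ := eventually_atTop.1 (hu.eventually (gt_mem_nhds
    (lt_min one_pos (half_pos hc))))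
  have hgap1 : ∀ n, gap p q μ c ℓ (u (n + n0)) < 1 := fun n =>
    (hn0 _ (Nat.le_add_left _ _)).trans_le (min_le_left _ _)
  have hgapc : ∀ n, gap p q μ c ℓ (u (n + n0)) < c / 2 := fun n =>
    (hn0 _ (Nat.le_add_left _ _)).trans_le (min_le_right _ _)
  have hε : 0 < -ℓ * p / (4 * μ) := by
    have : 0 < -ℓ := by linarith
    positivity
  obtain ⟨K, hK0, hK⟩ := exists_rpow_le_small_sq hp.1 hp.2 hε
  let C : ℝ := max 1 ((1 + 2 * μ / p * (K * Cs)) / (-ℓ / 2))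
  have hC : 0 < C := lt_max_of_lt_left one_pos
  have hT : ∀ n, ∫ x, ‖grad (u n) x‖ ^ 2 = 1 := hu1
  have hMb : ∀ n, ∫ x, ‖val (u (n + n0)) x‖ ^ 2 ≤ C := by
    intro n
    refine le_trans ?_ (le_max_right _ _)
    rw [le_div_iff₀ (by linarith)]
    have h1 := (hasSobGrad_val (u (n + n0))).integral_rpow_le hN hp hK0.le hK hCs
    rw [hT, Real.one_rpow, mul_one] at h1
    have h2 := hgap1 n
    rw [gap, hu1, Real.one_rpow, mul_one] at h2
    have h3 := powInt_nonneg q (u (n + n0))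
    have h3' : 0 ≤ 2 / q * powInt q (u (n + n0)) := by positivity
    have h4 : μ * (2 / p) * powInt p (u (n + n0))
        ≤ μ * (2 / p) * (-ℓ * p / (4 * μ) * sqInt (u (n + n0)) + K * Cs) := by
      gcongr
      exact h1
    have h5 : μ * (2 / p) * (-ℓ * p / (4 * μ) * sqInt (u (n + n0)) + K * Cs)
        = -ℓ / 2 * sqInt (u (n + n0)) + 2 * μ / p * (K * Cs) := by
      field_simp
      ring
    change sqInt (u (n + n0)) * _ ≤ _
    linarith
  have hPb : ∀ n, p / (2 * μ) * (c / 2) ≤ ∫ x, ‖val (u (n + n0)) x‖ ^ p := by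
    intro n
    have h2 := hgapc n
    rw [gap, hu1, Real.one_rpow, mul_one] at h2
    have h3' : 0 ≤ 2 / q * powInt q (u (n + n0)) :=
      mul_nonneg (by positivity) (powInt_nonneg _ _)
    have h4 : 0 ≤ -ℓ * sqInt (u (n + n0)) := mul_nonneg (by linarith) (sqInt_nonneg _)
    have h5 : c / 2 ≤ μ * (2 / p) * powInt p (u (n + n0)) := by linarith
    have h6 : p / (2 * μ) * (μ * (2 / p) * powInt p (u (n + n0))) = powInt p (u (n + n0)) := by
      field_simp
    calc p / (2 * μ) * (c / 2) ≤ p / (2 * μ) * (μ * (2 / p) * powInt p (u (n + n0))) := by gcongr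
      _ = _ := h6
  obtain ⟨η, hη, hnv⟩ := exists_translate_nonvanishing hN 𝕜 hp hC
    (δ := p / (2 * μ) * (c / 2)) (by positivity)
  have hC1 : ∀ n, ∫ x, ‖grad (u n) x‖ ^ 2 ≤ C := fun n => (hT n).le.trans (le_max_left _ _)
  choose y hy using fun n => hnv _ _ (hasSobGrad_val (u (n + n0))) (hMb n) (hC1 _) (hPb n)
  -- the translated sequence
  let w : ℕ → 𝔼 → 𝕜 := fun n x => val (u (n + n0)) (x + y n)
  let d : ℕ → 𝔼 → 𝔾 := fun n x => grad (u (n + n0)) (x + y n)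
  have hw : ∀ n, HasSobGrad (w n) (d n) := fun n => by
    simpa [w, d] using (hasSobGrad_val (u (n + n0))).comp_affine one_ne_zero (y n)
  have hwM : ∀ n, ∫ x, ‖w n x‖ ^ 2 = sqInt (u (n + n0)) := fun n =>
    integral_add_right_eq_self (fun x => ‖val (u (n + n0)) x‖ ^ 2) (y n)
  have hwP : ∀ r n, ∫ x, ‖w n x‖ ^ (r : ℝ) = powInt r (u (n + n0)) := fun r n =>
    integral_add_right_eq_self (fun x => ‖val (u (n + n0)) x‖ ^ r) (y n)
  have hwT : ∀ n, ∫ x, ‖d n x‖ ^ 2 = 1 := fun n =>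
    (integral_add_right_eq_self (fun x => ‖grad (u (n + n0)) x‖ ^ 2) (y n)).trans (hT _)
  have hwMC : ∀ n, ∫ x, ‖w n x‖ ^ 2 ≤ C := fun n => (hwM n).le.trans (hMb n)
  have hwTC : ∀ n, ∫ x, ‖d n x‖ ^ 2 ≤ C := fun n => (hwT n).le.trans (le_max_left _ _)
  obtain ⟨z, h, ns, hns, hz, hzM, hzT, hzae, hzw⟩ := exists_weak_limit hw hwMC hwTC
  have hdiff : ∀ n, HasSobGrad (fun x => w (ns n) x - z x) (fun x => d (ns n) x - h x) :=
    fun n => (hw _).sub hz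
  -- weighted convergence to zero would contradict the choice of the translations
  have hz0 : ¬ z =ᵐ[volume] 0 := by
    intro h0
    have h1 : ∀ n, η ≤ ∫ x, weight x * ‖w (ns n) x - z x‖ ^ 2 := by
      intro n
      refine (hy (ns n)).trans (le_of_eq (integral_congr_ae ?_))
      filter_upwards [h0] with x hx
      simp [w, hx]
    exact absurd (ge_of_tendsto' hzw h1) (not_le.2 hη)
  let v : H1 𝕜 N := hz.toH1
  let r : ℕ → H1 𝕜 N := fun n => (hdiff n).toH1
  have hvne : v ≠ 0 := fun h0 => hz0 (hz.toH1_eq_zero_iff.1 h0)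
  -- the splitting of the powers
  have hsplit : ∀ s ∈ Set.Ioo 2 (critExp N),
      Tendsto (fun n => powInt s (u (ns n + n0)) - powInt s (r n)) atTop (𝓝 (powInt s v)) := by
    intro s hs
    obtain ⟨K', hK'0, hK'⟩ := exists_rpow_le_small_sq hs.1 hs.2 one_pos
    have hb : ∀ n, ∫ x, ‖w (ns n) x - z x‖ ^ s
        ≤ 1 * (2 * C + 2 * ∫ x, ‖z x‖ ^ 2)
          + K' * (Cs * (2 * C + 2 * ∫ x, ‖h x‖ ^ 2) ^ sobExp N) := by
      intro n
      refine ((hdiff n).integral_rpow_le hN hs hK'0.le hK' hCs).trans ?_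
      have h1 := integral_norm_sub_sq_le (hw (ns n)).memLp hz.memLp
      have h2 := integral_norm_sub_sq_le (hw (ns n)).memLp_grad hz.memLp_grad
      have h3 := hwMC (ns n)
      have h4 := hwTC (ns n)
      have h5 : 0 ≤ ∫ x, ‖d (ns n) x - h x‖ ^ 2 := integral_nonneg fun x => by positivity
      have h6 : (∫ x, ‖d (ns n) x - h x‖ ^ 2) ≤ 2 * C + 2 * ∫ x, ‖h x‖ ^ 2 := by linarith
      have h7 : (∫ x, ‖w (ns n) x - z x‖ ^ 2) ≤ 2 * C + 2 * ∫ x, ‖z x‖ ^ 2 := by linarith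
      gcongr
    have hBL := tendsto_integral_rpow_sub (r := s) (by linarith [hs.1])
      (fun n => (hw (ns n)).integrable_rpow hN hs) (hz.integrable_rpow hN hs)
      (fun n => (hdiff n).integrable_rpow hN hs) hb hzae
    rw [← hz.powInt_toH1 s] at hBL
    refine hBL.congr fun n => ?_
    rw [hwP, ← (hdiff n).powInt_toH1 s]
  have hsM : Tendsto (fun n => sqInt (u (ns n + n0)) - sqInt (r n)) atTop (𝓝 (sqInt v)) := by
    rw [← hz.sqInt_toH1] at hzM
    refine hzM.congr fun n => ?_
    rw [hwM, ← (hdiff n).sqInt_toH1]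
  have hsT : Tendsto (fun n => dirichlet (r n)) atTop (𝓝 (1 - dirichlet v)) := by
    rw [← hz.dirichlet_toH1] at hzT
    refine (hzT.const_sub 1).congr fun n => ?_
    rw [hwT, ← (hdiff n).dirichlet_toH1, sub_sub_cancel]
  have hτ0 : 0 ≤ 1 - dirichlet v := ge_of_tendsto' hsT fun n => dirichlet_nonneg _
  have hTpos : 0 < dirichlet v := dirichlet_pos hN hvne
  have hlim : Tendsto (fun n => c - c * dirichlet (r n) ^ sobExp N
      - μ * (2 / p) * (powInt p (u (ns n + n0)) - powInt p (r n))
      + 2 / q * (powInt q (u (ns n + n0)) - powInt q (r n))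
      - ℓ * (sqInt (u (ns n + n0)) - sqInt (r n))) atTop
      (𝓝 (c - c * (1 - dirichlet v) ^ sobExp N - μ * (2 / p) * powInt p v
        + 2 / q * powInt q v - ℓ * sqInt v)) :=
    ((((hsT.rpow_const (Or.inr (by linarith))).const_mul c).const_sub c).sub
      ((hsplit p hp).const_mul _)).add ((hsplit q hq).const_mul _) |>.sub (hsM.const_mul ℓ)
  have hgl : Tendsto (fun n => gap p q μ c ℓ (u (ns n + n0))) atTop (𝓝 0) :=
    hu.comp ((tendsto_add_atTop_nat n0).comp hns.tendsto_atTop)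
  -- discard the nonnegative gap of the remainder
  have hkey : c - c * (1 - dirichlet v) ^ sobExp N - μ * (2 / p) * powInt p v
        + 2 / q * powInt q v - ℓ * sqInt v ≤ 0 := by
    refine le_of_tendsto_of_tendsto' hlim hgl fun n => ?_
    have h1 := hG (r n)
    rw [gap] at h1 ⊢
    rw [hu1, Real.one_rpow]
    linarith
  have hv := hG v
  -- strict superadditivity of `T ↦ T ^ κ` on the splitting of the Dirichlet integral
  have hsup : 1 ≤ (1 - dirichlet v) ^ sobExp N + dirichlet v ^ sobExp N := by
    rw [gap] at hv
    have : c * 1 ≤ c * ((1 - dirichlet v) ^ sobExp N + dirichlet v ^ sobExp N) := by linarith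
    exact le_of_mul_le_mul_left this hc
  have hτ : 1 - dirichlet v = 0 := by
    by_contra hne
    have hτp : 0 < 1 - dirichlet v := hτ0.lt_of_ne (Ne.symm hne)
    have h1 := Real.rpow_lt_rpow_of_exponent_gt hτp (by linarith : 1 - dirichlet v < 1) hκ
    have h2 := Real.rpow_lt_rpow_of_exponent_gt hTpos (by linarith : dirichlet v < 1) hκ
    rw [Real.rpow_one] at h1 h2
    linarith
  refine ⟨v, hvne, le_antisymm ?_ hv⟩
  have hT1 : dirichlet v = 1 := by linarith
  rw [hτ, Real.zero_rpow (by linarith), mul_zero, sub_zero] at hkey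
  rw [gap, hT1, Real.one_rpow, mul_one]
  exact hkey

end Attainment

section Derivatives

variable {𝕜 : Type*} [RCLike 𝕜] {N : ℕ}

local notation "𝔼" => EuclideanSpace ℝ (Fin N)
local notation "𝔾" => EuclideanSpace 𝕜 (Fin N)

/-! ### Gateaux derivatives and critical points -/

/-- `Re ∫ ∇u · conj ∇φ`, half the derivative of the Dirichlet integral. -/
noncomputable def gradPair (φ u : H1 𝕜 N) : ℝ := ∫ x, inner ℝ (grad φ x) (grad u x)

/-- `Re ∫ u conj φ`, the derivative of the mass. -/
noncomputable def sqPair (φ u : H1 𝕜 N) : ℝ := ∫ x, inner ℝ (val φ x) (val u x)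

/-- `Re ∫ |u| ^ (r - 2) u conj φ`, the derivative of `(1/r) ∫ |u| ^ r`. -/
noncomputable def powPair (r : ℝ) (φ u : H1 𝕜 N) : ℝ :=
  ∫ x, ‖val u x‖ ^ (r - 2) * inner ℝ (val φ x) (val u x)

theorem hasDerivAt_norm_rpow_line {r : ℝ} (hr : 2 < r) (a b : 𝕜) (t : ℝ) :
    HasDerivAt (fun t : ℝ => ‖a + t • b‖ ^ r)
      (r * (‖a + t • b‖ ^ (r - 2) * inner ℝ b (a + t • b))) t := by
  have h1 : HasDerivAt (fun t : ℝ => a + t • b) b t := by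
    simpa using ((hasDerivAt_id t).smul_const b).const_add a
  have h2 := h1.norm_sq.rpow_const (p := r / 2) (Or.inr (by linarith))
  have e : ∀ (z : 𝕜) (s : ℝ), (‖z‖ ^ 2) ^ s = ‖z‖ ^ (2 * s) := fun z s => by
    rw [← Real.rpow_two, ← Real.rpow_mul (norm_nonneg _)]
  simp only [e] at h2
  rw [show 2 * (r / 2) = r by ring, show 2 * (r / 2 - 1) = r - 2 by ring] at h2
  convert h2 using 1
  rw [real_inner_comm]
  ring

theorem rpow_sub_two_mul {r t : ℝ} (hr : 2 < r) (ht : 0 ≤ t) : t ^ (r - 2) * t ^ 2 = t ^ r := by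
  rw [← Real.rpow_two, ← Real.rpow_add' ht (by linarith)]
  congr 1; ring

theorem abs_rpow_mul_inner_le {r : ℝ} (hr : 2 < r) (a b : 𝕜) {t : ℝ} (ht : |t| ≤ 1) :
    |‖a + t • b‖ ^ (r - 2) * inner ℝ b (a + t • b)| ≤ 2 ^ r * (‖a‖ ^ r + ‖b‖ ^ r) := by
  have h1 : ‖a + t • b‖ ≤ ‖a‖ + ‖b‖ := by
    refine (norm_add_le _ _).trans ?_
    rw [norm_smul, Real.norm_eq_abs]
    gcongr
    exact mul_le_of_le_one_left (norm_nonneg _) ht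
  set m := max ‖a‖ ‖b‖
  have hm0 : 0 ≤ m := (norm_nonneg a).trans (le_max_left _ _)
  have hm : ‖a‖ + ‖b‖ ≤ 2 * m := by linarith [le_max_left ‖a‖ ‖b‖, le_max_right ‖a‖ ‖b‖]
  have h2 : |inner ℝ b (a + t • b)| ≤ (2 * m) ^ 2 := by
    refine (abs_real_inner_le_norm _ _).trans ?_
    have h3 : ‖b‖ ≤ 2 * m := by linarith [le_max_right ‖a‖ ‖b‖]
    rw [sq]
    exact mul_le_mul h3 (h1.trans hm) (norm_nonneg _) (by positivity)
  rw [abs_mul, abs_of_nonneg (by positivity)]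
  calc ‖a + t • b‖ ^ (r - 2) * |inner ℝ b (a + t • b)| ≤ (2 * m) ^ (r - 2) * (2 * m) ^ 2 := by
        gcongr
        exact h1.trans hm
    _ = 2 ^ r * m ^ r := by
        rw [rpow_sub_two_mul hr (by positivity), Real.mul_rpow two_pos.le hm0]
    _ ≤ 2 ^ r * (‖a‖ ^ r + ‖b‖ ^ r) := by
        gcongr
        rcases max_choice ‖a‖ ‖b‖ with h | h
        · simp only [m, h]; exact le_add_of_nonneg_right (by positivity)
        · simp only [m, h]; exact le_add_of_nonneg_left (by positivity)

theorem integrable_rpow_val (hN : 3 ≤ N) {r : ℝ} (hr : r ∈ Set.Ioo 2 (critExp N)) (u : H1 𝕜 N) :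
    Integrable (fun x => ‖val u x‖ ^ r) volume :=
  (hasSobGrad_val u).integrable_rpow hN hr

theorem aestronglyMeasurable_powPair {r : ℝ} {u φ : 𝔼 → 𝕜} (hu : AEStronglyMeasurable u volume)
    (hφ : AEStronglyMeasurable φ volume) :
    AEStronglyMeasurable (fun x => ‖u x‖ ^ (r - 2) * inner ℝ (φ x) (u x)) volume :=
  (hu.norm.aemeasurable.pow_const _).aestronglyMeasurable.mul (hφ.inner hu)

theorem HasSobGrad.integrable_powPair (hN : 3 ≤ N) {r : ℝ} (hr : r ∈ Set.Ioo 2 (critExp N))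
    {u φ : 𝔼 → 𝕜} {g h : 𝔼 → 𝔾} (hu : HasSobGrad u g) (hφ : HasSobGrad φ h) :
    Integrable (fun x => ‖u x‖ ^ (r - 2) * inner ℝ (φ x) (u x)) volume := by
  refine (((hu.integrable_rpow hN hr).add (hφ.integrable_rpow hN hr)).const_mul (2 ^ r)).mono'
    (aestronglyMeasurable_powPair hu.memLp.1 hφ.memLp.1) (Eventually.of_forall fun x => ?_)
  have := abs_rpow_mul_inner_le hr.1 (u x) (φ x) (t := 0) (by simp)
  simpa using this

theorem hasDerivAt_powInt (hN : 3 ≤ N) {r : ℝ} (hr : r ∈ Set.Ioo 2 (critExp N)) (u φ : H1 𝕜 N) :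
    HasDerivAt (fun t : ℝ => powInt r (u + t • φ)) (r * powPair r φ u) 0 := by
  have hr0 : 0 < r := by linarith [hr.1]
  have iu := integrable_rpow_val hN hr u
  have iφ := integrable_rpow_val hN hr φ
  have mu : AEStronglyMeasurable (val u) volume := (hasSobGrad_val u).memLp.1
  have mφ : AEStronglyMeasurable (val φ) volume := (hasSobGrad_val φ).memLp.1
  have ml : ∀ t : ℝ, AEStronglyMeasurable (fun x => val u x + t • val φ x) volume := fun t =>
    mu.add (mφ.const_smul t)
  have key := hasDerivAt_integral_of_dominated_loc_of_deriv_le (μ := (volume : Measure 𝔼))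
    (F := fun (t : ℝ) x => ‖val u x + t • val φ x‖ ^ r)
    (F' := fun (t : ℝ) x => r * (‖val u x + t • val φ x‖ ^ (r - 2)
      * inner ℝ (val φ x) (val u x + t • val φ x)))
    (x₀ := 0) (s := Metric.ball 0 1)
    (bound := fun x => r * (2 ^ r * (‖val u x‖ ^ r + ‖val φ x‖ ^ r)))
    (Metric.ball_mem_nhds _ one_pos)
    (Eventually.of_forall fun t =>
      ((ml t).norm.aemeasurable.pow_const r).aestronglyMeasurable)
    (by simpa using iu)
    ((aestronglyMeasurable_powPair (ml 0) mφ).const_mul r)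
    (Eventually.of_forall fun x t ht => by
      rw [norm_mul, Real.norm_of_nonneg hr0.le, Real.norm_eq_abs]
      gcongr
      refine abs_rpow_mul_inner_le hr.1 _ _ ?_
      rw [mem_ball_zero_iff, Real.norm_eq_abs] at ht
      exact ht.le)
    (((iu.add iφ).const_mul _).const_mul _)
    (Eventually.of_forall fun x t _ => hasDerivAt_norm_rpow_line hr.1 _ _ t)
  have h2 := key.2
  simp only [zero_smul, add_zero] at h2
  rw [integral_const_mul] at h2
  refine h2.congr_of_eventuallyEq (Eventually.of_forall fun t => ?_)
  exact integral_congr_ae ((val_add_smul u φ t).mono fun x hx => by simp only [hx])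

theorem hasDerivAt_integral_norm_sq {F : Type*} [NormedAddCommGroup F] [InnerProductSpace ℝ F]
    {f g : 𝔼 → F} (hf : MemLp f 2 volume) (hg : MemLp g 2 volume) :
    HasDerivAt (fun t : ℝ => ∫ x, ‖f x + t • g x‖ ^ 2) (2 * ∫ x, inner ℝ (g x) (f x)) 0 := by
  have i1 := integrable_norm_sq hf
  have i2 := integrable_inner_of_memLp hg hf
  have i3 := integrable_norm_sq hg
  have e : ∀ t : ℝ, ∫ x, ‖f x + t • g x‖ ^ 2
      = (∫ x, ‖f x‖ ^ 2) + t * (2 * ∫ x, inner ℝ (g x) (f x)) + t ^ 2 * ∫ x, ‖g x‖ ^ 2 := by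
    intro t
    have i23 : Integrable (fun x => ‖f x‖ ^ 2 + t * (2 * inner ℝ (g x) (f x))) volume :=
      i1.add ((i2.const_mul 2).const_mul t)
    rw [← integral_const_mul, ← integral_const_mul, ← integral_const_mul,
      ← integral_add i1 ((i2.const_mul 2).const_mul t), ← integral_add i23 (i3.const_mul _)]
    congr 1
    ext x
    rw [norm_add_sq_real, norm_smul, mul_pow, Real.norm_eq_abs, sq_abs, inner_smul_right,
      real_inner_comm]
    ring
  simp only [e]
  have h1 : HasDerivAt (fun t : ℝ => (∫ x, ‖f x‖ ^ 2)
      + t * (2 * ∫ x, inner ℝ (g x) (f x)) + t ^ 2 * ∫ x, ‖g x‖ ^ 2)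
      (1 * (2 * ∫ x, inner ℝ (g x) (f x)) + (2 * (0 : ℝ)) * ∫ x, ‖g x‖ ^ 2) 0 := by
    refine HasDerivAt.add (((hasDerivAt_id (0 : ℝ)).mul_const _).const_add _) ?_
    have := (hasDerivAt_pow 2 (0 : ℝ)).mul_const (∫ x, ‖g x‖ ^ 2)
    simpa using this
  simpa using h1

theorem hasDerivAt_dirichlet (u φ : H1 𝕜 N) :
    HasDerivAt (fun t : ℝ => dirichlet (u + t • φ)) (2 * gradPair φ u) 0 := by
  refine (hasDerivAt_integral_norm_sq (hasSobGrad_val u).memLp_grad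
    (hasSobGrad_val φ).memLp_grad).congr_of_eventuallyEq (Eventually.of_forall fun t => ?_)
  exact integral_congr_ae ((grad_add_smul u φ t).mono fun x hx => by simp only [hx])

theorem hasDerivAt_sqInt (u φ : H1 𝕜 N) :
    HasDerivAt (fun t : ℝ => sqInt (u + t • φ)) (2 * sqPair φ u) 0 := by
  refine (hasDerivAt_integral_norm_sq (hasSobGrad_val u).memLp
    (hasSobGrad_val φ).memLp).congr_of_eventuallyEq (Eventually.of_forall fun t => ?_)
  exact integral_congr_ae ((val_add_smul u φ t).mono fun x hx => by simp only [hx])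

theorem hasDerivAt_energy (hN : 3 ≤ N) {p q : ℝ} (hp : p ∈ Set.Ioo 2 (critExp N))
    (hq : q ∈ Set.Ioo 2 (critExp N)) (μ : ℝ) (u φ : H1 𝕜 N) :
    HasDerivAt (fun t : ℝ => energy p q μ (u + t • φ))
      (gradPair φ u - μ * powPair p φ u + powPair q φ u) 0 := by
  have hp0 : p ≠ 0 := by linarith [hp.1]
  have hq0 : q ≠ 0 := by linarith [hq.1]
  refine ((((hasDerivAt_dirichlet u φ).const_mul (1 / 2)).sub
    ((hasDerivAt_powInt hN hp u φ).const_mul (μ / p))).add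
    ((hasDerivAt_powInt hN hq u φ).const_mul (1 / q))).congr_deriv ?_
  field_simp

theorem mass_eq (u : H1 𝕜 N) : mass u = 1 / 2 * sqInt u := rfl

theorem mass_pos {u : H1 𝕜 N} (hu : u ≠ 0) : 0 < mass u := by
  rw [mass_eq]
  have := sqInt_pos hu
  positivity

theorem hasDerivAt_mass (u φ : H1 𝕜 N) :
    HasDerivAt (fun t : ℝ => mass (u + t • φ)) (sqPair φ u) 0 := by
  exact ((hasDerivAt_sqInt u φ).const_mul (1 / 2)).congr_deriv (by ring)

theorem re_inner_eq_real_inner (a b : 𝕜) : RCLike.re (inner 𝕜 a b) = inner ℝ a b := rfl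

theorem re_inner_eq_real_inner_vec (a b : 𝔾) : RCLike.re (inner 𝕜 a b) = inner ℝ a b := by
  rw [PiLp.inner_apply, PiLp.inner_apply, map_sum]
  rfl

theorem isWeakSolution_iff (hN : 3 ≤ N) {p q : ℝ} (hp : p ∈ Set.Ioo 2 (critExp N))
    (hq : q ∈ Set.Ioo 2 (critExp N)) {μ lam : ℝ} {u : H1 𝕜 N} :
    IsWeakSolution p q μ lam u ↔ ∀ φ : H1 𝕜 N,
      gradPair φ u - lam * sqPair φ u - μ * powPair p φ u + powPair q φ u = 0 := by
  refine forall_congr' fun φ => ?_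
  simp only [re_inner_eq_real_inner, re_inner_eq_real_inner_vec]
  have hu := hasSobGrad_val u
  have hφ := hasSobGrad_val φ
  have i1 := integrable_inner_of_memLp hφ.memLp_grad hu.memLp_grad
  have i2 := (integrable_inner_of_memLp hφ.memLp hu.memLp).const_mul lam
  have i3 := (hu.integrable_powPair hN hp hφ).const_mul μ
  have i4 := hu.integrable_powPair hN hq hφ
  have i12 : Integrable (fun x => inner ℝ (grad φ x) (grad u x)
      - lam * inner ℝ (val φ x) (val u x)) volume := i1.sub i2
  have i123 : Integrable (fun x => inner ℝ (grad φ x) (grad u x)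
      - lam * inner ℝ (val φ x) (val u x)
      - μ * (‖val u x‖ ^ (p - 2) * inner ℝ (val φ x) (val u x))) volume := i12.sub i3
  rw [integral_add i123 i4, integral_sub i12 i3, integral_sub i1 i2,
    integral_const_mul, integral_const_mul]
  rfl

theorem isCriticalPoint_action_iff (hN : 3 ≤ N) {p q : ℝ} (hp : p ∈ Set.Ioo 2 (critExp N))
    (hq : q ∈ Set.Ioo 2 (critExp N)) {μ lam : ℝ} {u : H1 𝕜 N} :
    IsCriticalPoint (action p q μ lam) u ↔ IsWeakSolution p q μ lam u := by
  rw [isWeakSolution_iff hN hp hq]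
  refine forall_congr' fun φ => ?_
  have h : HasDerivAt (fun t : ℝ => action p q μ lam (u + t • φ))
      (gradPair φ u - lam * sqPair φ u - μ * powPair p φ u + powPair q φ u) 0 := by
    exact ((hasDerivAt_energy hN hp hq μ u φ).sub
      ((hasDerivAt_mass u φ).const_mul lam)).congr_deriv (by ring)
  exact ⟨fun h0 => h.unique h0, fun h0 => h0 ▸ h⟩

theorem action_eq_iff_rayleigh_eq {p q μ S lam : ℝ} {u : H1 𝕜 N} (hu : u ≠ 0) :
    action p q μ lam u = S ↔ lam = rayleigh p q μ S u := by
  rw [action, rayleigh, eq_div_iff (mass_pos hu).ne']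
  constructor <;> intro h <;> linarith

/-- Critical points of the action-level Rayleigh quotient are the solutions whose frequency is the
value of the quotient. -/
theorem isCriticalPoint_rayleigh_iff (hN : 3 ≤ N) {p q : ℝ} (hp : p ∈ Set.Ioo 2 (critExp N))
    (hq : q ∈ Set.Ioo 2 (critExp N)) {μ S : ℝ} {u : H1 𝕜 N} (hu : u ≠ 0) :
    IsCriticalPoint (rayleigh p q μ S) u ↔ IsWeakSolution p q μ (rayleigh p q μ S u) u := by
  rw [isWeakSolution_iff hN hp hq]
  refine forall_congr' fun φ => ?_
  have hm := mass_pos hu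
  have e0 : u + (0 : ℝ) • φ = u := by simp
  have h := ((hasDerivAt_energy hN hp hq μ u φ).sub_const S).div (hasDerivAt_mass u φ)
    (by rw [e0]; exact hm.ne')
  simp only [e0] at h
  have h' : HasDerivAt (fun t : ℝ => rayleigh p q μ S (u + t • φ)) _ 0 := h
  have hiff : ((gradPair φ u - μ * powPair p φ u + powPair q φ u) * mass u
      - (energy p q μ u - S) * sqPair φ u) / mass u ^ 2 = 0 ↔
      gradPair φ u - rayleigh p q μ S u * sqPair φ u - μ * powPair p φ u + powPair q φ u = 0 := by
    rw [div_eq_zero_iff, or_iff_left (by positivity)]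
    have e1 : (gradPair φ u - μ * powPair p φ u + powPair q φ u) * mass u
        - (energy p q μ u - S) * sqPair φ u
        = (gradPair φ u - rayleigh p q μ S u * sqPair φ u - μ * powPair p φ u + powPair q φ u)
          * mass u := by
      rw [rayleigh]
      field_simp
      ring
    rw [e1, mul_eq_zero, or_iff_left hm.ne']
  rw [← hiff]
  exact ⟨fun h0 => h'.unique h0, fun h0 => h0 ▸ h'⟩

end Derivatives

section Existence

variable {𝕜 : Type*} [RCLike 𝕜] {N : ℕ}

local notation "𝔼" => EuclideanSpace ℝ (Fin N)
local notation "𝔾" => EuclideanSpace 𝕜 (Fin N)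

/-! ### Existence of solutions with prescribed frequency and action -/

/-- The constants of the scaling `c κ T ^ (κ - 1) = 1` behind `c_N^S`, with `T = N S`. -/
theorem cNS_mul (hN : 3 ≤ N) {S : ℝ} (hS : 0 < S) :
    cNS N S * sobExp N * (N * S) ^ (sobExp N - 1) = 1 := by
  have h3 : (3 : ℝ) ≤ N := by exact_mod_cast hN
  have hN0 : (0 : ℝ) < N := by linarith
  have h2 : (0 : ℝ) < N - 2 := by linarith
  have e1 : sobExp N - 1 = 2 / ((N : ℝ) - 2) := by
    rw [sobExp]; field_simp; ring
  have e2 : (N : ℝ) ^ ((N : ℝ) / ((N : ℝ) - 2)) = N ^ (2 / ((N : ℝ) - 2)) * N := by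
    rw [← e1, Real.rpow_sub_one hN0.ne', sobExp]
    field_simp
  rw [e1, cNS, e2, sobExp, Real.mul_rpow hN0.le hS.le]
  have p1 : 0 < (N : ℝ) ^ (2 / ((N : ℝ) - 2)) := by positivity
  have p2 : 0 < S ^ (2 / ((N : ℝ) - 2)) := by positivity
  field_simp

theorem cNS_pos (hN : 3 ≤ N) {S : ℝ} (hS : 0 < S) : 0 < cNS N S := by
  have h3 : (3 : ℝ) ≤ N := by exact_mod_cast hN
  have h2 : (0 : ℝ) < N - 2 := by linarith
  unfold cNS
  positivity

theorem ngRayleigh_eq {p q μ S : ℝ} (u : H1 𝕜 N) :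
    ngRayleigh p q μ S u = (cNS N S * dirichlet u ^ sobExp N - μ * (2 / p) * powInt p u
      + 2 / q * powInt q u) / sqInt u := rfl

theorem le_ngRayleigh_iff {p q μ S ℓ : ℝ} {u : H1 𝕜 N} (hu : u ≠ 0) :
    ℓ ≤ ngRayleigh p q μ S u ↔ 0 ≤ gap p q μ (cNS N S) ℓ u := by
  rw [ngRayleigh_eq, le_div_iff₀ (sqInt_pos hu), gap]
  constructor <;> intro h <;> linarith

theorem ngRayleigh_eq_iff {p q μ S ℓ : ℝ} {u : H1 𝕜 N} (hu : u ≠ 0) :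
    ngRayleigh p q μ S u = ℓ ↔ gap p q μ (cNS N S) ℓ u = 0 := by
  rw [ngRayleigh_eq, div_eq_iff (sqInt_pos hu).ne', gap]
  constructor <;> intro h <;> linarith

theorem two_mul_action_eq {p q μ ℓ : ℝ} (c : ℝ) (u : H1 𝕜 N) :
    2 * action p q μ ℓ u = dirichlet u - c * dirichlet u ^ sobExp N + gap p q μ c ℓ u := by
  rw [action, energy, mass_eq, gap]
  ring

theorem one_sub_inv_sobExp (hN : 3 ≤ N) : 1 - (sobExp N)⁻¹ = 2 / N := by
  have h3 : (3 : ℝ) ≤ N := by exact_mod_cast hN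
  have h2 : (N : ℝ) - 2 ≠ 0 := by linarith
  have h0 : (N : ℝ) ≠ 0 := by linarith
  rw [sobExp]
  field_simp
  ring

/-- Every nonzero function has a dilate with prescribed Dirichlet integral; all the terms of the
gap scale by the same factor. -/
theorem exists_dilate (hN : 3 ≤ N) {u : H1 𝕜 N} (hu : u ≠ 0) {T : ℝ} (hT : 0 < T) :
    ∃ v : H1 𝕜 N, v ≠ 0 ∧ dirichlet v = T ∧
      ∀ p q μ c ℓ : ℝ, gap p q μ c ℓ v = (T / dirichlet u) ^ sobExp N * gap p q μ c ℓ u := by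
  have h3 : (3 : ℝ) ≤ N := by exact_mod_cast hN
  have h2 : (0 : ℝ) < N - 2 := by linarith
  have hD := dirichlet_pos hN hu
  set s := T / dirichlet u with hs
  have hs0 : 0 < s := div_pos hT hD
  let a : ℝ := s ^ (-((N : ℝ) - 2)⁻¹)
  have ha : 0 < a := by positivity
  have hv := (hasSobGrad_val u).comp_affine ha.ne' 0
  have eN : |(a ^ N)⁻¹| = s ^ sobExp N := by
    rw [abs_of_pos (by positivity), ← Real.rpow_natCast, ← Real.rpow_neg ha.le,
      ← Real.rpow_mul hs0.le]
    congr 1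
    rw [sobExp]
    field_simp
  have eT : a ^ 2 * s ^ sobExp N = s := by
    rw [← Real.rpow_two, ← Real.rpow_mul hs0.le, ← Real.rpow_add hs0]
    conv_rhs => rw [← Real.rpow_one s]
    congr 1
    rw [sobExp]
    field_simp
    ring
  have hpow : ∀ r, powInt r hv.toH1 = s ^ sobExp N * powInt r u := by
    intro r
    rw [hv.powInt_toH1, integral_comp_affine ha.ne' 0 fun x => ‖val u x‖ ^ r, eN, smul_eq_mul]
    rfl
  have hsq : sqInt hv.toH1 = s ^ sobExp N * sqInt u := by
    rw [hv.sqInt_toH1, integral_comp_affine ha.ne' 0 fun x => ‖val u x‖ ^ 2, eN, smul_eq_mul]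
    rfl
  have hdir : dirichlet hv.toH1 = T := by
    rw [hv.dirichlet_toH1]
    have e1 : ∀ x : 𝔼, ‖a • grad u (a • x + 0)‖ ^ 2
        = a ^ 2 * ‖grad u (a • x + 0)‖ ^ 2 := fun x => by
      rw [norm_smul, mul_pow, Real.norm_of_nonneg ha.le]
    simp only [e1]
    rw [integral_const_mul, integral_comp_affine ha.ne' 0 fun x => ‖grad u x‖ ^ 2, eN, smul_eq_mul,
      ← mul_assoc, eT]
    exact div_mul_cancel₀ T hD.ne'
  refine ⟨hv.toH1, fun h0 => ?_, hdir, fun p q μ c ℓ => ?_⟩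
  · have h1 := sqInt_pos hu
    have h4 : sqInt hv.toH1 = 0 := by
      rw [h0]
      have : (val (0 : H1 𝕜 N)) =ᵐ[volume] 0 := val_ae_zero_iff.2 rfl
      exact integral_eq_zero_of_ae (this.mono fun x hx => by simp [hx])
    rw [hsq] at h4
    have : 0 < s ^ sobExp N * sqInt u := by positivity
    linarith
  · have e5 : T ^ sobExp N = s ^ sobExp N * dirichlet u ^ sobExp N := by
      rw [← Real.mul_rpow hs0.le hD.le, hs, div_mul_cancel₀ T hD.ne']
    rw [gap, gap, hpow, hpow, hsq, hdir, e5]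
    ring

/-- A zero of a nonnegative gap is, after dilation, a solution. -/
theorem exists_solution_of_gap_eq_zero (hN : 3 ≤ N) {p q μ c ℓ : ℝ}
    (hp : p ∈ Set.Ioo 2 (critExp N)) (hq : q ∈ Set.Ioo 2 (critExp N))
    (hG : ∀ u : H1 𝕜 N, 0 ≤ gap p q μ c ℓ u) {T : ℝ} (hT : 0 < T)
    (hcT : c * sobExp N * T ^ (sobExp N - 1) = 1)
    {v : H1 𝕜 N} (hv : v ≠ 0) (hv0 : gap p q μ c ℓ v = 0) :
    ∃ w : H1 𝕜 N, w ≠ 0 ∧ IsWeakSolution p q μ ℓ w ∧ action p q μ ℓ w = T / N := by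
  have hκ := one_lt_sobExp hN
  obtain ⟨w, hw, hwT, hws⟩ := exists_dilate hN hv hT
  have hw0 : gap p q μ c ℓ w = 0 := by rw [hws, hv0, mul_zero]
  have hp0 : p ≠ 0 := by linarith [hp.1]
  have hq0 : q ≠ 0 := by linarith [hq.1]
  refine ⟨w, hw, (isWeakSolution_iff hN hp hq).2 fun φ => ?_, ?_⟩
  · have e0 : w + (0 : ℝ) • φ = w := by simp
    have hd : HasDerivAt (fun t : ℝ => gap p q μ c ℓ (w + t • φ))
        (c * (2 * gradPair φ w * sobExp N * dirichlet (w + (0 : ℝ) • φ) ^ (sobExp N - 1))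
          - μ * (2 / p) * (p * powPair p φ w) + 2 / q * (q * powPair q φ w)
          - ℓ * (2 * sqPair φ w)) 0 :=
      (((((hasDerivAt_dirichlet w φ).rpow_const (Or.inr hκ.le)).const_mul c).sub
        ((hasDerivAt_powInt hN hp w φ).const_mul _)).add
        ((hasDerivAt_powInt hN hq w φ).const_mul _)).sub ((hasDerivAt_sqInt w φ).const_mul ℓ)
    have hmin : IsLocalMin (fun t : ℝ => gap p q μ c ℓ (w + t • φ)) 0 :=
      Eventually.of_forall fun t => by
        simp only [e0, hw0]
        exact hG _
    have h := hmin.hasDerivAt_eq_zero hd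
    rw [e0, hwT] at h
    have e1 : c * (2 * gradPair φ w * sobExp N * T ^ (sobExp N - 1)) = 2 * gradPair φ w := by
      calc c * (2 * gradPair φ w * sobExp N * T ^ (sobExp N - 1))
          = (c * sobExp N * T ^ (sobExp N - 1)) * (2 * gradPair φ w) := by ring
        _ = _ := by rw [hcT, one_mul]
    rw [e1] at h
    field_simp at h
    linarith
  · have h := two_mul_action_eq (p := p) (q := q) (μ := μ) (ℓ := ℓ) c w
    have hκ0 : sobExp N ≠ 0 := by linarith
    have e1 : c * T ^ sobExp N = T * (sobExp N)⁻¹ := by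
      have : T ^ sobExp N = T ^ (sobExp N - 1) * T := by
        rw [Real.rpow_sub_one hT.ne']; field_simp
      rw [this, eq_mul_inv_iff_mul_eq₀ hκ0]
      linear_combination T * hcT
    rw [hw0, hwT, e1, add_zero] at h
    have e2 := one_sub_inv_sobExp hN
    have e3 : T - T * (sobExp N)⁻¹ = 2 * (T / N) := by
      rw [show T - T * (sobExp N)⁻¹ = T * (1 - (sobExp N)⁻¹) by ring, e2]; ring
    linarith

/-- The attainment result in scale-invariant form. -/
theorem exists_gap_eq_zero_of_approx (hN : 3 ≤ N) {p q μ c ℓ : ℝ}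
    (hp : p ∈ Set.Ioo 2 (critExp N)) (hq : q ∈ Set.Ioo 2 (critExp N)) (hμ : 0 < μ) (hc : 0 < c)
    (hℓ : ℓ < 0) (hG : ∀ u : H1 𝕜 N, 0 ≤ gap p q μ c ℓ u)
    (happ : ∀ ε : ℝ, 0 < ε → ∃ u : H1 𝕜 N, u ≠ 0 ∧ gap p q μ c ℓ u ≤ ε * dirichlet u ^ sobExp N) :
    ∃ v : H1 𝕜 N, v ≠ 0 ∧ gap p q μ c ℓ v = 0 := by
  have h1 : ∀ n : ℕ, ∃ v : H1 𝕜 N, dirichlet v = 1 ∧ gap p q μ c ℓ v ≤ 1 / ((n : ℝ) + 1) := by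
    intro n
    obtain ⟨u, hu, hle⟩ := happ (1 / ((n : ℝ) + 1)) (by positivity)
    obtain ⟨v, -, hv1, hvs⟩ := exists_dilate hN hu one_pos
    have hD := dirichlet_pos hN hu
    refine ⟨v, hv1, ?_⟩
    rw [hvs, Real.div_rpow zero_le_one hD.le, Real.one_rpow]
    have : 0 < dirichlet u ^ sobExp N := by positivity
    rw [div_mul_eq_mul_div, one_mul, div_le_iff₀ this]
    exact hle
  choose v hv1 hv using h1
  exact exists_gap_eq_zero hN hp hq hμ hc hℓ hG v hv1
    (squeeze_zero (fun n => hG _) hv tendsto_one_div_add_atTop_nhds_zero_nat)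

/-- The negative power term of the gap is controlled by a small multiple of the mass and a multiple
of the Dirichlet term. -/
theorem exists_pow_term_le_small_sq (hN : 3 ≤ N) (𝕜 : Type*) [RCLike 𝕜] {p μ : ℝ}
    (hp : p ∈ Set.Ioo 2 (critExp N)) (hμ : 0 < μ) {ε : ℝ} (hε : 0 < ε) :
    ∃ K : ℝ, 0 < K ∧ ∀ u : H1 𝕜 N,
      μ * (2 / p) * powInt p u ≤ ε * sqInt u + K * dirichlet u ^ sobExp N := by
  have hp0 : 0 < p := by linarith [hp.1]
  obtain ⟨Cs, hCs0, hCs⟩ := exists_sobolev_const hN 𝕜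
  obtain ⟨K, hK0, hK⟩ := exists_rpow_le_small_sq hp.1 hp.2 (ε := ε / (μ * (2 / p))) (by positivity)
  refine ⟨μ * (2 / p) * (K * Cs), by positivity, fun u => ?_⟩
  have h := (hasSobGrad_val u).integral_rpow_le hN hp hK0.le hK hCs
  calc μ * (2 / p) * powInt p u
      ≤ μ * (2 / p) * (ε / (μ * (2 / p)) * sqInt u + K * (Cs * dirichlet u ^ sobExp N)) := by
        gcongr
        exact h
    _ = _ := by field_simp

/-- The negative power term of the gap is controlled by a small multiple of the Dirichlet term and a
multiple of the mass. -/
theorem exists_pow_term_le_small_dirichlet (hN : 3 ≤ N) (𝕜 : Type*) [RCLike 𝕜] {p μ : ℝ}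
    (hp : p ∈ Set.Ioo 2 (critExp N)) (hμ : 0 < μ) {ε : ℝ} (hε : 0 < ε) :
    ∃ K : ℝ, 0 < K ∧ ∀ u : H1 𝕜 N,
      μ * (2 / p) * powInt p u ≤ K * sqInt u + ε * dirichlet u ^ sobExp N := by
  have hp0 : 0 < p := by linarith [hp.1]
  obtain ⟨Cs, hCs0, hCs⟩ := exists_sobolev_const hN 𝕜
  obtain ⟨K, hK0, hK⟩ := exists_rpow_le_small_crit hp.1 hp.2 (ε := ε / (μ * (2 / p) * Cs))
    (by positivity)
  refine ⟨μ * (2 / p) * K, by positivity, fun u => ?_⟩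
  have h := (hasSobGrad_val u).integral_rpow_le hN hp (by positivity) hK hCs
  calc μ * (2 / p) * powInt p u
      ≤ μ * (2 / p) * (K * sqInt u
        + ε / (μ * (2 / p) * Cs) * (Cs * dirichlet u ^ sobExp N)) := by
        gcongr
        exact h
    _ = _ := by field_simp

theorem gap_zero (hN : 3 ≤ N) {p q : ℝ} (hp : p ∈ Set.Ioo 2 (critExp N))
    (hq : q ∈ Set.Ioo 2 (critExp N)) (μ c ℓ : ℝ) : gap p q μ c ℓ (0 : H1 𝕜 N) = 0 := by
  have hv : (val (0 : H1 𝕜 N)) =ᵐ[volume] 0 := val_ae_zero_iff.2 rfl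
  have hpow : ∀ r : ℝ, 0 < r → powInt r (0 : H1 𝕜 N) = 0 := fun r hr =>
    integral_eq_zero_of_ae (hv.mono fun x hx => by simp [hx, hr.ne'])
  have hsq : sqInt (0 : H1 𝕜 N) = 0 :=
    integral_eq_zero_of_ae (hv.mono fun x hx => by simp [hx])
  have hg : (grad (0 : H1 𝕜 N)) =ᵐ[volume] fun _ => 0 := by
    have h0 : HasSobGrad (fun _ : 𝔼 => (0 : 𝕜)) (fun _ : 𝔼 => (0 : 𝔾)) := by
      simpa using (hasSobGrad_val (0 : H1 𝕜 N)).smul 0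
    exact grad_ae_eq h0 hv
  have hd : dirichlet (0 : H1 𝕜 N) = 0 :=
    integral_eq_zero_of_ae (hg.mono fun x hx => by simp [hx])
  rw [gap, hpow p (by linarith [hp.1]), hpow q (by linarith [hq.1]), hsq, hd,
    Real.zero_rpow (by linarith [one_lt_sobExp hN])]
  ring

/-- With the action fixed: if the nonlinear Rayleigh quotient takes a value below `lam < 0`, then
there is a solution with action `S` and a frequency below `lam`. -/
theorem exists_solution_lower_frequency (hN : 3 ≤ N) {p q μ S lam : ℝ}
    (hp : p ∈ Set.Ioo 2 (critExp N)) (hq : q ∈ Set.Ioo 2 (critExp N)) (hμ : 0 < μ) (hS : 0 < S)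
    (hlam : lam < 0) {v : H1 𝕜 N} (hv : gap p q μ (cNS N S) lam v < 0) :
    ∃ (ℓ : ℝ) (w : H1 𝕜 N), ℓ < lam ∧ w ≠ 0 ∧ IsWeakSolution p q μ ℓ w ∧
      action p q μ ℓ w = S := by
  have h3 : (3 : ℝ) ≤ N := by exact_mod_cast hN
  have hq0 : 0 < q := by linarith [hq.1]
  set c := cNS N S
  have hc : 0 < c := cNS_pos hN hS
  have hv0 : v ≠ 0 := by
    rintro rfl
    rw [gap_zero hN hp hq] at hv
    exact lt_irrefl _ hv
  -- the supremum of `L` is the infimum of the nonlinear Rayleigh quotient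
  let L : Set ℝ := {ℓ | ∀ u : H1 𝕜 N, 0 ≤ gap p q μ c ℓ u}
  have hmono : ∀ (u : H1 𝕜 N) (a b : ℝ), gap p q μ c b u = gap p q μ c a u - (b - a) * sqInt u :=
    fun u a b => by rw [gap, gap]; ring
  have hLne : L.Nonempty := by
    obtain ⟨K, hK0, hK⟩ := exists_pow_term_le_small_dirichlet hN 𝕜 hp hμ hc
    refine ⟨-K, fun u => ?_⟩
    have h1 := hK u
    have h2 : 0 ≤ 2 / q * powInt q u := mul_nonneg (by positivity) (powInt_nonneg _ _)
    rw [gap]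
    linarith
  -- every admissible frequency lies strictly below `lam`, by a margin given by `v`
  have hLv : ∀ ℓ ∈ L, ℓ ≤ lam + gap p q μ c lam v / sqInt v := by
    intro ℓ hℓ
    have h1 := hℓ v
    rw [hmono v lam ℓ] at h1
    have h2 : ℓ - lam ≤ gap p q μ c lam v / sqInt v := by
      rw [le_div_iff₀ (sqInt_pos hv0)]; linarith
    linarith
  have hbdd : BddAbove L := ⟨_, hLv⟩
  set ℓ := sSup L with hℓdef
  have hℓlam : ℓ < lam := by
    have h1 : ℓ ≤ _ := csSup_le hLne hLv
    have h2 : gap p q μ c lam v / sqInt v < 0 := div_neg_of_neg_of_pos hv (sqInt_pos hv0)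
    linarith
  have hℓ0 : ℓ < 0 := hℓlam.trans hlam
  -- the gap is continuous in the frequency, so `L` contains its supremum
  have hG : ∀ u : H1 𝕜 N, 0 ≤ gap p q μ c ℓ u := by
    intro u
    by_contra! hneg
    have hs := sqInt_nonneg u
    have hs1 : 0 < sqInt u + 1 := by linarith
    obtain ⟨a, haL, ha⟩ := exists_lt_of_lt_csSup hLne
      (show ℓ + gap p q μ c ℓ u / (sqInt u + 1) < ℓ by
        have := div_neg_of_neg_of_pos hneg hs1
        linarith)
    have h1 := haL u
    rw [hmono u ℓ a] at h1
    have h2 : gap p q μ c ℓ u / (sqInt u + 1) < a - ℓ := by linarith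
    rw [div_lt_iff₀ hs1] at h2
    have h3 : a ≤ ℓ := le_csSup hbdd haL
    linarith
  obtain ⟨K, hK0, hK⟩ := exists_pow_term_le_small_sq hN 𝕜 hp hμ (ε := -ℓ / 4) (by linarith)
  obtain ⟨w0, hw0, hw0g⟩ := exists_gap_eq_zero_of_approx hN hp hq hμ hc hℓ0 hG (by
    intro ε hε
    -- `δ` keeps the frequency below `ℓ / 2`, so that the mass stays controlled
    let δ : ℝ := min (-ℓ / 2) (ε * (-ℓ / 4) / K)
    have hδ : 0 < δ := lt_min (by linarith) (by have : 0 < -ℓ / 4 := by linarith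
                                                positivity)
    have hnot : ℓ + δ ∉ L := fun h => by
      have := le_csSup hbdd h
      linarith
    simp only [L, Set.mem_ofPred_eq, not_forall, not_le] at hnot
    obtain ⟨u, hu⟩ := hnot
    have hu0 : u ≠ 0 := by
      rintro rfl
      rw [gap_zero hN hp hq] at hu
      exact lt_irrefl _ hu
    refine ⟨u, hu0, ?_⟩
    have h1 := hK u
    have hs := sqInt_pos hu0
    have hT : 0 < dirichlet u ^ sobExp N := Real.rpow_pos_of_pos (dirichlet_pos hN hu0) _
    have h2 : 0 ≤ 2 / q * powInt q u := mul_nonneg (by positivity) (powInt_nonneg _ _)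
    have hδ1 : δ ≤ -ℓ / 2 := min_le_left _ _
    have hδ2 : δ ≤ ε * (-ℓ / 4) / K := min_le_right _ _
    -- the mass is controlled by the Dirichlet term
    have hM : -ℓ / 4 * sqInt u ≤ K * dirichlet u ^ sobExp N := by
      have h4 : 0 < c * dirichlet u ^ sobExp N := by positivity
      have h5 := hu
      rw [gap] at h5
      have h6 : (ℓ + δ) * sqInt u ≤ ℓ / 2 * sqInt u :=
        mul_le_mul_of_nonneg_right (by linarith) hs.le
      linarith
    have h7 : gap p q μ c ℓ u ≤ δ * sqInt u := by
      have h8 := hmono u ℓ (ℓ + δ)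
      rw [add_sub_cancel_left] at h8
      linarith
    have h9 : 0 < -ℓ / 4 := by linarith
    calc gap p q μ c ℓ u ≤ δ * sqInt u := h7
      _ ≤ ε * (-ℓ / 4) / K * sqInt u := by gcongr
      _ = ε / K * (-ℓ / 4 * sqInt u) := by ring
      _ ≤ ε / K * (K * dirichlet u ^ sobExp N) := by gcongr
      _ = ε * dirichlet u ^ sobExp N := by field_simp)
  have hN0 : (0 : ℝ) < N := by linarith
  obtain ⟨w, hw, hws, hwa⟩ := exists_solution_of_gap_eq_zero hN hp hq hG
    (mul_pos hN0 hS) (cNS_mul hN hS) hw0 hw0g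
  exact ⟨ℓ, w, hℓlam, hw, hws, by rw [hwa]; field_simp⟩

/-- With the frequency fixed: if the nonlinear Rayleigh quotient at `S` takes a value below
`lam < 0`, then there is a solution with frequency `lam` and action below `S`. -/
theorem exists_solution_lower_action (hN : 3 ≤ N) {p q μ S lam : ℝ}
    (hp : p ∈ Set.Ioo 2 (critExp N)) (hq : q ∈ Set.Ioo 2 (critExp N)) (hμ : 0 < μ) (hS : 0 < S)
    (hlam : lam < 0) {v : H1 𝕜 N} (hv : gap p q μ (cNS N S) lam v < 0) :
    ∃ w : H1 𝕜 N, w ≠ 0 ∧ IsWeakSolution p q μ lam w ∧ action p q μ lam w < S := by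
  have h3 : (3 : ℝ) ≤ N := by exact_mod_cast hN
  have hq0 : 0 < q := by linarith [hq.1]
  have hκ := one_lt_sobExp hN
  have hv0 : v ≠ 0 := by
    rintro rfl
    rw [gap_zero hN hp hq] at hv
    exact lt_irrefl _ hv
  -- the least admissible constant plays the role of `c_N` at the smaller action
  let L : Set ℝ := {c | ∀ u : H1 𝕜 N, 0 ≤ gap p q μ c lam u}
  have hmono : ∀ (u : H1 𝕜 N) (a b : ℝ),
      gap p q μ b lam u = gap p q μ a lam u + (b - a) * dirichlet u ^ sobExp N :=
    fun u a b => by rw [gap, gap]; ring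
  have hTnn : ∀ u : H1 𝕜 N, 0 ≤ dirichlet u ^ sobExp N := fun u =>
    Real.rpow_nonneg (dirichlet_nonneg u) _
  have hLne : L.Nonempty := by
    obtain ⟨K, hK0, hK⟩ := exists_pow_term_le_small_sq hN 𝕜 hp hμ (ε := -lam) (by linarith)
    refine ⟨K, fun u => ?_⟩
    have h1 := hK u
    have h2 : 0 ≤ 2 / q * powInt q u := mul_nonneg (by positivity) (powInt_nonneg _ _)
    rw [gap]
    linarith
  have hTv : 0 < dirichlet v ^ sobExp N := Real.rpow_pos_of_pos (dirichlet_pos hN hv0) _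
  have hLv : ∀ c ∈ L, cNS N S - gap p q μ (cNS N S) lam v / dirichlet v ^ sobExp N ≤ c := by
    intro c hc
    have h1 := hc v
    rw [hmono v (cNS N S) c] at h1
    have h2 : - gap p q μ (cNS N S) lam v / dirichlet v ^ sobExp N ≤ c - cNS N S := by
      rw [div_le_iff₀ hTv]; linarith
    rw [neg_div] at h2
    linarith
  have hbdd : BddBelow L := ⟨_, hLv⟩
  set c := sInf L with hcdef
  have hcS : cNS N S < c := by
    have h1 : _ ≤ c := le_csInf hLne hLv
    have h2 : gap p q μ (cNS N S) lam v / dirichlet v ^ sobExp N < 0 :=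
      div_neg_of_neg_of_pos hv hTv
    linarith
  have hc : 0 < c := (cNS_pos hN hS).trans hcS
  have hG : ∀ u : H1 𝕜 N, 0 ≤ gap p q μ c lam u := by
    intro u
    by_contra! hneg
    have hs1 : 0 < dirichlet u ^ sobExp N + 1 := by linarith [hTnn u]
    obtain ⟨a, haL, ha⟩ := exists_lt_of_csInf_lt hLne
      (show c < c - gap p q μ c lam u / (dirichlet u ^ sobExp N + 1) by
        have := div_neg_of_neg_of_pos hneg hs1
        linarith)
    have h1 := haL u
    rw [hmono u c a] at h1
    have h2 : gap p q μ c lam u / (dirichlet u ^ sobExp N + 1) < c - a := by linarith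
    rw [div_lt_iff₀ hs1] at h2
    have h3 : c ≤ a := csInf_le hbdd haL
    linarith
  obtain ⟨w0, hw0, hw0g⟩ := exists_gap_eq_zero_of_approx hN hp hq hμ hc hlam hG (by
    intro ε hε
    have hnot : c - ε ∉ L := fun h => by
      have := csInf_le hbdd h
      linarith
    simp only [L, Set.mem_ofPred_eq, not_forall, not_le] at hnot
    obtain ⟨u, hu⟩ := hnot
    refine ⟨u, ?_, ?_⟩
    · rintro rfl
      rw [gap_zero hN hp hq] at hu
      exact lt_irrefl _ hu
    · rw [hmono u c (c - ε)] at hu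
      linarith)
  have hN0 : (0 : ℝ) < N := by linarith
  have hκ1 : 0 < sobExp N - 1 := by linarith
  have hκ0 : 0 < sobExp N := by linarith
  -- the Dirichlet integral of the solution; it decreases as `c` grows, which lowers the action
  let T : ℝ := (c * sobExp N)⁻¹ ^ (sobExp N - 1)⁻¹
  have hT : 0 < T := by positivity
  have hcT : c * sobExp N * T ^ (sobExp N - 1) = 1 := by
    rw [← Real.rpow_mul (by positivity), inv_mul_cancel₀ hκ1.ne', Real.rpow_one,
      mul_inv_cancel₀ (by positivity)]
  obtain ⟨w, hw, hws, hwa⟩ := exists_solution_of_gap_eq_zero hN hp hq hG hT hcT hw0 hw0g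
  refine ⟨w, hw, hws, ?_⟩
  rw [hwa, div_lt_iff₀ hN0]
  by_contra! hle
  have h1 := cNS_mul hN hS
  have h2 : (N * S) ^ (sobExp N - 1) ≤ T ^ (sobExp N - 1) :=
    Real.rpow_le_rpow (by positivity) (by linarith) hκ1.le
  have h4 : 0 < (N * S) ^ (sobExp N - 1) := by positivity
  have h5 : cNS N S * sobExp N * (N * S) ^ (sobExp N - 1)
      < c * sobExp N * T ^ (sobExp N - 1) := by
    calc cNS N S * sobExp N * (N * S) ^ (sobExp N - 1)
        < c * sobExp N * (N * S) ^ (sobExp N - 1) := by gcongr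
      _ ≤ _ := by gcongr
  rw [h1, hcT] at h5
  exact lt_irrefl _ h5

end Existence

section Ray

variable {𝕜 : Type*} [RCLike 𝕜] {N : ℕ}

local notation "𝔼" => EuclideanSpace ℝ (Fin N)
local notation "𝔾" => EuclideanSpace 𝕜 (Fin N)

/-! ### The Pohozaev identity on the ray through a solution, for `q ≤ p` -/

theorem val_smul (w : H1 𝕜 N) (t : ℝ) : val (t • w) =ᵐ[volume] fun x => t • val w x :=
  Lp.coeFn_smul t w.1

theorem grad_smul (w : H1 𝕜 N) (t : ℝ) : grad (t • w) =ᵐ[volume] fun x => t • grad w x :=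
  grad_ae_eq ((hasSobGrad_val w).smul t) (val_smul w t)

theorem dirichlet_smul (w : H1 𝕜 N) (t : ℝ) : dirichlet (t • w) = t ^ 2 * dirichlet w := by
  rw [dirichlet, dirichlet, ← integral_const_mul]
  exact integral_congr_ae ((grad_smul w t).mono fun x hx => by
    simp only [hx, norm_smul, mul_pow, Real.norm_eq_abs, sq_abs])

theorem sqInt_smul (w : H1 𝕜 N) (t : ℝ) : sqInt (t • w) = t ^ 2 * sqInt w := by
  rw [sqInt, sqInt, ← integral_const_mul]
  exact integral_congr_ae ((val_smul w t).mono fun x hx => by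
    simp only [hx, norm_smul, mul_pow, Real.norm_eq_abs, sq_abs])

theorem powInt_smul (w : H1 𝕜 N) (r : ℝ) {t : ℝ} (ht : 0 ≤ t) :
    powInt r (t • w) = t ^ r * powInt r w := by
  rw [powInt, powInt, ← integral_const_mul]
  exact integral_congr_ae ((val_smul w t).mono fun x hx => by
    simp only [hx, norm_smul, Real.norm_of_nonneg ht, Real.mul_rpow ht (norm_nonneg _)])

theorem powPair_self {r : ℝ} (hr : 2 < r) (w : H1 𝕜 N) : powPair r w w = powInt r w := by
  rw [powPair, powInt]
  congr 1
  ext x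
  rw [real_inner_self_eq_norm_sq, rpow_sub_two_mul hr (norm_nonneg _)]

/-- The Nehari identity. -/
theorem IsWeakSolution.nehari (hN : 3 ≤ N) {p q μ lam : ℝ} (hp : p ∈ Set.Ioo 2 (critExp N))
    (hq : q ∈ Set.Ioo 2 (critExp N)) {w : H1 𝕜 N} (h : IsWeakSolution p q μ lam w) :
    dirichlet w - lam * sqInt w - μ * powInt p w + powInt q w = 0 := by
  have h1 := (isWeakSolution_iff hN hp hq).1 h w
  rw [powPair_self hp.1, powPair_self hq.1, gradPair, sqPair] at h1
  simp only [real_inner_self_eq_norm_sq] at h1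
  exact h1

/-- `(t ^ r - 1) / r` is nondecreasing in `r > 0`; this is Bernoulli's inequality. -/
theorem rpow_sub_one_div_le {r s t : ℝ} (hr : 0 < r) (hrs : r ≤ s) (ht : 0 ≤ t) :
    (t ^ r - 1) / r ≤ (t ^ s - 1) / s := by
  have hs : 0 < s := hr.trans_le hrs
  have h := one_add_mul_self_le_rpow_one_add (s := t ^ r - 1)
    (by linarith [Real.rpow_nonneg ht r]) ((one_le_div hr).2 hrs)
  rw [add_sub_cancel, ← Real.rpow_mul ht, mul_div_cancel₀ _ hr.ne'] at h
  rw [div_le_div_iff₀ hr hs]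
  have : (1 + s / r * (t ^ r - 1)) * r ≤ t ^ s * r := by gcongr
  have e : (1 + s / r * (t ^ r - 1)) * r = r + s * (t ^ r - 1) := by field_simp
  linarith

/-- For `q ≤ p` the action of a solution is maximal along its ray. By the Nehari identity the
difference of the actions is a combination, with nonnegative coefficients, of differences of the
quotients `(t ^ r - 1) / r` for `r = 2, q, p`. -/
theorem action_smul_le (hN : 3 ≤ N) {p q μ lam : ℝ} (hp : p ∈ Set.Ioo 2 (critExp N))
    (hq : q ∈ Set.Ioo 2 (critExp N)) (hqp : q ≤ p) (hlam : lam < 0) {w : H1 𝕜 N}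
    (h : IsWeakSolution p q μ lam w) {t : ℝ} (ht : 0 ≤ t) :
    action p q μ lam (t • w) ≤ action p q μ lam w := by
  have h1 := h.nehari hN hp hq
  have hp0 : 0 < p := by linarith [hp.1]
  have hq0 : 0 < q := by linarith [hq.1]
  have h2 := rpow_sub_one_div_le two_pos hq.1.le ht
  have h3 := rpow_sub_one_div_le hq0 hqp ht
  rw [Real.rpow_two] at h2
  have hR := powInt_nonneg q w
  have hA : 0 ≤ μ * powInt p w - powInt q w := by
    have := dirichlet_nonneg w
    have := mul_nonneg (neg_nonneg.2 hlam.le) (sqInt_nonneg w)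
    linarith
  have e : action p q μ lam w - action p q μ lam (t • w)
      = (μ * powInt p w - powInt q w) * ((t ^ p - 1) / p - (t ^ 2 - 1) / 2)
        + powInt q w * ((t ^ p - 1) / p - (t ^ q - 1) / q) := by
    simp only [action, energy, mass_eq, dirichlet_smul, sqInt_smul, powInt_smul w _ ht]
    have e1 : dirichlet w = lam * sqInt w + μ * powInt p w - powInt q w := by linarith
    rw [e1]
    field_simp
    ring
  have i1 := mul_nonneg hA (by linarith : 0 ≤ (t ^ p - 1) / p - (t ^ 2 - 1) / 2)
  have i2 := mul_nonneg hR (by linarith : 0 ≤ (t ^ p - 1) / p - (t ^ q - 1) / q)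
  linarith

/-- For `q ≤ p` the ray through a solution meets the Pohozaev set: the defect is positive near zero,
and far out the power `p` dominates. For `q = p` the Nehari identity gives the sign. -/
theorem exists_smul_pohozaev (hN : 3 ≤ N) {p q μ lam : ℝ} (hp : p ∈ Set.Ioo 2 (critExp N))
    (hq : q ∈ Set.Ioo 2 (critExp N)) (hqp : q ≤ p) (hμ : 0 < μ) (hlam : lam < 0) {w : H1 𝕜 N}
    (hw : w ≠ 0) (h : IsWeakSolution p q μ lam w) :
    ∃ t : ℝ, 0 < t ∧ dirichlet (t • w) = sobExp N * (lam * sqInt (t • w)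
      + μ * (2 / p) * powInt p (t • w) - 2 / q * powInt q (t • w)) := by
  have h1 := h.nehari hN hp hq
  have hp2 := hp.1
  have hq2 := hq.1
  have hκ : 0 < sobExp N := by linarith [one_lt_sobExp hN]
  have hT := dirichlet_pos hN hw
  have hM := sqInt_pos hw
  have hlM : 0 < -lam * sqInt w := mul_pos (by linarith) hM
  have hR := powInt_nonneg q w
  have hP : 0 < powInt p w := by
    have : 0 < μ * powInt p w := by linarith
    exact pos_of_mul_pos_right this hμ.le
  -- the Pohozaev identity on the ray, divided by `t ^ 2`
  let f : ℝ → ℝ := fun t => dirichlet w + sobExp N * (-lam * sqInt w)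
    - sobExp N * (μ * (2 / p) * powInt p w * t ^ (p - 2) - 2 / q * powInt q w * t ^ (q - 2))
  have hf : Continuous f := by
    have c1 : Continuous fun t : ℝ => t ^ (p - 2) :=
      Real.continuous_rpow_const (by linarith)
    have c2 : Continuous fun t : ℝ => t ^ (q - 2) :=
      Real.continuous_rpow_const (by linarith)
    fun_prop
  have hf0 : 0 < f 0 := by
    simp only [f]
    rw [Real.zero_rpow (by linarith), Real.zero_rpow (by linarith)]
    simp only [mul_zero, sub_zero]
    positivity
  obtain ⟨B, hB, hlimB⟩ : ∃ B : ℝ, 0 < B ∧ Tendsto (fun t : ℝ => μ * (2 / p) * powInt p w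
      - 2 / q * powInt q w * t ^ (q - p)) atTop (𝓝 B) := by
    rcases hqp.lt_or_eq with hlt | rfl
    · refine ⟨μ * (2 / p) * powInt p w, by positivity, ?_⟩
      have := (tendsto_rpow_neg_atTop (y := p - q) (by linarith)).const_mul (2 / q * powInt q w)
      rw [mul_zero] at this
      simpa using this.const_sub (μ * (2 / p) * powInt p w)
    · refine ⟨2 / q * (μ * powInt q w - powInt q w),
        mul_pos (by positivity) (by linarith), ?_⟩
      simp only [sub_self, Real.rpow_zero, mul_one]
      refine tendsto_const_nhds.congr fun _ => ?_
      ring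
  have hlim : Tendsto (fun t : ℝ => t ^ (p - 2) * (μ * (2 / p) * powInt p w
      - 2 / q * powInt q w * t ^ (q - p))) atTop atTop :=
    (tendsto_rpow_atTop (by linarith)).atTop_mul_pos hB hlimB
  obtain ⟨t₁, ht₁, ht₁f⟩ := ((eventually_gt_atTop 0).and (hlim.eventually_ge_atTop
    ((dirichlet w + sobExp N * (-lam * sqInt w)) / sobExp N))).exists
  have hft₁ : f t₁ ≤ 0 := by
    rw [div_le_iff₀ hκ] at ht₁f
    have e : t₁ ^ (q - 2) = t₁ ^ (p - 2) * t₁ ^ (q - p) := by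
      rw [← Real.rpow_add ht₁]; congr 1; ring
    simp only [f]
    rw [e]
    linarith
  obtain ⟨t, ⟨ht0, -⟩, htf⟩ := intermediate_value_Icc' ht₁.le hf.continuousOn ⟨hft₁, hf0.le⟩
  have htpos : 0 < t := ht0.lt_of_ne fun h0 => by rw [← h0] at htf; linarith
  refine ⟨t, htpos, ?_⟩
  rw [dirichlet_smul, sqInt_smul, powInt_smul w _ ht0, powInt_smul w _ ht0,
    ← rpow_sub_two_mul hp2 ht0, ← rpow_sub_two_mul hq2 ht0]
  simp only [f] at htf
  linear_combination t ^ 2 * htf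

end Ray

section Semiconcave

variable {𝕜 : Type*} [RCLike 𝕜]

/-! ### Semiconcavity of the potential, for `p < q` -/

/-- The potential `(λ/2)|z|² + (μ/p)|z| ^ p - (1/q)|z| ^ q`, so that the action is
`∫ (½ |∇u|² - potential u)`. -/
noncomputable def potential (p q μ lam : ℝ) (z : 𝕜) : ℝ :=
  lam / 2 * ‖z‖ ^ 2 + μ / p * ‖z‖ ^ p - 1 / q * ‖z‖ ^ q

/-- The lower power is dominated by the higher one for large `t` and by a constant for small `t`. -/
theorem exists_rpow_sub_rpow_le {p q b : ℝ} (hp : 2 < p) (hpq : p < q) (hb : 0 < b) :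
    ∃ K : ℝ, 0 < K ∧ ∀ t : ℝ, 0 ≤ t → b * t ^ (p - 2) ≤ K + t ^ (q - 2) := by
  have ht₀ : 0 < b ^ (q - p)⁻¹ := by positivity
  refine ⟨b * (b ^ (q - p)⁻¹) ^ (p - 2), by positivity, fun t ht => ?_⟩
  rcases le_total t (b ^ (q - p)⁻¹) with h | h
  · have h1 : b * t ^ (p - 2) ≤ b * (b ^ (q - p)⁻¹) ^ (p - 2) := by
      gcongr
    linarith [Real.rpow_nonneg ht (q - 2)]
  · have h1 : b ≤ t ^ (q - p) := by
      calc b = (b ^ (q - p)⁻¹) ^ (q - p) := by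
            rw [← Real.rpow_mul hb.le, inv_mul_cancel₀ (by linarith), Real.rpow_one]
        _ ≤ t ^ (q - p) := Real.rpow_le_rpow ht₀.le h (by linarith)
    have h2 : t ^ (q - 2) = t ^ (q - p) * t ^ (p - 2) := by
      rw [← Real.rpow_add (ht₀.trans_le h)]; congr 1; ring
    have h3 : b * t ^ (p - 2) ≤ t ^ (q - p) * t ^ (p - 2) := by gcongr
    have : 0 < b * (b ^ (q - p)⁻¹) ^ (p - 2) := by positivity
    linarith

/-- For `p < q` the potential is semiconcave: subtracting a large multiple of `|z|²` leaves a
radial function with a concave decreasing profile. -/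
theorem exists_potential_semiconcave {p q μ : ℝ} (hp : 2 < p) (hpq : p < q) (hμ : 0 < μ)
    (lam : ℝ) : ∃ C : ℝ, 0 < C ∧ ∀ a b : 𝕜,
      potential p q μ lam b - potential p q μ lam a ≤
        lam * inner ℝ (b - a) a + μ * (‖a‖ ^ (p - 2) * inner ℝ (b - a) a)
          - ‖a‖ ^ (q - 2) * inner ℝ (b - a) a + C * ‖b - a‖ ^ 2 := by
  have hp0 : p ≠ 0 := by linarith
  have hq0 : q ≠ 0 := by linarith
  obtain ⟨K, hK0, hK⟩ := exists_rpow_sub_rpow_le hp hpq (b := μ * (p - 1))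
    (mul_pos hμ (by linarith))
  refine ⟨(K + |lam|) / 2, by positivity, fun a b => ?_⟩
  set C := (K + |lam|) / 2
  have hC : K ≤ 2 * C - lam := by
    have := le_abs_self lam
    simp only [C]; linarith
  -- the radial profile of `C |z|² - potential z` and its first two derivatives
  let ψ : ℝ → ℝ := fun t => (C - lam / 2) * t ^ 2 - μ / p * t ^ p + 1 / q * t ^ q
  let ψ' : ℝ → ℝ := fun t => (2 * C - lam) * t - μ * t ^ (p - 1) + t ^ (q - 1)
  let ψ'' : ℝ → ℝ := fun t => (2 * C - lam) - μ * ((p - 1) * t ^ (p - 2)) + (q - 1) * t ^ (q - 2)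
  have d1 : ∀ t, HasDerivAt ψ (ψ' t) t := by
    intro t
    have e1 : HasDerivAt (fun t : ℝ => t ^ p) (p * t ^ (p - 1)) t :=
      Real.hasDerivAt_rpow_const (Or.inr (by linarith))
    have e2 : HasDerivAt (fun t : ℝ => t ^ q) (q * t ^ (q - 1)) t :=
      Real.hasDerivAt_rpow_const (Or.inr (by linarith))
    refine ((((hasDerivAt_pow 2 t).const_mul (C - lam / 2)).sub (e1.const_mul (μ / p))).add
      (e2.const_mul (1 / q))).congr_deriv ?_
    simp only [ψ']
    field_simp
    push_cast
    ring
  have d2 : ∀ t, HasDerivAt ψ' (ψ'' t) t := by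
    intro t
    have e1 : HasDerivAt (fun t : ℝ => t ^ (p - 1)) ((p - 1) * t ^ (p - 1 - 1)) t :=
      Real.hasDerivAt_rpow_const (Or.inr (by linarith))
    have e2 : HasDerivAt (fun t : ℝ => t ^ (q - 1)) ((q - 1) * t ^ (q - 1 - 1)) t :=
      Real.hasDerivAt_rpow_const (Or.inr (by linarith))
    refine ((((hasDerivAt_id t).const_mul (2 * C - lam)).sub
      (e1.const_mul μ)).add e2).congr_deriv ?_
    rw [show p - 1 - 1 = p - 2 by ring, show q - 1 - 1 = q - 2 by ring, mul_one]
  have hψ'' : ∀ t, 0 ≤ t → 0 ≤ ψ'' t := by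
    intro t ht
    have h1 := hK t ht
    have h2 : 0 ≤ (q - 2) * t ^ (q - 2) := mul_nonneg (by linarith) (Real.rpow_nonneg ht _)
    simp only [ψ'']
    linarith
  have hconv : ConvexOn ℝ (Set.Ici 0) ψ := by
    refine convexOn_of_hasDerivWithinAt2_nonneg (convex_Ici 0)
      (fun t _ => (d1 t).continuousAt.continuousWithinAt)
      (fun t _ => (d1 t).hasDerivWithinAt) (fun t _ => (d2 t).hasDerivWithinAt) fun t ht => ?_
    rw [interior_Ici] at ht
    exact hψ'' t (le_of_lt ht)
  set s := ‖a‖ with hs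
  set r := ‖b‖ with hr
  have hs0 : 0 ≤ s := norm_nonneg a
  have hr0 : 0 ≤ r := norm_nonneg b
  have htan : ψ' s * (r - s) ≤ ψ r - ψ s := by
    rcases lt_trichotomy s r with h | h | h
    · have := hconv.le_slope_of_hasDerivAt (Set.mem_Ici.2 hs0) (Set.mem_Ici.2 hr0) h (d1 s)
      rwa [slope_def_field, le_div_iff₀ (by linarith)] at this
    · rw [h]; simp
    · have := hconv.slope_le_of_hasDerivAt (Set.mem_Ici.2 hr0) (Set.mem_Ici.2 hs0) h (d1 s)
      rw [slope_def_field, div_le_iff₀ (by linarith)] at this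
      linarith
  have hm : 0 ≤ (2 * C - lam) - μ * s ^ (p - 2) + s ^ (q - 2) := by
    have h1 := hK s hs0
    have h2 : 0 ≤ μ * ((p - 2) * s ^ (p - 2)) :=
      mul_nonneg hμ.le (mul_nonneg (by linarith) (Real.rpow_nonneg hs0 _))
    linarith
  have hin : inner ℝ (b - a) a ≤ s * r - s ^ 2 := by
    rw [inner_sub_left, real_inner_self_eq_norm_sq]
    have := real_inner_le_norm b a
    linarith
  have e1 : ψ' s * (r - s) = ((2 * C - lam) - μ * s ^ (p - 2) + s ^ (q - 2)) * (s * r - s ^ 2) := by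
    have e2 : ∀ z : ℝ, 2 < z → s ^ (z - 1) = s ^ (z - 2) * s := by
      intro z hz
      rw [← Real.rpow_add_one' hs0 (by linarith)]
      congr 1; ring
    simp only [ψ']
    rw [e2 p hp, e2 q (hp.trans hpq)]
    ring
  have h3 := mul_le_mul_of_nonneg_left hin hm
  have h4 : ‖b - a‖ ^ 2 = r ^ 2 - s ^ 2 - 2 * inner ℝ (b - a) a := by
    have := norm_add_sq_real (b - a) a
    rw [sub_add_cancel] at this
    linarith
  rw [h4, potential, potential, ← hs, ← hr]
  simp only [ψ] at htan
  rw [e1] at htan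
  linarith

end Semiconcave

section DilatedCutoffs

variable {N : ℕ}

local notation "𝔼" => EuclideanSpace ℝ (Fin N)

/-! ### Integrals against dilated cutoff functions -/

theorem fderiv_cutoffAt_eq_zero {R : ℝ} (hR : 0 < R) {x : 𝔼} (hx : ‖x‖ < R ∨ 2 * R < ‖x‖) :
    fderiv ℝ (cutoffAt R) x = 0 := by
  rcases hx with hx | hx
  · have h : (cutoffAt R : 𝔼 → ℝ) =ᶠ[𝓝 x] fun _ => (1 : ℝ) := by
      filter_upwards [(isOpen_lt continuous_norm continuous_const).mem_nhds hx] with z hz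
      exact cutoffAt_eq_one hR (le_of_lt hz)
    rw [h.fderiv_eq]
    simp
  · have h : (cutoffAt R : 𝔼 → ℝ) =ᶠ[𝓝 x] fun _ => (0 : ℝ) := by
      filter_upwards [(isOpen_lt continuous_const continuous_norm).mem_nhds hx] with z hz
      exact cutoffAt_eq_zero hR (le_of_lt hz)
    rw [h.fderiv_eq]
    simp

theorem exists_abs_fderiv_cutoffAt_self_le :
    ∃ C : ℝ, 0 < C ∧ ∀ R : ℝ, 0 < R → ∀ x : 𝔼, |fderiv ℝ (cutoffAt R) x x| ≤ C := by
  obtain ⟨C, hC0, hC⟩ := exists_norm_grad_cutoffAt_le (N := N)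
  refine ⟨2 * C, by positivity, fun R hR x => ?_⟩
  rcases le_or_gt ‖x‖ (2 * R) with h | h
  · calc |fderiv ℝ (cutoffAt R) x x| ≤ ‖fderiv ℝ (cutoffAt R) x‖ * ‖x‖ := by
          rw [← Real.norm_eq_abs]
          exact ContinuousLinearMap.le_opNorm _ _
      _ ≤ C / R * (2 * R) := by
          gcongr
          exact (hC R hR x).2
      _ = 2 * C := by field_simp
  · rw [fderiv_cutoffAt_eq_zero hR (Or.inr h)]
    simpa using hC0.le

theorem continuous_cutoffAt (R : ℝ) : Continuous (cutoffAt R : 𝔼 → ℝ) :=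
  (contDiff_cutoffAt R).continuous

theorem abs_cutoffAt_le_one (R : ℝ) (x : 𝔼) : |cutoffAt R x| ≤ 1 := by
  rw [abs_of_nonneg (cutoffAt_nonneg R x)]
  exact cutoffAt_le_one R x

theorem integrable_cutoffAt_mul {k : 𝔼 → ℝ} (hk : Integrable k volume) (R s : ℝ) :
    Integrable (fun x => cutoffAt R (s • x) * k x) volume := by
  refine hk.mono (((continuous_cutoffAt R).comp
    (continuous_const_smul s)).aestronglyMeasurable.mul hk.1) (Eventually.of_forall fun x => ?_)
  rw [norm_mul]
  exact mul_le_of_le_one_left (norm_nonneg _) (abs_cutoffAt_le_one R _)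

theorem tendsto_integral_cutoffAt_mul {k : 𝔼 → ℝ} (hk : Integrable k volume) :
    Tendsto (fun R : ℝ => ∫ x, cutoffAt R x * k x) atTop (𝓝 (∫ x, k x)) := by
  refine tendsto_integral_filter_of_dominated_convergence (fun x => ‖k x‖)
    (Eventually.of_forall fun R => (continuous_cutoffAt R).aestronglyMeasurable.mul hk.1)
    (Eventually.of_forall fun R => Eventually.of_forall fun x => ?_) hk.norm
    (Eventually.of_forall fun x => ?_)
  · rw [norm_mul]
    exact mul_le_of_le_one_left (norm_nonneg _) (abs_cutoffAt_le_one R _)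
  · refine tendsto_const_nhds.congr' ?_
    filter_upwards [eventually_gt_atTop 0, eventually_ge_atTop ‖x‖] with R hR hx
    rw [cutoffAt_eq_one hR hx, one_mul]

theorem continuous_fderiv_cutoffAt_self (R : ℝ) :
    Continuous fun x : 𝔼 => fderiv ℝ (cutoffAt R) x x :=
  ((contDiff_cutoffAt R).continuous_fderiv (by simp)).clm_apply continuous_id

theorem tendsto_integral_fderiv_cutoffAt_mul {k : 𝔼 → ℝ} (hk : Integrable k volume) :
    Tendsto (fun R : ℝ => ∫ x, fderiv ℝ (cutoffAt R) x x * k x) atTop (𝓝 0) := by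
  obtain ⟨C, hC0, hC⟩ := exists_abs_fderiv_cutoffAt_self_le (N := N)
  rw [← integral_zero 𝔼 ℝ]
  refine tendsto_integral_filter_of_dominated_convergence (fun x => C * ‖k x‖)
    (Eventually.of_forall fun R =>
      (continuous_fderiv_cutoffAt_self R).aestronglyMeasurable.mul hk.1)
    ?_ (hk.norm.const_mul C) (Eventually.of_forall fun x => ?_)
  · filter_upwards [eventually_gt_atTop 0] with R hR
    refine Eventually.of_forall fun x => ?_
    rw [norm_mul]
    gcongr
    exact hC R hR x
  · refine tendsto_const_nhds.congr' ?_
    filter_upwards [eventually_gt_atTop 0, eventually_gt_atTop ‖x‖] with R hR hx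
    rw [fderiv_cutoffAt_eq_zero hR (Or.inl hx)]
    simp

theorem hasDerivAt_integral_cutoffAt_mul {R : ℝ} (hR : 0 < R) {k : 𝔼 → ℝ}
    (hk : Integrable k volume) :
    HasDerivAt (fun s : ℝ => ∫ x, cutoffAt R (s • x) * k x)
      (∫ x, fderiv ℝ (cutoffAt R) x x * k x) 1 := by
  obtain ⟨C, hC0, hC⟩ := exists_abs_fderiv_cutoffAt_self_le (N := N)
  have key := hasDerivAt_integral_of_dominated_loc_of_deriv_le (μ := (volume : Measure 𝔼))
    (F := fun (s : ℝ) x => cutoffAt R (s • x) * k x)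
    (F' := fun (s : ℝ) x => fderiv ℝ (cutoffAt R) (s • x) x * k x)
    (x₀ := 1) (s := Metric.ball 1 (1 / 2)) (bound := fun x => 2 * C * ‖k x‖)
    (Metric.ball_mem_nhds _ (by norm_num))
    (Eventually.of_forall fun s => (integrable_cutoffAt_mul hk R s).1)
    (integrable_cutoffAt_mul hk R 1)
    (by
      simp only [one_smul]
      exact (continuous_fderiv_cutoffAt_self R).aestronglyMeasurable.mul hk.1)
    (Eventually.of_forall fun x s hs => by
      rw [Metric.mem_ball, Real.dist_eq, abs_lt] at hs
      have hs0 : (1 : ℝ) / 2 < s := by linarith [hs.1]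
      have hs' : 0 < s := by linarith
      have h1 : fderiv ℝ (cutoffAt R) (s • x) x
          = s⁻¹ * fderiv ℝ (cutoffAt R) (s • x) (s • x) := by
        rw [map_smul, smul_eq_mul, inv_mul_cancel_left₀ hs'.ne']
      have h2 : s⁻¹ ≤ 2 := by
        rw [inv_le_comm₀ hs' two_pos]; linarith
      rw [norm_mul, h1, norm_mul, Real.norm_of_nonneg (by positivity : 0 ≤ s⁻¹)]
      gcongr
      exact hC R hR _)
    (hk.norm.const_mul _)
    (Eventually.of_forall fun x s _ => by
      have h1 : HasDerivAt (fun s : ℝ => s • x) x s := by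
        simpa using (hasDerivAt_id s).smul_const x
      exact ((((contDiff_cutoffAt R).differentiable (by simp)).differentiableAt
        (x := s • x)).hasFDerivAt.comp_hasDerivAt s h1).mul_const (k x))
  simpa only [one_smul] using key.2

theorem integral_cutoffAt_mul_comp_smul {R a : ℝ} (ha : 0 < a) (k : 𝔼 → ℝ) :
    ∫ x, cutoffAt R x * k (a • x) = (a ^ N)⁻¹ * ∫ x, cutoffAt R (a⁻¹ • x) * k x := by
  have h := integral_comp_affine ha.ne' 0 fun x : 𝔼 => cutoffAt R (a⁻¹ • x) * k x
  rw [abs_of_pos (by positivity), smul_eq_mul] at h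
  rw [← h]
  simp only [add_zero, smul_smul, inv_mul_cancel₀ ha.ne', one_smul]

theorem hasDerivAt_integral_cutoffAt_dilate {R : ℝ} (hR : 0 < R) {k : 𝔼 → ℝ}
    (hk : Integrable k volume) :
    HasDerivAt (fun a : ℝ => ∫ x, cutoffAt R x * k (a • x))
      (-(N * ∫ x, cutoffAt R x * k x) - ∫ x, fderiv ℝ (cutoffAt R) x x * k x) 1 := by
  have h1 : HasDerivAt (fun a : ℝ => ∫ x, cutoffAt R (a⁻¹ • x) * k x)
      ((∫ x, fderiv ℝ (cutoffAt R) x x * k x) * (-((1 : ℝ) ^ 2)⁻¹)) 1 := by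
    have h2 := hasDerivAt_integral_cutoffAt_mul hR hk
    rw [← inv_one (G := ℝ)] at h2
    exact h2.comp 1 (hasDerivAt_inv one_ne_zero)
  have h3 := ((hasDerivAt_pow N (1 : ℝ)).inv (by simp)).mul h1
  have h4 : HasDerivAt (fun a : ℝ => (a ^ N)⁻¹ * ∫ x, cutoffAt R (a⁻¹ • x) * k x)
      (-(N * ∫ x, cutoffAt R x * k x) - ∫ x, fderiv ℝ (cutoffAt R) x x * k x) 1 := by
    refine h3.congr_deriv ?_
    simp
    ring
  refine h4.congr_of_eventuallyEq ?_
  filter_upwards [eventually_gt_nhds one_pos] with a ha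
  exact integral_cutoffAt_mul_comp_smul ha k

/-- A function that is minimal at `x` up to an error `e |t| + O(t²)` has a derivative of size at
most `e`. -/
theorem abs_le_of_hasDerivAt_of_le {f : ℝ → ℝ} {x f' K e δ : ℝ} (hδ : 0 < δ)
    (hf : HasDerivAt f f' x)
    (h : ∀ t : ℝ, |t| ≤ δ → 0 ≤ f (x + t) - f x + K * t ^ 2 + |t| * e) : |f'| ≤ e := by
  have key : ∀ {f : ℝ → ℝ} {x f' : ℝ}, HasDerivAt f f' x →
      (∀ t : ℝ, |t| ≤ δ → 0 ≤ f (x + t) - f x + K * t ^ 2 + |t| * e) → -e ≤ f' := by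
    intro f x f' hf h
    have l1 := hf.tendsto_slope_zero_right
    have l2 : Tendsto (fun t : ℝ => -e - K * t) (𝓝[>] 0) (𝓝 (-e)) := by
      have : Continuous fun t : ℝ => -e - K * t := by fun_prop
      simpa using (this.tendsto 0).mono_left nhdsWithin_le_nhds
    refine le_of_tendsto_of_tendsto l2 l1 ?_
    filter_upwards [Ioc_mem_nhdsGT hδ] with t ht
    have h1 := h t (by rw [abs_of_pos ht.1]; exact ht.2)
    rw [abs_of_pos ht.1] at h1
    rw [smul_eq_mul, le_inv_mul_iff₀ ht.1]
    linarith
  refine abs_le.2 ⟨key hf h, ?_⟩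
  have hf2 : HasDerivAt (fun t => f (-t)) (-f') (-x) := by
    have h1 : HasDerivAt f f' (-(-x)) := by rwa [neg_neg]
    have := h1.comp (-x) (hasDerivAt_neg (-x))
    exact this.congr_deriv (by ring)
  have := key hf2 fun t ht => by
    have := h (-t) (by rwa [abs_neg])
    rw [abs_neg, neg_sq] at this
    simpa [add_comm] using this
  linarith

end DilatedCutoffs

section Pohozaev

variable {𝕜 : Type*} [RCLike 𝕜] {N : ℕ}

local notation "𝔼" => EuclideanSpace ℝ (Fin N)
local notation "𝔾" => EuclideanSpace 𝕜 (Fin N)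

/-! ### The Pohozaev identity of a solution, for `p < q` -/

theorem HasSobGrad.integral_affine_sub_sq_le {u : 𝔼 → 𝕜} {g : 𝔼 → 𝔾} (hu : HasSobGrad u g) {τ : ℝ}
    (hτ : |τ| ≤ 1 / 2) {A : Set 𝔼} (hA : MeasurableSet A) {d : ℝ} (hd0 : 0 ≤ d)
    (hd : ∀ x ∈ A, ‖τ • x‖ ≤ d) :
    ∫ x in A, ‖u ((1 + τ) • x) - u x‖ ^ 2 ≤ d ^ 2 * (2 ^ N) ^ 2 * ∫ x, ‖g x‖ ^ 2 := by
  have ha : 1 + τ ≠ 0 := by linarith [neg_abs_le τ]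
  have h := hu.eLpNorm_affine_sub_le hτ 0 hA (d := d) (by simpa using hd)
  have hm : MemLp (fun x => u ((1 + τ) • x + 0) - u x) 2 (volume.restrict A) :=
    ((memLp_comp_affine ha 0 hu.memLp).sub hu.memLp).restrict A
  simp only [add_zero] at h hm
  have h2 := pow_le_pow_left' h 2
  rw [eLpNorm_two_eq_ofReal hm, mul_pow, mul_pow, eLpNorm_two_eq_ofReal hu.memLp_grad,
    show ((2 : ENNReal) ^ N) ^ 2 = ENNReal.ofReal ((2 ^ N) ^ 2) by
      rw [ENNReal.ofReal_pow (by positivity), ENNReal.ofReal_pow (by positivity)]; simp,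
    ← ENNReal.ofReal_pow hd0, ← ENNReal.ofReal_mul (by positivity),
    ← ENNReal.ofReal_mul (by positivity),
    ENNReal.ofReal_le_ofReal_iff (by have : 0 ≤ ∫ x, ‖g x‖ ^ 2 := by positivity
                                     positivity)] at h2
  linarith

/-- A weak solution may be tested with functions in place of classes. -/
theorem IsWeakSolution.integral_test (hN : 3 ≤ N) {p q μ lam : ℝ}
    (hp : p ∈ Set.Ioo 2 (critExp N)) (hq : q ∈ Set.Ioo 2 (critExp N)) {w : H1 𝕜 N}
    (hws : IsWeakSolution p q μ lam w) {φ : 𝔼 → 𝕜} {h : 𝔼 → 𝔾} (hφ : HasSobGrad φ h) :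
    Integrable (fun x => inner ℝ (h x) (grad w x) - lam * inner ℝ (φ x) (val w x)
      - μ * (‖val w x‖ ^ (p - 2) * inner ℝ (φ x) (val w x))
      + ‖val w x‖ ^ (q - 2) * inner ℝ (φ x) (val w x)) volume ∧
    ∫ x, (inner ℝ (h x) (grad w x) - lam * inner ℝ (φ x) (val w x)
      - μ * (‖val w x‖ ^ (p - 2) * inner ℝ (φ x) (val w x))
      + ‖val w x‖ ^ (q - 2) * inner ℝ (φ x) (val w x)) = 0 := by
  have hu := hasSobGrad_val w
  refine ⟨(((integrable_inner_of_memLp hφ.memLp_grad hu.memLp_grad).sub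
    ((integrable_inner_of_memLp hφ.memLp hu.memLp).const_mul lam)).sub
    ((hu.integrable_powPair hN hp hφ).const_mul μ)).add (hu.integrable_powPair hN hq hφ), ?_⟩
  have h1 := hws hφ.toH1
  simp only [re_inner_eq_real_inner, re_inner_eq_real_inner_vec] at h1
  rw [← h1]
  refine integral_congr_ae ?_
  filter_upwards [hφ.val_toH1, hφ.grad_toH1] with x hx1 hx2
  rw [hx1, hx2]

/-- The action of the dilate `x ↦ w (a x)`, with its density `½ |∇w|² - potential w` localized by
the cutoff at radius `R`. -/
noncomputable def localAction (p q μ lam R a : ℝ) (w : H1 𝕜 N) : ℝ :=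
  ∫ x, cutoffAt R x * (1 / 2 * ‖a • grad w (a • x)‖ ^ 2 - potential p q μ lam (val w (a • x)))

theorem integrable_potential (hN : 3 ≤ N) {p q μ lam : ℝ}
    (hp : p ∈ Set.Ioo 2 (critExp N)) (hq : q ∈ Set.Ioo 2 (critExp N)) {u : 𝔼 → 𝕜} {g : 𝔼 → 𝔾}
    (hu : HasSobGrad u g) : Integrable (fun x => potential p q μ lam (u x)) volume :=
  (((integrable_norm_sq hu.memLp).const_mul _).add ((hu.integrable_rpow hN hp).const_mul _)).sub
    ((hu.integrable_rpow hN hq).const_mul _)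

theorem integral_potential (hN : 3 ≤ N) {p q μ lam : ℝ}
    (hp : p ∈ Set.Ioo 2 (critExp N)) (hq : q ∈ Set.Ioo 2 (critExp N)) (w : H1 𝕜 N) :
    ∫ x, potential p q μ lam (val w x)
      = lam / 2 * sqInt w + μ / p * powInt p w - 1 / q * powInt q w := by
  have hu := hasSobGrad_val w
  have i1 := (integrable_norm_sq hu.memLp).const_mul (lam / 2)
  have i2 := (hu.integrable_rpow hN hp).const_mul (μ / p)
  have i3 := (hu.integrable_rpow hN hq).const_mul (1 / q)
  have i12 : Integrable (fun x => lam / 2 * ‖val w x‖ ^ 2 + μ / p * ‖val w x‖ ^ p) volume :=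
    i1.add i2
  simp only [potential]
  rw [integral_sub i12 i3, integral_add i1 i2, integral_const_mul, integral_const_mul,
    integral_const_mul]
  rfl

/-- A weak solution tested with the localized increment `χ (w((1 + τ) ·) - w)`. By convexity of
`|∇w|²` and semiconcavity of the potential, the localized action changes at first order in `τ`
by no more than the error due to the gradient of the cutoff, which is controlled by the Dirichlet
energy outside a large ball. -/
theorem IsWeakSolution.localAction_dilate_ge (hN : 3 ≤ N) {p q μ lam : ℝ}
    (hp : p ∈ Set.Ioo 2 (critExp N)) (hq : q ∈ Set.Ioo 2 (critExp N)) (hpq : p < q) (hμ : 0 < μ)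
    {w : H1 𝕜 N} (hws : IsWeakSolution p q μ lam w) :
    ∃ K₁ K₂ K₃ : ℝ, ∀ R : ℝ, 0 < R → ∀ η : ℝ, 0 < η → ∀ τ : ℝ, |τ| ≤ 1 / 2 →
      0 ≤ localAction p q μ lam R (1 + τ) w - localAction p q μ lam R 1 w
        + K₁ * R ^ 2 * τ ^ 2
        + |τ| * (K₂ / η + K₃ * η * ∫ x, (1 - cutoffAt (R / 2) x) * ‖grad w x‖ ^ 2) := by
  obtain ⟨B, hB0, hB⟩ := exists_potential_semiconcave (𝕜 := 𝕜) hp.1 hpq hμ lam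
  obtain ⟨C, hC0, hC⟩ := exists_norm_grad_cutoffAt_le (N := N)
  have hu := hasSobGrad_val w
  set u := val w
  set g := grad w
  refine ⟨B * (4 * (2 ^ N) ^ 2 * dirichlet w), 2 * C * (2 ^ N) ^ 2 * dirichlet w, C / 2,
    fun R hR η hη τ hτ => ?_⟩
  rcases eq_or_ne τ 0 with rfl | hτ0
  · simp
  have hτp : 0 < |τ| := abs_pos.2 hτ0
  set a := 1 + τ with ha
  have ha0 : a ≠ 0 := by linarith [neg_abs_le τ]
  have hU : HasSobGrad (fun x => u (a • x)) (fun x => a • g (a • x)) := by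
    simpa using hu.comp_affine ha0 0
  have hd := hU.sub hu
  have hφ := hd.cutoff (contDiff_cutoffAt R) (hasCompactSupport_cutoffAt hR)
  obtain ⟨iI, hI⟩ := hws.integral_test hN hp hq hφ
  -- the parameter of Young's inequality in the cutoff error
  set s := R * |τ| * η with hs
  have hs0 : 0 < s := by positivity
  set A : Set 𝔼 := Metric.closedBall 0 (2 * R) with hA
  have hAm : MeasurableSet A := measurableSet_closedBall
  -- integrability of the terms of the upper bound
  have ik : ∀ {v : 𝔼 → 𝕜} {h : 𝔼 → 𝔾}, HasSobGrad v h → Integrable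
      (fun x => cutoffAt R x * (1 / 2 * ‖h x‖ ^ 2 - potential p q μ lam (v x))) volume := by
    intro v h hv
    have := integrable_cutoffAt_mul (((integrable_norm_sq hv.memLp_grad).const_mul (1 / 2)).sub
      (integrable_potential (μ := μ) (lam := lam) hN hp hq hv)) R 1
    simpa using this
  have i1 := ik hU
  have i2 := ik hu
  have i3 : Integrable (A.indicator fun x => ‖u (a • x) - u x‖ ^ 2) volume :=
    (integrable_norm_sq hd.memLp).indicator hAm
  have i4 : Integrable (fun x => (1 - cutoffAt (R / 2) x) * ‖g x‖ ^ 2) volume := by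
    have h1 := integrable_norm_sq hu.memLp_grad
    have h2 := h1.sub (integrable_cutoffAt_mul h1 (R / 2) 1)
    refine h2.congr (Eventually.of_forall fun x => ?_)
    simp only [Pi.sub_apply, one_smul]
    ring
  have i3' := i3.const_mul (B + C / R / (2 * s))
  have i4' := i4.const_mul (C / R * (s / 2))
  have i12 : Integrable (fun x =>
      cutoffAt R x * (1 / 2 * ‖a • g (a • x)‖ ^ 2 - potential p q μ lam (u (a • x)))
      - cutoffAt R x * (1 / 2 * ‖g x‖ ^ 2 - potential p q μ lam (u x))) volume := i1.sub i2
  have i123 : Integrable (fun x =>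
      cutoffAt R x * (1 / 2 * ‖a • g (a • x)‖ ^ 2 - potential p q μ lam (u (a • x)))
      - cutoffAt R x * (1 / 2 * ‖g x‖ ^ 2 - potential p q μ lam (u x))
      + (B + C / R / (2 * s)) * A.indicator (fun x => ‖u (a • x) - u x‖ ^ 2) x) volume :=
    i12.add i3'
  have hle := integral_mono (g := fun x =>
      cutoffAt R x * (1 / 2 * ‖a • g (a • x)‖ ^ 2 - potential p q μ lam (u (a • x)))
      - cutoffAt R x * (1 / 2 * ‖g x‖ ^ 2 - potential p q μ lam (u x))
      + (B + C / R / (2 * s)) * A.indicator (fun x => ‖u (a • x) - u x‖ ^ 2) x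
      + C / R * (s / 2) * ((1 - cutoffAt (R / 2) x) * ‖g x‖ ^ 2)) iI (i123.add i4') (fun x => by
    have h1 := hB (u x) (u (a • x))
    set d := u (a • x) - u x with hdx
    set c := cutoffAt R x with hc
    have hc0 : 0 ≤ c := cutoffAt_nonneg R x
    have hc1 : c ≤ 1 := cutoffAt_le_one R x
    set v : 𝔾 := vecSmul (classicalGrad (cutoffAt R) x) d with hv
    have h2 : inner ℝ (a • g (a • x) - g x) (g x)
        ≤ 1 / 2 * ‖a • g (a • x)‖ ^ 2 - 1 / 2 * ‖g x‖ ^ 2 := by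
      have e1 := norm_sub_sq_real (a • g (a • x)) (g x)
      have e2 := sq_nonneg ‖a • g (a • x) - g x‖
      rw [inner_sub_left, real_inner_self_eq_norm_sq]
      linarith
    have h3 : c * inner ℝ (a • g (a • x) - g x) (g x)
        ≤ c * (1 / 2 * ‖a • g (a • x)‖ ^ 2 - 1 / 2 * ‖g x‖ ^ 2) := by gcongr
    have h4 := mul_le_mul_of_nonneg_left h1 hc0
    -- the last two terms vanish unless `x` lies in the relevant ball or annulus
    have h5 : c * (B * ‖d‖ ^ 2) ≤ B * A.indicator (fun x => ‖u (a • x) - u x‖ ^ 2) x := by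
      by_cases hx : x ∈ A
      · rw [Set.indicator_of_mem hx]
        exact mul_le_of_le_one_left (by positivity) hc1
      · rw [Set.indicator_of_notMem hx, hc, cutoffAt_eq_zero hR, zero_mul, mul_zero]
        rw [hA, mem_closedBall_zero_iff, not_le] at hx
        exact hx.le
    have h6 : inner ℝ v (g x) ≤ C / R / (2 * s) * A.indicator (fun x => ‖u (a • x) - u x‖ ^ 2) x
        + C / R * (s / 2) * ((1 - cutoffAt (R / 2) x) * ‖g x‖ ^ 2) := by
      have hn1 : 0 ≤ A.indicator (fun x => ‖u (a • x) - u x‖ ^ 2) x :=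
        Set.indicator_nonneg (fun _ _ => by positivity) x
      have hn2 : 0 ≤ 1 - cutoffAt (R / 2) x := sub_nonneg.2 (cutoffAt_le_one _ _)
      by_cases hx : ‖x‖ < R ∨ 2 * R < ‖x‖
      · have hz : classicalGrad (cutoffAt R) x = (0 : 𝔼) := by
          ext i
          simp [classicalGrad, fderiv_cutoffAt_eq_zero hR hx]
        have hv0 : v = 0 := by
          rw [← norm_eq_zero, hv, norm_vecSmul, hz, norm_zero, zero_mul]
        rw [hv0, inner_zero_left]
        positivity
      · push Not at hx
        have hxA : x ∈ A := by
          rw [hA, mem_closedBall_zero_iff]; exact hx.2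
        rw [Set.indicator_of_mem hxA, cutoffAt_eq_zero (half_pos hR) (by linarith [hx.1]), sub_zero,
          one_mul]
        have hCR : 0 < C / R := by positivity
        calc inner ℝ v (g x) ≤ ‖v‖ * ‖g x‖ := real_inner_le_norm _ _
          _ = ‖classicalGrad (cutoffAt R) x‖ * (‖d‖ * ‖g x‖) := by rw [hv, norm_vecSmul, mul_assoc]
          _ ≤ C / R * (‖d‖ ^ 2 / (2 * s) + s / 2 * ‖g x‖ ^ 2) := by
              gcongr
              · exact (hC R hR x).1
              · have e : ‖d‖ ^ 2 / (2 * s) + s / 2 * ‖g x‖ ^ 2 - ‖d‖ * ‖g x‖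
                    = (‖d‖ - s * ‖g x‖) ^ 2 / (2 * s) := by
                  field_simp
                  ring
                have : 0 ≤ (‖d‖ - s * ‖g x‖) ^ 2 / (2 * s) := by positivity
                linarith
          _ = _ := by ring
    simp only [inner_add_left, real_inner_smul_left]
    linarith)
  rw [hI, integral_add i123 i4', integral_add i12 i3', integral_sub i1 i2, integral_const_mul,
    integral_const_mul, integral_indicator hAm] at hle
  have hD := hu.integral_affine_sub_sq_le hτ hAm (d := 2 * R * |τ|) (by positivity) fun x hx => by
    rw [hA, mem_closedBall_zero_iff] at hx
    rw [norm_smul, Real.norm_eq_abs, mul_comm]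
    gcongr
  have hD2 := mul_le_mul_of_nonneg_left hD (by positivity : 0 ≤ B + C / R / (2 * s))
  have eD : (B + C / R / (2 * s)) * ((2 * R * |τ|) ^ 2 * (2 ^ N) ^ 2 * ∫ x, ‖g x‖ ^ 2)
      = B * (4 * (2 ^ N) ^ 2 * dirichlet w) * R ^ 2 * τ ^ 2
        + |τ| * (2 * C * (2 ^ N) ^ 2 * dirichlet w / η) := by
    rw [← sq_abs τ, hs, show (∫ x, ‖g x‖ ^ 2) = dirichlet w from rfl]
    field_simp
    ring
  have eG : C / R * (s / 2) = |τ| * (C / 2 * η) := by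
    rw [hs]; field_simp
  have e1 : localAction p q μ lam R 1 w = ∫ x, cutoffAt R x * (1 / 2 * ‖g x‖ ^ 2
      - potential p q μ lam (u x)) := by
    simp only [localAction, one_smul]
    rfl
  rw [e1]
  rw [eD] at hD2
  rw [eG] at hle
  change 0 ≤ localAction p q μ lam R a w - _ + _ + _ at hle
  linarith

theorem hasDerivAt_localAction (hN : 3 ≤ N) {p q μ lam : ℝ}
    (hp : p ∈ Set.Ioo 2 (critExp N)) (hq : q ∈ Set.Ioo 2 (critExp N)) (w : H1 𝕜 N) {R : ℝ}
    (hR : 0 < R) :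
    HasDerivAt (fun a => localAction p q μ lam R a w)
      (2 * (∫ x, cutoffAt R x * (1 / 2 * ‖grad w x‖ ^ 2))
        - N * (∫ x, cutoffAt R x * (1 / 2 * ‖grad w x‖ ^ 2))
        - (∫ x, fderiv ℝ (cutoffAt R) x x * (1 / 2 * ‖grad w x‖ ^ 2))
        + N * (∫ x, cutoffAt R x * potential p q μ lam (val w x))
        + ∫ x, fderiv ℝ (cutoffAt R) x x * potential p q μ lam (val w x)) 1 := by
  have hu := hasSobGrad_val w
  have k1 := (integrable_norm_sq hu.memLp_grad).const_mul (1 / 2)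
  have k2 := integrable_potential (μ := μ) (lam := lam) hN hp hq hu
  have h1 := (hasDerivAt_pow 2 (1 : ℝ)).mul (hasDerivAt_integral_cutoffAt_dilate hR k1)
  have h2 := h1.sub (hasDerivAt_integral_cutoffAt_dilate hR k2)
  have h3 : HasDerivAt (fun a : ℝ => a ^ 2 * (∫ x, cutoffAt R x * (1 / 2 * ‖grad w (a • x)‖ ^ 2))
      - ∫ x, cutoffAt R x * potential p q μ lam (val w (a • x))) _ 1 := h2
  refine (h3.congr_of_eventuallyEq ?_).congr_deriv ?_
  · filter_upwards [eventually_gt_nhds one_pos] with a ha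
    have hU : HasSobGrad (fun x => val w (a • x)) (fun x => a • grad w (a • x)) := by
      simpa using hu.comp_affine ha.ne' 0
    have i1 := integrable_cutoffAt_mul
      ((integrable_norm_sq hU.memLp_grad).const_mul (1 / 2)) R 1
    have i2 := integrable_cutoffAt_mul
      (integrable_potential (μ := μ) (lam := lam) hN hp hq hU) R 1
    simp only [one_smul] at i1 i2
    simp only [localAction, mul_sub]
    rw [integral_sub i1 i2, ← integral_const_mul]
    congr 2
    ext x
    rw [norm_smul, mul_pow, Real.norm_eq_abs, sq_abs]
    ring
  · simp only [one_smul, one_pow]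
    push_cast
    ring

/-- The Pohozaev identity. The derivative of the localized action under dilations is bounded by the
cutoff error; as `R → ∞`, and then `η → ∞`, the derivative tends to the defect of the identity, and
the bound to zero. -/
theorem IsWeakSolution.pohozaev (hN : 3 ≤ N) {p q μ lam : ℝ}
    (hp : p ∈ Set.Ioo 2 (critExp N)) (hq : q ∈ Set.Ioo 2 (critExp N)) (hpq : p < q) (hμ : 0 < μ)
    {w : H1 𝕜 N} (hws : IsWeakSolution p q μ lam w) :
    dirichlet w = sobExp N * (lam * sqInt w + μ * (2 / p) * powInt p w
      - 2 / q * powInt q w) := by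
  obtain ⟨K₁, K₂, K₃, hK⟩ := hws.localAction_dilate_ge hN hp hq hpq hμ
  have hu := hasSobGrad_val w
  have k0 := integrable_norm_sq hu.memLp_grad
  have k1 := k0.const_mul (1 / 2)
  have k2 := integrable_potential (μ := μ) (lam := lam) hN hp hq hu
  set T := dirichlet w with hT
  set V := ∫ x, potential p q μ lam (val w x) with hV
  have l1 := tendsto_integral_cutoffAt_mul k1
  have l2 := tendsto_integral_cutoffAt_mul k2
  have l3 := tendsto_integral_fderiv_cutoffAt_mul k1
  have l4 := tendsto_integral_fderiv_cutoffAt_mul k2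
  have l5 : Tendsto (fun R : ℝ => ∫ x, (1 - cutoffAt (R / 2) x) * ‖grad w x‖ ^ 2) atTop (𝓝 0) := by
    have h1 := ((tendsto_integral_cutoffAt_mul k0).comp
      (tendsto_id.atTop_div_const two_pos)).const_sub (∫ x, ‖grad w x‖ ^ 2)
    rw [sub_self] at h1
    refine h1.congr fun R => ?_
    have i2 := integrable_cutoffAt_mul k0 (R / 2) 1
    simp only [one_smul] at i2
    rw [Function.comp_apply, id, ← integral_sub k0 i2]
    congr 1
    ext x
    ring
  have hlim := (((((l1.const_mul 2).sub (l1.const_mul (N : ℝ))).sub l3).add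
    (l2.const_mul (N : ℝ))).add l4).abs
  have hbound : ∀ η : ℝ, 0 < η → |2 * (∫ x, 1 / 2 * ‖grad w x‖ ^ 2)
      - N * (∫ x, 1 / 2 * ‖grad w x‖ ^ 2) - 0 + N * V + 0| ≤ K₂ / η := by
    intro η hη
    have l6 := (l5.const_mul (K₃ * η)).const_add (K₂ / η)
    rw [mul_zero, add_zero] at l6
    refine le_of_tendsto_of_tendsto hlim l6 ?_
    filter_upwards [eventually_gt_atTop 0] with R hR
    exact abs_le_of_hasDerivAt_of_le (by norm_num) (hasDerivAt_localAction hN hp hq w hR)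
      (hK R hR η hη)
  have hzero : |2 * (∫ x, 1 / 2 * ‖grad w x‖ ^ 2)
      - N * (∫ x, 1 / 2 * ‖grad w x‖ ^ 2) - 0 + N * V + 0| ≤ 0 :=
    ge_of_tendsto (tendsto_const_nhds.div_atTop tendsto_id)
      ((eventually_gt_atTop 0).mono hbound)
  rw [abs_nonpos_iff, integral_const_mul, show (∫ x, ‖grad w x‖ ^ 2) = T from rfl, hV,
    integral_potential hN hp hq] at hzero
  have h3 : (3 : ℝ) ≤ N := by exact_mod_cast hN
  have h2 : (N : ℝ) - 2 ≠ 0 := by linarith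
  rw [sobExp, div_mul_eq_mul_div, eq_div_iff h2]
  linear_combination -2 * hzero

/-- Below the action of a solution there is a function that satisfies the Pohozaev identity: the
solution itself or, if `q ≤ p`, a multiple of it. -/
theorem exists_pohozaev (hN : 3 ≤ N) {p q μ lam : ℝ}
    (hp : p ∈ Set.Ioo 2 (critExp N)) (hq : q ∈ Set.Ioo 2 (critExp N)) (hμ : 0 < μ)
    (hlam : lam < 0) {w : H1 𝕜 N} (hw : w ≠ 0) (hws : IsWeakSolution p q μ lam w) :
    ∃ v : H1 𝕜 N, v ≠ 0 ∧ dirichlet v = sobExp N * (lam * sqInt v + μ * (2 / p) * powInt p v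
      - 2 / q * powInt q v) ∧ action p q μ lam v ≤ action p q μ lam w := by
  rcases lt_or_ge p q with hpq | hqp
  · exact ⟨w, hw, hws.pohozaev hN hp hq hpq hμ, le_rfl⟩
  · obtain ⟨t, ht, h⟩ := exists_smul_pohozaev hN hp hq hqp hμ hlam hw hws
    exact ⟨t • w, smul_ne_zero ht.ne' hw, h, action_smul_le hN hp hq hqp hlam hws ht.le⟩

end Pohozaev

section Comparison

variable {𝕜 : Type*} [RCLike 𝕜] {N : ℕ}

/-! ### The correspondence -/

theorem action_eq_of_pohozaev (hN : 3 ≤ N) {p q μ lam : ℝ} {v : H1 𝕜 N}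
    (hv : dirichlet v = sobExp N * (lam * sqInt v + μ * (2 / p) * powInt p v
      - 2 / q * powInt q v)) : action p q μ lam v = dirichlet v / N := by
  have hκ0 : sobExp N ≠ 0 := by linarith [one_lt_sobExp hN]
  have h1 := two_mul_action_eq (p := p) (q := q) (μ := μ) (ℓ := lam) 0 v
  have e1 : gap p q μ 0 lam v = -(dirichlet v * (sobExp N)⁻¹) := by
    rw [gap, eq_neg_iff_add_eq_zero]
    conv_lhs => enter [2, 1]; rw [hv]
    field_simp
    ring
  have h2 : 2 * action p q μ lam v = dirichlet v * (1 - (sobExp N)⁻¹) := by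
    rw [h1, e1]; ring
  rw [one_sub_inv_sobExp hN] at h2
  linarith [show dirichlet v * (2 / (N : ℝ)) = 2 * (dirichlet v / N) by ring]

/-- For a function that satisfies the Pohozaev identity, the sign of the gap compares its action
with `S`. -/
theorem gap_eq_of_pohozaev (hN : 3 ≤ N) {p q μ lam S : ℝ} {v : H1 𝕜 N} (hv0 : v ≠ 0)
    (hv : dirichlet v = sobExp N * (lam * sqInt v + μ * (2 / p) * powInt p v
      - 2 / q * powInt q v)) :
    gap p q μ (cNS N S) lam v = dirichlet v / sobExp N
      * (cNS N S * sobExp N * (N * action p q μ lam v) ^ (sobExp N - 1) - 1) := by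
  have h3 : (N : ℝ) ≠ 0 := by
    have : (3 : ℝ) ≤ N := by exact_mod_cast hN
    linarith
  have hκ0 : sobExp N ≠ 0 := by linarith [one_lt_sobExp hN]
  have hT := dirichlet_pos hN hv0
  rw [action_eq_of_pohozaev hN hv, mul_div_cancel₀ _ h3, Real.rpow_sub_one hT.ne', gap]
  have e : dirichlet v / sobExp N
      = lam * sqInt v + μ * (2 / p) * powInt p v - 2 / q * powInt q v := by
    rw [div_eq_iff hκ0, mul_comm]
    exact hv
  have e2 : dirichlet v / sobExp N
      * (cNS N S * sobExp N * (dirichlet v ^ sobExp N / dirichlet v) - 1)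
      = cNS N S * dirichlet v ^ sobExp N - dirichlet v / sobExp N := by
    field_simp
  rw [e2, e]
  ring

theorem gap_neg_of_pohozaev (hN : 3 ≤ N) {p q μ lam S : ℝ} (hS : 0 < S) {v : H1 𝕜 N} (hv0 : v ≠ 0)
    (hv : dirichlet v = sobExp N * (lam * sqInt v + μ * (2 / p) * powInt p v
      - 2 / q * powInt q v)) (h : action p q μ lam v < S) : gap p q μ (cNS N S) lam v < 0 := by
  have hN0 : (0 : ℝ) < N := by
    have : (3 : ℝ) ≤ N := by exact_mod_cast hN
    linarith
  have hκ := one_lt_sobExp hN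
  have hT := dirichlet_pos hN hv0
  have ha : 0 < action p q μ lam v := by
    rw [action_eq_of_pohozaev hN hv]; positivity
  rw [gap_eq_of_pohozaev hN hv0 hv]
  refine mul_neg_of_pos_of_neg (by positivity) (sub_neg.2 ?_)
  have hc := cNS_pos hN hS
  refine lt_of_lt_of_eq (mul_lt_mul_of_pos_left (Real.rpow_lt_rpow (by positivity) ?_
    (by linarith)) (by positivity)) (cNS_mul hN hS)
  gcongr

theorem gap_eq_zero_of_pohozaev (hN : 3 ≤ N) {p q μ lam S : ℝ} (hS : 0 < S) {v : H1 𝕜 N}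
    (hv0 : v ≠ 0)
    (hv : dirichlet v = sobExp N * (lam * sqInt v + μ * (2 / p) * powInt p v
      - 2 / q * powInt q v)) (h : action p q μ lam v = S) : gap p q μ (cNS N S) lam v = 0 := by
  rw [gap_eq_of_pohozaev hN hv0 hv, h, cNS_mul hN hS, sub_self, mul_zero]

theorem action_pos_of_pohozaev (hN : 3 ≤ N) {p q μ lam : ℝ} {v : H1 𝕜 N} (hv0 : v ≠ 0)
    (hv : dirichlet v = sobExp N * (lam * sqInt v + μ * (2 / p) * powInt p v
      - 2 / q * powInt q v)) : 0 < action p q μ lam v := by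
  have hN0 : (0 : ℝ) < N := by
    have : (3 : ℝ) ≤ N := by exact_mod_cast hN
    linarith
  rw [action_eq_of_pohozaev hN hv]
  have := dirichlet_pos hN hv0
  positivity

/-- The nonlinear Rayleigh quotient at the action of a solution takes a value that is at most its
frequency. -/
theorem exists_gap_nonpos_of_isWeakSolution (hN : 3 ≤ N) {p q μ lam S : ℝ}
    (hp : p ∈ Set.Ioo 2 (critExp N)) (hq : q ∈ Set.Ioo 2 (critExp N)) (hμ : 0 < μ) (hS : 0 < S)
    (hlam : lam < 0) {w : H1 𝕜 N} (hw : w ≠ 0) (hws : IsWeakSolution p q μ lam w)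
    (hwS : action p q μ lam w ≤ S) :
    ∃ v : H1 𝕜 N, v ≠ 0 ∧ gap p q μ (cNS N S) lam v ≤ 0 ∧
      (action p q μ lam w < S → gap p q μ (cNS N S) lam v < 0) := by
  obtain ⟨v, hv0, hv, hvw⟩ := exists_pohozaev hN hp hq hμ hlam hw hws
  refine ⟨v, hv0, ?_, fun h => gap_neg_of_pohozaev hN hS hv0 hv (hvw.trans_lt h)⟩
  rcases (hvw.trans hwS).lt_or_eq with h | h
  · exact (gap_neg_of_pohozaev hN hS hv0 hv h).le
  · exact (gap_eq_zero_of_pohozaev hN hS hv0 hv h).le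

theorem isGroundState_of_fundamental (hN : 3 ≤ N) {p q μ S lam : ℝ}
    (hp : p ∈ Set.Ioo 2 (critExp N)) (hq : q ∈ Set.Ioo 2 (critExp N)) (hμ : 0 < μ) (hS : 0 < S)
    (hlam : lam < 0) {u : H1 𝕜 N} (h : IsFundamentalFrequencySolution p q μ S lam u) :
    IsGroundState p q μ lam u ∧ action p q μ lam u = S := by
  obtain ⟨hu, hus, hul, hmin⟩ := h
  have huS : action p q μ lam u = S := (action_eq_iff_rayleigh_eq hu).2 hul
  refine ⟨⟨hu, hus, fun w hw hwc => ?_⟩, huS⟩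
  rw [huS]
  by_contra! hlt
  rw [isCriticalPoint_action_iff hN hp hq] at hwc
  obtain ⟨v, -, -, hv⟩ := exists_gap_nonpos_of_isWeakSolution hN hp hq hμ hS hlam hw hwc hlt.le
  obtain ⟨ℓ, w', hℓ, hw', hws', hwS'⟩ :=
    exists_solution_lower_frequency hN hp hq hμ hS hlam (hv hlt)
  have e : ℓ = rayleigh p q μ S w' := (action_eq_iff_rayleigh_eq hw').1 hwS'
  have := hmin w' hw' ((isCriticalPoint_rayleigh_iff hN hp hq hw').2 (e ▸ hws'))
  linarith

/-- At the action of a ground state, the frequency bounds the nonlinear Rayleigh quotient from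
below. -/
theorem IsGroundState.gap_nonneg (hN : 3 ≤ N) {p q μ lam : ℝ}
    (hp : p ∈ Set.Ioo 2 (critExp N)) (hq : q ∈ Set.Ioo 2 (critExp N)) (hμ : 0 < μ)
    (hlam : lam < 0) {u : H1 𝕜 N} (h : IsGroundState p q μ lam u)
    (hS : 0 < action p q μ lam u) (v : H1 𝕜 N) :
    0 ≤ gap p q μ (cNS N (action p q μ lam u)) lam v := by
  by_contra! hv
  obtain ⟨w, hw, hws, hlt⟩ := exists_solution_lower_action hN hp hq hμ hS hlam hv
  exact absurd (h.2.2 w hw ((isCriticalPoint_action_iff hN hp hq).2 hws)) (not_le.2 hlt)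

theorem IsGroundState.fundamental (hN : 3 ≤ N) {p q μ lam : ℝ}
    (hp : p ∈ Set.Ioo 2 (critExp N)) (hq : q ∈ Set.Ioo 2 (critExp N)) (hμ : 0 < μ)
    (hlam : lam < 0) {u : H1 𝕜 N} (h : IsGroundState p q μ lam u) :
    0 < action p q μ lam u ∧
      IsFundamentalFrequencySolution p q μ (action p q μ lam u) lam u ∧
      IsLeast (ngRayleigh p q μ (action p q μ lam u) '' {v : H1 𝕜 N | v ≠ 0}) lam := by
  obtain ⟨hu, hus, -⟩ := id h
  have hS : 0 < action p q μ lam u := by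
    obtain ⟨v, hv0, hv, hvu⟩ := exists_pohozaev hN hp hq hμ hlam hu hus
    exact (action_pos_of_pohozaev hN hv0 hv).trans_le hvu
  have hgap := h.gap_nonneg hN hp hq hμ hlam hS
  refine ⟨hS, ⟨hu, hus, (action_eq_iff_rayleigh_eq hu).1 rfl, fun w hw hwc => ?_⟩, ?_, ?_⟩
  · by_contra! hlt
    rw [isCriticalPoint_rayleigh_iff hN hp hq hw] at hwc
    obtain ⟨v, hv0, hv, -⟩ := exists_gap_nonpos_of_isWeakSolution hN hp hq hμ hS (hlt.trans hlam)
      hw hwc ((action_eq_iff_rayleigh_eq hw).2 rfl).le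
    -- the gap decreases strictly with the frequency
    have h1 := hgap v
    have h2 := sqInt_pos hv0
    rw [gap] at hv h1
    nlinarith
  · obtain ⟨v, hv0, hv, -⟩ := exists_gap_nonpos_of_isWeakSolution hN hp hq hμ hS hlam hu hus le_rfl
    exact ⟨v, hv0, (ngRayleigh_eq_iff hv0).2 (le_antisymm hv (hgap v))⟩
  · rintro _ ⟨v, hv0, rfl⟩
    exact (le_ngRayleigh_iff hv0).2 (hgap v)

end Comparison

end NLS

theorem mainTheorem5 {𝕜 : Type*} [RCLike 𝕜] {N : ℕ} (hN : 3 ≤ N) {p q μ : ℝ}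
    (hp : p ∈ Set.Ioo 2 (NLS.critExp N)) (hq : q ∈ Set.Ioo 2 (NLS.critExp N)) (hμ : 0 < μ) :
    (∀ S lam : ℝ, 0 < S → lam < 0 → ∀ u : NLS.H1 𝕜 N,
      NLS.IsFundamentalFrequencySolution p q μ S lam u →
        NLS.IsGroundState p q μ lam u ∧ NLS.action p q μ lam u = S) ∧
    (∀ lam : ℝ, lam < 0 → ∀ u : NLS.H1 𝕜 N, NLS.IsGroundState p q μ lam u →
      0 < NLS.action p q μ lam u ∧
      NLS.IsFundamentalFrequencySolution p q μ (NLS.action p q μ lam u) lam u ∧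
      IsLeast (NLS.ngRayleigh p q μ (NLS.action p q μ lam u) '' {v : NLS.H1 𝕜 N | v ≠ 0})
        lam) :=
  ⟨fun _ _ hS hlam _ hu => NLS.isGroundState_of_fundamental hN hp hq hμ hS hlam hu,
    fun _ hlam _ hu => hu.fundamental hN hp hq hμ hlam⟩
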